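/- Let $M$ be a simply connected oriented Riemannian surface with Levi-Civita connection $\nabla$ and complex structure $J$ (rotation by $+\pi/2$), with its spin structure and spinor bundle $\Sigma M$. The fibre $\Sigma_2=\mathbb{H}$ carries the Clifford multiplication in which, in an oriented orthonormal frame $(e_1,e_2)$, $X=x_1e_1+x_2e_2$ acts by left multiplication by $x_1i+x_2j$; $\omega_2=e_1\cdot e_2$ then acts by left multiplication by $k$. $\nabla$ also denotes the induced connection on $\Sigma M$, and $D=\sum_a e_a\cdot\nabla_{e_a}$ the Dirac operator. All data are smooth. The shape operator of an immersion with oriented unit normal $\nu$ is $S=-\nabla^{\mathrm{amb}}\nu$, and $H=\tfrac12\operatorname{tr}S$. (A) (Euclidean space.) For every field $S$ of symmetric endomorphisms of $TM$, the following are equivalent: (1) there is an isometric immersion $M\to\mathbb{R}^3$ with shape operator $S$; (2) there is a nontrivial spinor field $\varphi$ with $\nabla_X\varphi=-\tfrac12 (SX)\cdot\omega_2\cdot\varphi$ for all $X$. Moreover, for every function $H$ on $M$, the following are equivalent: there is a symmetric $S$ with trace $2H$ for which (1) holds; there is a symmetric $S$ with trace $2H$ for which (2) holds; (3) there is a nontrivial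 spinor field $\varphi$ of constant norm with $D\varphi=H\omega_2\cdot\varphi$. (B) (Heisenberg group.) Let $\tau\neq0$ and let $\mathrm{Nil}_3(\tau)$ be the Heisenberg group with the left-invariant metric and orientation for which the left-invariant frame $(E_1,E_2,E_3)$ is oriented and orthonormal, the only nonzero bracket being $[E_1,E_2]=2\tau E_3$. Let $S$ be a field of symmetric endomorphisms of $TM$ with trace $2H$, $T$ a vector field and $\lambda$ a function on $M$ with $\lambda^2+|T|^2=1$. Daniel's equations are $$\nabla_XT=\lambda(SX-\tau JX),\qquad X(\lambda)=-\langle SX-\tau JX,T\rangle\qquad\text{for all }X.$$ The following are equivalent: (1) there is an isometric immersion $M\to\mathrm{Nil}_3(\tau)$ with shape operator $S$ and $E_3=T+\lambda\nu$; (2) Daniel's equations hold, and there is a nontrivial spinor field $\varphi$ with $$\nabla_X\varphi=-\tfrac12(SX)\cdot\omega_2\cdot\varphi+\tfrac{\tau}{2}X\cdot\varphi-\tau\langle X,T\rangle(T\cdot\varphi+\lambda\,\omega_2\cdot\varphi)\qquad\text{for all }X;$$ (3) Daniel's equations hold, and there is a nontrivial spinor field $\varphi$ of constant norm with $$D\varphi=H\omega_2\cdot\varphi-\tau\lambda(\lambda\varphi+T\cdot\omega_2\cdot\varphi)\quad\text{and}\quad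 d\lambda=-2Q_\varphi(T)-B(T)-\tau JT,$$ where $Q_\varphi(X,Y)=\tfrac12\operatorname{Re}\langle X\cdot\omega_2\cdot\nabla_Y\varphi+Y\cdot\omega_2\cdot\nabla_X\varphi,\varphi/|\varphi|^2\rangle$ and $B$ is the symmetric tensor $B(X,Y)=\tau(\langle X,T\rangle\langle JY,T\rangle+\langle JX,T\rangle\langle Y,T\rangle)$, i.e. with matrix $\tau\begin{pmatrix}2T_1T_2&T_2^2-T_1^2\\T_2^2-T_1^2&-2T_1T_2\end{pmatrix}$ in an oriented orthonormal frame. -/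

import Mathlib

open Bundle Manifold VectorField
open scoped ContDiff Quaternion

set_option linter.unusedSectionVars false

noncomputable section

/-! ## The Levi-Civita connection of a Riemannian manifold -/

section LeviCivita

variable {E : Type*} [NormedAddCommGroup E] [NormedSpace ℝ E] [FiniteDimensional ℝ E]
  {H : Type*} [TopologicalSpace H] {I : ModelWithCorners ℝ E H}
  {M : Type*} [TopologicalSpace M] [ChartedSpace H M] [IsManifold I ∞ M]
  [RiemannianBundle (fun x : M => TangentSpace I x)]
  [IsContMDiffRiemannianBundle I ∞ E (fun x : M => TangentSpace I x)]

instance finiteDimensional_tangentSpace (x : M) : FiniteDimensional ℝ (TangentSpace I x) :=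
  inferInstanceAs (FiniteDimensional ℝ E)

/-- The right-hand side of the Koszul formula for `2 ⟨∇_X Y, Z⟩`. -/
def koszul (X Y Z : Π x : M, TangentSpace I x) (x : M) : ℝ :=
  mvfderiv I (fun y => inner ℝ (Y y) (Z y)) x (X x)
    + mvfderiv I (fun y => inner ℝ (X y) (Z y)) x (Y x)
    - mvfderiv I (fun y => inner ℝ (X y) (Y y)) x (Z x)
    + inner ℝ (mlieBracket I X Y x) (Z x)
    - inner ℝ (mlieBracket I X Z x) (Y x)
    - inner ℝ (mlieBracket I Y Z x) (X x)

theorem mdiffAt_inner {x : M} {X Z : Π x : M, TangentSpace I x}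
    (hX : MDiffAt (T% X) x) (hZ : MDiffAt (T% Z) x) :
    MDiffAt (fun y => (inner ℝ (X y) (Z y) : ℝ)) x :=
  MDifferentiableAt.inner_bundle (E := fun x : M => TangentSpace I x) hX hZ

theorem mvfderiv_inner_smul_left {x : M} {f : M → ℝ} {X Z : Π x : M, TangentSpace I x}
    (hf : MDiffAt f x) (hX : MDiffAt (T% X) x) (hZ : MDiffAt (T% Z) x) :
    mvfderiv I (fun y => (inner ℝ ((f • X) y) (Z y) : ℝ)) x
      = f x • mvfderiv I (fun y => (inner ℝ (X y) (Z y) : ℝ)) x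
        + (inner ℝ (X x) (Z x) : ℝ) • mvfderiv I f x := by
  rw [← mvfderiv_fun_mul hf (mdiffAt_inner hX hZ)]
  congr 1; ext y; simp [inner_smul_left]

theorem mvfderiv_inner_add_left {x : M} {X X' Z : Π x : M, TangentSpace I x}
    (hX : MDiffAt (T% X) x) (hX' : MDiffAt (T% X') x) (hZ : MDiffAt (T% Z) x) :
    mvfderiv I (fun y => (inner ℝ ((X + X') y) (Z y) : ℝ)) x
      = mvfderiv I (fun y => (inner ℝ (X y) (Z y) : ℝ)) x
        + mvfderiv I (fun y => (inner ℝ (X' y) (Z y) : ℝ)) x := by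
  rw [← mvfderiv_fun_add (mdiffAt_inner hX hZ) (mdiffAt_inner hX' hZ)]
  congr 1; ext y; simp [inner_add_left]

theorem mvfderiv_inner_comm (X Z : Π x : M, TangentSpace I x) :
    (fun y => (inner ℝ (X y) (Z y) : ℝ)) = (fun y => (inner ℝ (Z y) (X y) : ℝ)) := by
  ext y; exact real_inner_comm _ _

theorem koszul_tensorial_left {x : M} {Y Z : Π x : M, TangentSpace I x}
    (hY : MDiffAt (T% Y) x) (hZ : MDiffAt (T% Z) x) :
    TensorialAt I E (fun X => koszul X Y Z x) x where
  smul {f X} hf hX := by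
    have : CompleteSpace E := FiniteDimensional.complete ℝ E
    simp only [koszul, mvfderiv_inner_smul_left hf hX hZ, mvfderiv_inner_smul_left hf hX hY,
      mlieBracket_smul_left hf hX]
    simp [inner_add_left, inner_smul_left, inner_smul_right, inner_neg_left]
    ring
  add {X X'} hX hX' := by
    have : CompleteSpace E := FiniteDimensional.complete ℝ E
    simp only [koszul, mvfderiv_inner_add_left hX hX' hZ, mvfderiv_inner_add_left hX hX' hY,
      mlieBracket_add_left hX hX']
    simp [inner_add_left, inner_add_right]
    ring

theorem koszul_tensorial_right {x : M} {X Y : Π x : M, TangentSpace I x}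
    (hX : MDiffAt (T% X) x) (hY : MDiffAt (T% Y) x) :
    TensorialAt I E (fun Z => koszul X Y Z x) x where
  smul {f Z} hf hZ := by
    have : CompleteSpace E := FiniteDimensional.complete ℝ E
    simp only [koszul, mvfderiv_inner_comm Y (f • Z), mvfderiv_inner_comm X (f • Z),
      mvfderiv_inner_smul_left hf hZ hX, mvfderiv_inner_smul_left hf hZ hY,
      mlieBracket_smul_right hf hZ, mvfderiv_inner_comm Z]
    simp [inner_add_left, inner_smul_left, inner_smul_right, real_inner_comm (Z x)]
    ring
  add {Z Z'} hZ hZ' := by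
    have : CompleteSpace E := FiniteDimensional.complete ℝ E
    simp only [koszul, mvfderiv_inner_comm Y (Z + Z'), mvfderiv_inner_comm X (Z + Z'),
      mvfderiv_inner_add_left hZ hZ' hX, mvfderiv_inner_add_left hZ hZ' hY,
      mlieBracket_add_right hZ hZ', mvfderiv_inner_comm Z, mvfderiv_inner_comm Z']
    simp [inner_add_left, inner_add_right]
    ring

/-- The Levi-Civita derivative `∇Y` at `x` of a vector field `Y`, as a linear map `X ↦ ∇_X Y`:
the metric dual of half the Koszul form (and `0` where `Y` is not differentiable). -/
def leviCivitaAux (Y : Π x : M, TangentSpace I x) (x : M) :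
    TangentSpace I x →L[ℝ] TangentSpace I x :=
  open Classical in
  if hY : MDiffAt (T% Y) x then
    haveI : CompleteSpace (TangentSpace I x) := FiniteDimensional.complete ℝ _
    LinearMap.toContinuousLinearMap
      { toFun := fun v => (1 / 2 : ℝ) • (InnerProductSpace.toDual ℝ (TangentSpace I x)).symm
          (TensorialAt.mkHom₂ (fun X Z => koszul X Y Z x) x
            (fun _ hZ => koszul_tensorial_left hY hZ)
            (fun _ hX => koszul_tensorial_right hX hY) v)
        map_add' := fun v w => by simp only [map_add, smul_add]
        map_smul' := fun c v => by
          simp only [map_smul, RingHom.id_apply, smul_comm c] }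
  else 0

theorem inner_leviCivitaAux {x : M} {X Y Z : Π x : M, TangentSpace I x}
    (hX : MDiffAt (T% X) x) (hY : MDiffAt (T% Y) x) (hZ : MDiffAt (T% Z) x) :
    inner ℝ (leviCivitaAux Y x (X x)) (Z x) = 1 / 2 * koszul X Y Z x := by
  have : CompleteSpace (TangentSpace I x) := FiniteDimensional.complete ℝ _
  have h := TensorialAt.mkHom₂_apply (fun _ hZ => koszul_tensorial_left hY hZ)
    (fun _ hX => koszul_tensorial_right hX hY) hX hZ
  rw [← h, leviCivitaAux, dif_pos hY]
  simp [inner_smul_left]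

theorem clm_ext_fields {x : M} {A B : TangentSpace I x →L[ℝ] TangentSpace I x}
    (h : ∀ X Z : Π y : M, TangentSpace I y, MDiffAt (T% X) x → MDiffAt (T% Z) x →
      (inner ℝ (A (X x)) (Z x) : ℝ) = inner ℝ (B (X x)) (Z x)) : A = B := by
  ext v
  apply ext_inner_right ℝ
  intro w
  have := h (FiberBundle.extend E v) (FiberBundle.extend E w)
    (FiberBundle.mdifferentiableAt_extend I E (V := fun x : M => TangentSpace I x) v)
    (FiberBundle.mdifferentiableAt_extend I E (V := fun x : M => TangentSpace I x) w)
  simpa using this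

/-- The Levi-Civita connection of the Riemannian manifold `M`. -/
def leviCivita : CovariantDerivative I E (fun x : M => TangentSpace I x) where
  toFun := leviCivitaAux
  isCovariantDerivativeOnUniv :=
    { add := fun {Y Y' x} hY hY' _ => by
        have : CompleteSpace E := FiniteDimensional.complete ℝ E
        refine clm_ext_fields fun X Z hX hZ => ?_
        rw [add_apply, inner_add_left,
          inner_leviCivitaAux hX hY hZ, inner_leviCivitaAux hX hY' hZ,
          inner_leviCivitaAux hX (mdifferentiableAt_add_section hY hY') hZ]
        simp only [koszul, mvfderiv_inner_add_left hY hY' hZ, mvfderiv_inner_comm X (Y + Y'),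
          mvfderiv_inner_add_left hY hY' hX, mlieBracket_add_left hY hY',
          mlieBracket_add_right hY hY', mvfderiv_inner_comm X Y, mvfderiv_inner_comm X Y']
        simp [inner_add_left, inner_add_right]
        ring
      leibniz := fun {Y g x} hY hg _ => by
        have : CompleteSpace E := FiniteDimensional.complete ℝ E
        refine clm_ext_fields fun X Z hX hZ => ?_
        rw [add_apply, inner_add_left, smul_apply,
          inner_smul_left, inner_leviCivitaAux hX hY hZ,
          inner_leviCivitaAux hX (hg.smul_section hY) hZ]
        simp only [koszul, mvfderiv_inner_smul_left hg hY hZ, mvfderiv_inner_comm X (g • Y),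
          mvfderiv_inner_smul_left hg hY hX, mlieBracket_smul_left hg hY,
          mlieBracket_smul_right hg hY, mvfderiv_inner_comm X Y]
        simp [inner_add_left, inner_add_right, inner_smul_left, inner_smul_right, inner_neg_right,
          real_inner_comm (X x)]
        ring }

theorem inner_leviCivita {x : M} {X Y Z : Π x : M, TangentSpace I x}
    (hX : MDiffAt (T% X) x) (hY : MDiffAt (T% Y) x) (hZ : MDiffAt (T% Z) x) :
    inner ℝ (leviCivita Y x (X x)) (Z x) = 1 / 2 * koszul X Y Z x :=
  inner_leviCivitaAux hX hY hZ

theorem leviCivita_metric {x : M} {X Y Z : Π x : M, TangentSpace I x}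
    (hX : MDiffAt (T% X) x) (hY : MDiffAt (T% Y) x) (hZ : MDiffAt (T% Z) x) :
    mvfderiv I (fun y => (inner ℝ (Y y) (Z y) : ℝ)) x (X x)
      = inner ℝ (leviCivita Y x (X x)) (Z x) + inner ℝ (Y x) (leviCivita Z x (X x)) := by
  rw [inner_leviCivita hX hY hZ, real_inner_comm _ (Y x), inner_leviCivita hX hZ hY]
  simp only [koszul, mlieBracket_swap_apply (V := Z) (W := Y), mvfderiv_inner_comm Z Y]
  simp
  ring

theorem leviCivita_torsion : (leviCivita (I := I) (M := M)).torsion = 0 := by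
  rw [CovariantDerivative.torsion_eq_zero_iff]
  intro X Y x hX hY
  apply ext_inner_right ℝ
  intro w
  have hZ := FiberBundle.mdifferentiableAt_extend I E (V := fun x : M => TangentSpace I x) w
  rw [← FiberBundle.extend_apply_self E w, inner_sub_left, inner_leviCivita hX hY hZ,
    inner_leviCivita hY hX hZ]
  simp only [koszul, mlieBracket_swap_apply (V := Y) (W := X), mvfderiv_inner_comm Y X]
  simp
  ring

end LeviCivita

/-! ## The Heisenberg group -/

/-- Euclidean space `ℝ³`. -/
abbrev R3 : Type := EuclideanSpace ℝ (Fin 3)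

namespace Nil3

/-- The group law of `Nil₃(τ)` on `ℝ³`. -/
def mul (τ : ℝ) (p q : R3) : R3 :=
  !₂[p 0 + q 0, p 1 + q 1, p 2 + q 2 + τ * (p 0 * q 1 - p 1 * q 0)]

/-- The left-invariant vector field on `Nil₃(τ)` with value `a` at the identity:
`a₀ E₁ + a₁ E₂ + a₂ E₃`, where `E₁ = ∂₀ - τ x₁ ∂₂`, `E₂ = ∂₁ + τ x₀ ∂₂`, `E₃ = ∂₂`. -/
def leftInv (τ : ℝ) (a p : R3) : R3 :=
  !₂[a 0, a 1, a 2 + τ * (p 0 * a 1 - p 1 * a 0)]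

/-- The coordinates of a tangent vector `w` at the point `p` of `Nil₃(τ)` in the left-invariant
frame `(E₁, E₂, E₃)`, that is, the value at `w` of the Maurer-Cartan form. -/
def mc (τ : ℝ) (p w : R3) : R3 :=
  !₂[w 0, w 1, w 2 - τ * (p 0 * w 1 - p 1 * w 0)]

/-- The left-invariant Riemannian metric of `Nil₃(τ)` for which `(E₁, E₂, E₃)` is orthonormal. -/
def metric (τ : ℝ) (p v w : R3) : ℝ := inner ℝ (mc τ p v) (mc τ p w)

/-- The Lie bracket of `𝔫𝔦𝔩₃(τ)`, with `[E₁, E₂] = 2 τ E₃`. -/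
def bracket (τ : ℝ) (a b : R3) : R3 := !₂[0, 0, 2 * τ * (a 0 * b 1 - a 1 * b 0)]

/-- The Levi-Civita connection `∇_a b` of `Nil₃(τ)` on left-invariant vector fields. -/
def conn (τ : ℝ) (a b : R3) : R3 :=
  !₂[τ * (a 1 * b 2 + a 2 * b 1), -(τ * (a 0 * b 2 + a 2 * b 0)), τ * (a 0 * b 1 - a 1 * b 0)]

theorem mul_assoc (τ : ℝ) (p q r : R3) : mul τ (mul τ p q) r = mul τ p (mul τ q r) := by
  ext i; fin_cases i <;> simp [mul] <;> ring

theorem mul_zero (τ : ℝ) (p : R3) : mul τ p 0 = p ∧ mul τ 0 p = p := by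
  constructor <;> ext i <;> fin_cases i <;> simp [mul]

theorem mul_neg (τ : ℝ) (p : R3) : mul τ p (-p) = 0 ∧ mul τ (-p) p = 0 := by
  constructor <;> ext i <;> fin_cases i <;> simp [mul, mul_comm]

theorem mc_leftInv (τ : ℝ) (a p : R3) : mc τ p (leftInv τ a p) = a := by
  ext i; fin_cases i <;> simp [mc, leftInv]

theorem leftInv_mc (τ : ℝ) (w p : R3) : leftInv τ (mc τ p w) p = w := by
  ext i; fin_cases i <;> simp [mc, leftInv]

/-- `leftInv` is obtained from its value at the identity by left translation. -/
theorem hasDerivAt_mul (τ : ℝ) (a p : R3) :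
    HasDerivAt (fun t : ℝ => mul τ p (t • a)) (leftInv τ a p) 0 := by
  have h : (fun t : ℝ => mul τ p (t • a)) = fun t : ℝ => p + t • leftInv τ a p := by
    ext t i; fin_cases i <;> simp [mul, leftInv]; ring
  rw [h]
  simpa using ((hasDerivAt_id (0 : ℝ)).smul_const (leftInv τ a p)).const_add p

theorem fderiv_leftInv (τ : ℝ) (a p w : R3) :
    fderiv ℝ (leftInv τ a) p w = !₂[0, 0, τ * (w 0 * a 1 - w 1 * a 0)] := by
  let L : R3 →ₗ[ℝ] R3 :=
    { toFun := fun w => !₂[0, 0, τ * (w 0 * a 1 - w 1 * a 0)]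
      map_add' := fun v w => by ext i; fin_cases i <;> simp; ring
      map_smul' := fun c w => by ext i; fin_cases i <;> simp; ring }
  have h : leftInv τ a = fun p => a + LinearMap.toContinuousLinearMap L p := by
    ext p i; fin_cases i <;> simp [leftInv, L]
  rw [h, fderiv_const_add, ContinuousLinearMap.fderiv]
  rfl

theorem lieBracket_leftInv (τ : ℝ) (a b p : R3) :
    lieBracket ℝ (leftInv τ a) (leftInv τ b) p = leftInv τ (bracket τ a b) p := by
  rw [lieBracket, fderiv_leftInv, fderiv_leftInv]
  ext i; fin_cases i <;> simp [leftInv, bracket]; ring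

theorem conn_torsion_free (τ : ℝ) (a b : R3) : conn τ a b - conn τ b a = bracket τ a b := by
  ext i; fin_cases i <;> simp [conn, bracket] <;> ring

theorem conn_metric (τ : ℝ) (a b c : R3) :
    inner ℝ (conn τ a b) c + inner ℝ b (conn τ a c) = (0 : ℝ) := by
  simp [conn, PiLp.inner_apply, Fin.sum_univ_three]; ring

end Nil3

/-! ## Oriented Riemannian surfaces -/

section Surface

variable {M : Type*} [TopologicalSpace M] [ChartedSpace (EuclideanSpace ℝ (Fin 2)) M]
  [IsManifold (𝓡 2) ∞ M]
  [RiemannianBundle (fun x : M => TangentSpace (𝓡 2) x)]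
  [IsContMDiffRiemannianBundle (𝓡 2) ∞ (EuclideanSpace ℝ (Fin 2))
    (fun x : M => TangentSpace (𝓡 2) x)]

instance fact_finrank_tangentSpace (x : M) :
    Fact (Module.finrank ℝ (TangentSpace (𝓡 2) x) = 2) :=
  ⟨(finrank_euclideanSpace_fin : Module.finrank ℝ (EuclideanSpace ℝ (Fin 2)) = 2)⟩

/-- `(e 0, e 1)` is a smooth orthonormal frame over `U`, positively oriented for the orientations
`o x` of the tangent planes (`e 1` is the rotation of `e 0` by a positive right angle). -/
def IsOrientedFrameOn (o : ∀ x : M, Orientation ℝ (TangentSpace (𝓡 2) x) (Fin 2))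
    (e : Fin 2 → Π x : M, TangentSpace (𝓡 2) x) (U : Set M) : Prop :=
  (∀ i, ContMDiffOn (𝓡 2) (𝓡 2).tangent ∞ (fun x => (⟨x, e i x⟩ : TangentBundle (𝓡 2) M)) U) ∧
    ∀ x ∈ U, Orthonormal ℝ (fun i => e i x) ∧ e 1 x = (o x).rightAngleRotation (e 0 x)

variable (M) in
/-- An orientation of the surface `M`: orientations of the tangent planes which, locally, are given
by smooth frames. -/
structure SurfaceOrientation where
  at_point : ∀ x : M, Orientation ℝ (TangentSpace (𝓡 2) x) (Fin 2)
  exists_frame : ∀ x : M, ∃ U : Set M, IsOpen U ∧ x ∈ U ∧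
    ∃ e : Fin 2 → Π x : M, TangentSpace (𝓡 2) x, IsOrientedFrameOn at_point e U

/-- The complex structure `J` of an oriented Riemannian surface: rotation by a positive right
angle. -/
def SurfaceOrientation.J (o : SurfaceOrientation M) (x : M) (X : TangentSpace (𝓡 2) x) :
    TangentSpace (𝓡 2) x :=
  (o.at_point x).rightAngleRotation X

/-- Smooth vector fields. -/
def IsSmoothField (T : Π x : M, TangentSpace (𝓡 2) x) : Prop :=
  ContMDiff (𝓡 2) (𝓡 2).tangent ∞ (fun x => (⟨x, T x⟩ : TangentBundle (𝓡 2) M))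

/-- Smooth fields of symmetric endomorphisms of the tangent planes. -/
def IsSymmetricField (S : Π x : M, TangentSpace (𝓡 2) x →L[ℝ] TangentSpace (𝓡 2) x) : Prop :=
  ContMDiff (𝓡 2) ((𝓡 2).prod 𝓘(ℝ, EuclideanSpace ℝ (Fin 2) →L[ℝ] EuclideanSpace ℝ (Fin 2))) ∞
    (fun x => TotalSpace.mk' (EuclideanSpace ℝ (Fin 2) →L[ℝ] EuclideanSpace ℝ (Fin 2))
      (E := fun x : M => TangentSpace (𝓡 2) x →L[ℝ] TangentSpace (𝓡 2) x) x (S x)) ∧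
    ∀ (x : M) (X Y : TangentSpace (𝓡 2) x), (inner ℝ (S x X) Y : ℝ) = inner ℝ X (S x Y)

/-- `H = (tr S) / 2`. -/
def meanCurvature (S : Π x : M, TangentSpace (𝓡 2) x →L[ℝ] TangentSpace (𝓡 2) x) (x : M) : ℝ :=
  LinearMap.trace ℝ (TangentSpace (𝓡 2) x) (S x).toLinearMap / 2

/-- `∇_X T = λ (S X - τ J X)` and `X(λ) = - ⟨S X - τ J X, T⟩` for all tangent vectors `X`. -/
def DanielEquations (o : SurfaceOrientation M) (τ : ℝ)
    (S : Π x : M, TangentSpace (𝓡 2) x →L[ℝ] TangentSpace (𝓡 2) x)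
    (T : Π x : M, TangentSpace (𝓡 2) x) (lam : M → ℝ) : Prop :=
  ∀ (x : M) (X : TangentSpace (𝓡 2) x),
    leviCivita T x X = lam x • (S x X - τ • o.J x X) ∧
      mvfderiv (𝓡 2) lam x X = - inner ℝ (S x X - τ • o.J x X) (T x)

/-! ## Isometric immersions into `ℝ³` and `Nil₃(τ)` -/

/-- `(a, b, c)` is a positively oriented basis of `ℝ³`. -/
def PositivelyOriented (a b c : R3) : Prop :=
  0 < (Matrix.of ![a.ofLp, b.ofLp, c.ofLp]).det

/-- `f` is an isometric immersion of `M` into `ℝ³`, with oriented unit normal `nu` and shape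
operator `S = - d nu`. -/
structure IsImmersionR3 (o : SurfaceOrientation M)
    (S : Π x : M, TangentSpace (𝓡 2) x →L[ℝ] TangentSpace (𝓡 2) x) (f nu : M → R3) : Prop where
  smooth_f : ContMDiff (𝓡 2) (𝓡 3) ∞ f
  smooth_nu : ContMDiff (𝓡 2) (𝓡 3) ∞ nu
  isometric : ∀ (x : M) (X Y : TangentSpace (𝓡 2) x),
    (inner ℝ (mvfderiv (𝓡 2) f x X) (mvfderiv (𝓡 2) f x Y) : ℝ) = inner ℝ X Y
  unit : ∀ x, ‖nu x‖ = 1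
  normal : ∀ (x : M) (X : TangentSpace (𝓡 2) x),
    (inner ℝ (mvfderiv (𝓡 2) f x X) (nu x) : ℝ) = 0
  oriented : ∀ (x : M) (X : TangentSpace (𝓡 2) x), X ≠ 0 →
    PositivelyOriented (mvfderiv (𝓡 2) f x X) (mvfderiv (𝓡 2) f x (o.J x X)) (nu x)
  shape : ∀ (x : M) (X : TangentSpace (𝓡 2) x),
    mvfderiv (𝓡 2) nu x X = - mvfderiv (𝓡 2) f x (S x X)

/-- The differential `df(X)` of a map into `Nil₃(τ)`, expressed in the left-invariant frame
`(E₁, E₂, E₃)`, that is, `(f⁻¹ df)(X)`. -/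
def nilDeriv (τ : ℝ) (f : M → R3) (x : M) (X : TangentSpace (𝓡 2) x) : R3 :=
  Nil3.mc τ (f x) (mvfderiv (𝓡 2) f x X)

/-- The Levi-Civita derivative of `Nil₃(τ)`, in the direction of `X`, of a vector field along `f`
whose components in the left-invariant frame are given by `nu`. -/
def nilCov (τ : ℝ) (f nu : M → R3) (x : M) (X : TangentSpace (𝓡 2) x) : R3 :=
  mvfderiv (𝓡 2) nu x X + Nil3.conn τ (nilDeriv τ f x X) (nu x)

/-- `f` is an isometric immersion of `M` into `Nil₃(τ)` with shape operator `S`, and with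
`E₃ = T + λ ν` where `ν` is the oriented unit normal. The components of `ν` in the left-invariant
frame are given by `nu`. -/
structure IsImmersionNil3 (o : SurfaceOrientation M) (τ : ℝ)
    (S : Π x : M, TangentSpace (𝓡 2) x →L[ℝ] TangentSpace (𝓡 2) x)
    (T : Π x : M, TangentSpace (𝓡 2) x) (lam : M → ℝ) (f nu : M → R3) : Prop where
  smooth_f : ContMDiff (𝓡 2) (𝓡 3) ∞ f
  smooth_nu : ContMDiff (𝓡 2) (𝓡 3) ∞ nu
  isometric : ∀ (x : M) (X Y : TangentSpace (𝓡 2) x),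
    Nil3.metric τ (f x) (mvfderiv (𝓡 2) f x X) (mvfderiv (𝓡 2) f x Y) = inner ℝ X Y
  unit : ∀ x, ‖nu x‖ = 1
  normal : ∀ (x : M) (X : TangentSpace (𝓡 2) x), (inner ℝ (nilDeriv τ f x X) (nu x) : ℝ) = 0
  oriented : ∀ (x : M) (X : TangentSpace (𝓡 2) x), X ≠ 0 →
    PositivelyOriented (nilDeriv τ f x X) (nilDeriv τ f x (o.J x X)) (nu x)
  shape : ∀ (x : M) (X : TangentSpace (𝓡 2) x),
    nilCov τ f nu x X = - nilDeriv τ f x (S x X)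
  vertical : ∀ x, nilDeriv τ f x (T x) + lam x • nu x = !₂[0, 0, 1]

/-! ## Spinors -/

/-- The quaternion `x₁ i + x₂ j`, where `x₁, x₂` are the coordinates of the tangent vector `X` in
the orthonormal frame `e`. -/
def frameCoord (e : Fin 2 → Π x : M, TangentSpace (𝓡 2) x) (x : M) (X : TangentSpace (𝓡 2) x) :
    ℍ[ℝ] :=
  ⟨0, inner ℝ (e 0 x) X, inner ℝ (e 1 x) X, 0⟩

/-- The quaternion `k = i j`; left multiplication by it is Clifford multiplication by the real
volume element `ω₂ = e₁ · e₂`. -/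
def omega2 : ℍ[ℝ] := ⟨0, 0, 0, 1⟩

/-- A spin structure on an oriented Riemannian surface, as a cocycle with values in
`Spin(2) = {cos a + sin a k}` which lifts the transition maps between local oriented orthonormal
frames: if `x₁ i + x₂ j` are the coordinates of a tangent vector in the frame `j`, then its
coordinates in the frame `i` are `g (x₁ i + x₂ j) g⁻¹`, where `g = trans i j`. -/
structure SpinStructure (o : SurfaceOrientation M) where
  ι : Type*
  U : ι → Set M
  isOpen_U : ∀ i, IsOpen (U i)
  cover : ∀ x : M, ∃ i, x ∈ U i
  frame : ι → Fin 2 → Π x : M, TangentSpace (𝓡 2) x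
  isFrame : ∀ i, IsOrientedFrameOn o.at_point (frame i) (U i)
  trans : ι → ι → M → ℍ[ℝ]
  smooth_trans : ∀ i j, ContMDiffOn (𝓡 2) 𝓘(ℝ, ℍ[ℝ]) ∞ (trans i j) (U i ∩ U j)
  mem_spin : ∀ i j, ∀ x ∈ U i ∩ U j, ∃ a : ℝ, trans i j x = ⟨Real.cos a, 0, 0, Real.sin a⟩
  cocycle : ∀ i j l, ∀ x ∈ U i ∩ U j ∩ U l, trans i j x * trans j l x = trans i l x
  lift : ∀ i j, ∀ x ∈ U i ∩ U j, ∀ X : TangentSpace (𝓡 2) x,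
    frameCoord (frame i) x X = trans i j x * frameCoord (frame j) x X * star (trans i j x)

/-- A smooth spinor field, section of the bundle associated with the representation of `Spin(2)` on
`Σ₂ = ℍ` by left multiplication: its components `v i` in the local spin frames satisfy
`v i = trans i j * v j`. -/
structure SpinorField {o : SurfaceOrientation M} (σ : SpinStructure o) where
  v : σ.ι → M → ℍ[ℝ]
  smooth_v : ∀ i, ContMDiffOn (𝓡 2) 𝓘(ℝ, ℍ[ℝ]) ∞ (v i) (σ.U i)
  compat : ∀ i j, ∀ x ∈ σ.U i ∩ σ.U j, v i x = σ.trans i j x * v j x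

namespace SpinorField

variable {o : SurfaceOrientation M} {σ : SpinStructure o}

/-- The spinor field does not vanish identically. -/
def Nontrivial (φ : SpinorField σ) : Prop := ∃ i, ∃ x ∈ σ.U i, φ.v i x ≠ 0

/-- `|φ|` is constant. -/
def ConstNorm (φ : SpinorField σ) : Prop := ∃ c : ℝ, ∀ i, ∀ x ∈ σ.U i, ‖φ.v i x‖ = c

/-- Clifford multiplication by the tangent vector `X`, in the spin frame `i`. -/
def cl (σ : SpinStructure o) (i : σ.ι) (x : M) (X : TangentSpace (𝓡 2) x) (q : ℍ[ℝ]) : ℍ[ℝ] :=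
  frameCoord (σ.frame i) x X * q

/-- The spinorial Levi-Civita connection `∇_X φ = X v + (1 / 2) ⟨∇_X e₁, e₂⟩ ω₂ · v`, in the spin
frame `i`. -/
def nabla (φ : SpinorField σ) (i : σ.ι) (x : M) (X : TangentSpace (𝓡 2) x) : ℍ[ℝ] :=
  mvfderiv (𝓡 2) (φ.v i) x X
    + (1 / 2 * inner ℝ (leviCivita (σ.frame i 0) x X) (σ.frame i 1 x) : ℝ) • (omega2 * φ.v i x)

/-- The Dirac operator `D φ = ∑ₐ eₐ · ∇_{eₐ} φ`, in the spin frame `i`. -/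
def dirac (φ : SpinorField σ) (i : σ.ι) (x : M) : ℍ[ℝ] :=
  ∑ a : Fin 2, cl σ i x (σ.frame i a x) (φ.nabla i x (σ.frame i a x))

/-- `∇_X φ = - (1 / 2) (S X) · ω₂ · φ` for all `X`. -/
def IsConstantR3 (S : Π x : M, TangentSpace (𝓡 2) x →L[ℝ] TangentSpace (𝓡 2) x)
    (φ : SpinorField σ) : Prop :=
  ∀ i, ∀ x ∈ σ.U i, ∀ X : TangentSpace (𝓡 2) x,
    φ.nabla i x X = -((1 / 2 : ℝ) • cl σ i x (S x X) (omega2 * φ.v i x))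

/-- `∇_X φ = - (1 / 2) (S X) · ω₂ · φ + (τ / 2) X · φ - τ ⟨X, T⟩ (T · φ + λ ω₂ · φ)` for
all `X`. -/
def IsConstantNil3 (τ : ℝ) (S : Π x : M, TangentSpace (𝓡 2) x →L[ℝ] TangentSpace (𝓡 2) x)
    (T : Π x : M, TangentSpace (𝓡 2) x) (lam : M → ℝ) (φ : SpinorField σ) : Prop :=
  ∀ i, ∀ x ∈ σ.U i, ∀ X : TangentSpace (𝓡 2) x,
    φ.nabla i x X = -((1 / 2 : ℝ) • cl σ i x (S x X) (omega2 * φ.v i x))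
      + (τ / 2) • cl σ i x X (φ.v i x)
      - (τ * inner ℝ X (T x)) • (cl σ i x (T x) (φ.v i x) + lam x • (omega2 * φ.v i x))

/-- `D φ = H ω₂ · φ`. -/
def IsDiracR3 (H : M → ℝ) (φ : SpinorField σ) : Prop :=
  ∀ i, ∀ x ∈ σ.U i, φ.dirac i x = H x • (omega2 * φ.v i x)

/-- `D φ = H ω₂ · φ - τ λ (λ φ + T · ω₂ · φ)`. -/
def IsDiracNil3 (τ : ℝ) (H : M → ℝ) (T : Π x : M, TangentSpace (𝓡 2) x) (lam : M → ℝ)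
    (φ : SpinorField σ) : Prop :=
  ∀ i, ∀ x ∈ σ.U i, φ.dirac i x = H x • (omega2 * φ.v i x)
    - (τ * lam x) • (lam x • φ.v i x + cl σ i x (T x) (omega2 * φ.v i x))

/-- The energy-momentum tensor
`Q(X, Y) = (1 / 2) Re ⟨X · ω₂ · ∇_Y φ + Y · ω₂ · ∇_X φ, φ / |φ|²⟩`, in the spin frame `i`. -/
def energyMomentum (φ : SpinorField σ) (i : σ.ι) (x : M) (X Y : TangentSpace (𝓡 2) x) : ℝ :=
  1 / 2 * inner ℝ (cl σ i x X (omega2 * φ.nabla i x Y) + cl σ i x Y (omega2 * φ.nabla i x X))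
    ((1 / ‖φ.v i x‖ ^ 2 : ℝ) • φ.v i x)

/-- The symmetric tensor `B(X, Y) = τ (⟨X, T⟩ ⟨J Y, T⟩ + ⟨J X, T⟩ ⟨Y, T⟩)`. -/
def tensorB (o : SurfaceOrientation M) (τ : ℝ) (T : Π x : M, TangentSpace (𝓡 2) x) (x : M)
    (X Y : TangentSpace (𝓡 2) x) : ℝ :=
  τ * (inner ℝ X (T x) * inner ℝ (o.J x Y) (T x) + inner ℝ (o.J x X) (T x) * inner ℝ Y (T x))

/-- `dλ = - 2 Q(T) - B(T) - τ J T`. -/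
def DLambdaCondition (τ : ℝ) (T : Π x : M, TangentSpace (𝓡 2) x) (lam : M → ℝ)
    (φ : SpinorField σ) : Prop :=
  ∀ i, ∀ x ∈ σ.U i, ∀ X : TangentSpace (𝓡 2) x,
    mvfderiv (𝓡 2) lam x X = - 2 * φ.energyMomentum i x (T x) X - tensorB o τ T x (T x) X
      - τ * inner ℝ (o.J x (T x)) X

end SpinorField

end Surface

end

/-! A unit spinor field is a moving frame in disguise. In a spin frame it is a function v with
values in the unit quaternions, and q ↦ `star v * q * v` carries the tangent plane, spanned by i and
j, and the normal direction k into Im ℍ = ℝ³. The resulting 1-form `SpinorField.form` and function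
`SpinorField.normal` do not depend on the spin frame. If ∇_X φ = A(X) φ with A(X) imaginary, then
|φ| is constant, and the derivatives of `form` and `normal` involve only the Levi-Civita connection
and conjugated commutators with A(X). For the potential A of the theorem (`connTerm`) these are the
Gauss and Weingarten formulas for the shape operator S. Euclidean space is the case τ = 0, with T =
0 and λ = 0.

From spinors to immersions: in the left-invariant frame of Nil₃(τ), ∇_a b = (τ/2)[a - 2a₃k, b],
while the spinor equation produces X - 2⟨X,T⟩(T + λν) in place of a - 2a₃k. The two agree once T +
λν, read through φ, equals k. Daniel's equations make this field constant (`mvfderiv_vert`), and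
right multiplication of φ by a constant unit quaternion rotates it to k. Symmetry of S and vanishing
torsion then give the Maurer-Cartan equation for `form`, which integrates to an immersion because M
is simply connected (`exists_nilDeriv_eq`).

From immersions to spinors: the frame (df e₁, df e₂, ν), translated to the identity, lifts locally
to unit quaternions, uniquely up to sign. The signs form a locally constant cocycle, trivial on a
simply connected surface, so the lifts glue to a spinor field (`SpinorField.exists_form_eq`). The
Gauss formula determines the commutators of A(X) with i and j, hence A(X) up to a real number, and
|φ| = 1 removes the real part.

Dirac equations: constant norm leaves two imaginary quaternions A(e₁), A(e₂), that is six real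
unknowns, of which the Dirac equation fixes four (`dirac_eq_iff`). In ℝ³ it says that the second
fundamental form of `normal` is symmetric with trace 2H and that A has no k-component, so this form
serves as S. In Nil₃(τ), S is given, and the two missing numbers are the entries of the symmetric
trace-free tensor S - 2Q - B. Comparing the condition on dλ with Daniel's equations shows that this
tensor kills T, so it vanishes wherever T ≠ 0. On an open set where T = 0, S would equal τJ, which
is not symmetric; hence T ≠ 0 on a dense set and continuity concludes. -/

noncomputable section

/-! ### Locally constant cocycles on simply connected spaces -/

section Cocycles

open Topology

/-- The fibre bundle with discrete fibre `G` defined by a locally constant cocycle. -/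
def cocycleBundleCore {X ι G : Type*} [TopologicalSpace X] [Group G] [TopologicalSpace G]
    [DiscreteTopology G] (U : ι → Set X) (hU : ∀ i, IsOpen (U i)) (ix : X → ι)
    (hix : ∀ x, x ∈ U (ix x)) (c : ι → ι → X → G)
    (hc : ∀ i j, ∀ x ∈ U i ∩ U j, ∀ᶠ y in 𝓝 x, c i j y = c i j x)
    (hcoc : ∀ i j l, ∀ x ∈ U i ∩ U j ∩ U l, c i j x * c j l x = c i l x) :
    FiberBundleCore ι X G where
  baseSet := U
  isOpen_baseSet := hU
  indexAt := ix
  mem_baseSet_at := hix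
  coordChange i j x v := c j i x * v
  coordChange_self i x hx v := by
    -- `c i i x` is idempotent, hence 1 in a group. The indices in `coordChange` are swapped because
    -- it goes from chart i to chart j.
    have h := hcoc i i i x ⟨⟨hx, hx⟩, hx⟩
    rw [mul_eq_left.mp h, one_mul]
  continuousOn_coordChange i j := by
    rintro ⟨x, g⟩ ⟨hx, -⟩
    have h := hc j i x hx.symm
    have h1 : ContinuousAt (fun p : X × G => c j i x * p.2) (x, g) := by fun_prop
    refine ContinuousAt.continuousWithinAt (h1.congr ?_)
    have h2 : ∀ᶠ p : X × G in 𝓝 (x, g), c j i p.1 = c j i x :=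
      (continuous_fst.tendsto (x, g)).eventually h
    filter_upwards [h2] with p hp
    rw [hp]
  coordChange_comp i j k x hx v := by
    rw [← mul_assoc, hcoc k j i x ⟨⟨hx.2, hx.1.2⟩, hx.1.1⟩]

/-- On a simply connected, locally path connected space, every locally constant cocycle with
values in a group is a coboundary. -/
theorem exists_coboundary_of_cocycle {X ι G : Type*} [TopologicalSpace X] [SimplyConnectedSpace X]
    [LocallyPathConnectedSpace X] [Group G] (U : ι → Set X) (hU : ∀ i, IsOpen (U i))
    (hcov : ∀ x, ∃ i, x ∈ U i) (c : ι → ι → X → G)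
    (hc : ∀ i j, ∀ x ∈ U i ∩ U j, ∀ᶠ y in 𝓝 x, c i j y = c i j x)
    (hcoc : ∀ i j l, ∀ x ∈ U i ∩ U j ∩ U l, c i j x * c j l x = c i l x) :
    ∃ s : ι → X → G, (∀ i, ∀ x ∈ U i, ∀ᶠ y in 𝓝 x, s i y = s i x) ∧
      ∀ i j, ∀ x ∈ U i ∩ U j, s i x = c i j x * s j x := by
  choose ix hix using hcov
  let : TopologicalSpace G := ⊥
  have : DiscreteTopology G := ⟨rfl⟩
  set Z := cocycleBundleCore U hU ix hix c hc hcoc with hZ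
  -- A bundle with discrete fibre is a covering. The identity of the simply connected base lifts to
  -- it, and the fibre components of this global section are the locally constant s i.
  have hcov : IsCoveringMap (Bundle.TotalSpace.proj : Z.TotalSpace → X) :=
    FiberBundle.isCoveringMap (F := G) (E := Z.Fiber)
  obtain ⟨x₀⟩ : Nonempty X := inferInstance
  obtain ⟨F, ⟨-, hF⟩, -⟩ := hcov.existsUnique_continuousMap_lifts (ContinuousMap.id X) x₀
    (⟨x₀, (1 : G)⟩ : Z.TotalSpace) rfl
  have hF' : ∀ x, (F x).proj = x := fun x => congrFun hF x
  refine ⟨fun i x => (Z.localTriv i (F x)).2, fun i x hx => ?_, fun i j x hx => ?_⟩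
  · have h1 : ContinuousAt (Z.localTriv i) (F x) := by
      apply (Z.localTriv i).continuousAt
      rw [Z.mem_localTriv_source, hF']
      exact hx
    have h2 : ContinuousAt (fun y => (Z.localTriv i (F y)).2) x :=
      continuousAt_snd.comp (h1.comp F.continuous.continuousAt)
    have := h2.eventually (IsOpen.mem_nhds (isOpen_discrete {(Z.localTriv i (F x)).2}) rfl)
    exact this
  · simp only [Z.localTriv_apply, hF']
    change c i (ix x) x * (show G from (F x).2) = c i j x * (c j (ix x) x * (show G from (F x).2))
    rw [← mul_assoc, hcoc i j (ix x) x ⟨hx, hix x⟩]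

end Cocycles

/-! ### Derivatives of vector-valued functions and the Lie bracket in charts -/

section Calculus

open Topology

variable {E : Type*} [NormedAddCommGroup E] [NormedSpace ℝ E]
  {H : Type*} [TopologicalSpace H] {I : ModelWithCorners ℝ E H}
  {M : Type*} [TopologicalSpace M] [ChartedSpace H M]
  {F : Type*} [NormedAddCommGroup F] [NormedSpace ℝ F]
  {G : Type*} [NormedAddCommGroup G] [NormedSpace ℝ G]
  {K : Type*} [NormedAddCommGroup K] [NormedSpace ℝ K]

theorem mvfderiv_comp_of_hasFDerivAt {h : M → F} {x : M} (hh : MDiffAt h x) {g : F → G}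
    {g' : F →L[ℝ] G} (hg : HasFDerivAt g g' (h x)) :
    mvfderiv I (fun y => g (h y)) x = g' ∘L mvfderiv I h x := by
  have h1 : HasMFDerivAt 𝓘(ℝ, F) 𝓘(ℝ, G) g (h x) g' := hg.hasMFDerivAt
  have h2 := (h1.comp x hh.hasMFDerivAt).mfderiv
  ext v
  exact DFunLike.congr_fun h2 v

theorem mvfderiv_clm_comp {h : M → F} {x : M} (hh : MDiffAt h x) (L : F →L[ℝ] G)
    (X : TangentSpace I x) :
    mvfderiv I (fun y => L (h y)) x X = L (mvfderiv I h x X) := by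
  rw [mvfderiv_comp_of_hasFDerivAt hh L.hasFDerivAt]
  rfl

theorem mvfderiv_bilinear (B : F →L[ℝ] G →L[ℝ] K) {f : M → F} {g : M → G} {x : M}
    (hf : MDiffAt f x) (hg : MDiffAt g x) (X : TangentSpace I x) :
    mvfderiv I (fun y => B (f y) (g y)) x X
      = B (mvfderiv I f x X) (g x) + B (f x) (mvfderiv I g x X) := by
  have h1 := B.hasFDerivAt_of_bilinear (hasFDerivAt_fst (𝕜 := ℝ) (p := (f x, g x)))
    (hasFDerivAt_snd (𝕜 := ℝ) (p := (f x, g x)))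
  have h2 : HasMFDerivAt 𝓘(ℝ, F × G) 𝓘(ℝ, K) _ (f x, g x) _ := h1.hasMFDerivAt
  have h3 : HasMFDerivAt I 𝓘(ℝ, F × G) (fun y => (f y, g y)) x _ :=
    ⟨hf.hasMFDerivAt.1.prodMk hg.hasMFDerivAt.1, hf.hasMFDerivAt.2.prodMk hg.hasMFDerivAt.2⟩
  have h4 := (HasMFDerivAt.comp x h2 h3).mfderiv
  have h5 := DFunLike.congr_fun h4 X
  refine h5.trans ?_
  change B (f x) (mvfderiv I g x X) + B (mvfderiv I f x X) (g x) = _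
  rw [add_comm]

theorem Filter.EventuallyEq.mvfderiv_eq {h k : M → F} {x : M} (hk : h =ᶠ[𝓝 x] k) :
    mvfderiv I h x = mvfderiv I k x := by
  have h1 := hk.mfderiv_eq (I := I) (I' := 𝓘(ℝ, F))
  ext v
  exact DFunLike.congr_fun h1 v

theorem mdiffAt_bilinear (B : F →L[ℝ] G →L[ℝ] K) {f : M → F} {g : M → G} {x : M}
    (hf : MDiffAt f x) (hg : MDiffAt g x) : MDiffAt (fun y => B (f y) (g y)) x :=
  MDifferentiableAt.clm_apply (B.mdifferentiableAt.comp x hf) hg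

variable [IsManifold I ∞ M]

theorem ContMDiffAt.mvfderiv_apply {h : M → F} {X : Π x : M, TangentSpace I x} {x : M}
    (hh : ContMDiffAt I 𝓘(ℝ, F) ∞ h x)
    (hX : ContMDiffAt I I.tangent ∞ (fun y => (⟨y, X y⟩ : TangentBundle I M)) x) :
    ContMDiffAt I 𝓘(ℝ, F) ∞ (fun y => mvfderiv I h y (X y)) x := by
  have h1 := hh.mfderiv_const (m := ∞) (by simp)
  have h2 := ContMDiffAt.clm_apply_of_inCoordinates (IB₁ := I) (IB₂ := 𝓘(ℝ, F)) (b₁ := id)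
    (b₂ := h) (ϕ := fun y => mfderiv I 𝓘(ℝ, F) h y) (v := X) (n := ∞) h1 hX hh
  exact (contMDiff_snd_tangentBundle_modelSpace F 𝓘(ℝ, F)).contMDiffAt.comp x h2

variable [I.Boundaryless]

theorem mfderiv_extChartAt_isInvertible_symm {x : M} {y : E} (hy : y ∈ (extChartAt I x).target) :
    mfderiv I 𝓘(ℝ, E) (extChartAt I x) ((extChartAt I x).symm y)
      = (mfderivWithin 𝓘(ℝ, E) I (extChartAt I x).symm (Set.range I) y).inverse :=
  (ContinuousLinearMap.inverse_eq (mfderivWithin_extChartAt_symm_comp_mfderiv_extChartAt hy)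
    (mfderiv_extChartAt_comp_mfderivWithin_extChartAt_symm hy)).symm

/-- The components of a vector field in a chart. -/
def chartField (x : M) (X : Π x : M, TangentSpace I x) (y : E) : E :=
  mpullbackWithin 𝓘(ℝ, E) I (extChartAt I x).symm X (Set.range I) y

theorem chartField_extChartAt {x z : M} (hz : z ∈ (extChartAt I x).source)
    (X : Π x : M, TangentSpace I x) :
    chartField x X (extChartAt I x z) = mfderiv I 𝓘(ℝ, E) (extChartAt I x) z (X z) := by
  have hy := (extChartAt I x).map_source hz
  have h := congrArg (fun w => (mfderiv I 𝓘(ℝ, E) (extChartAt I x) w (X w) : E))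
    ((extChartAt I x).left_inv hz)
  refine Eq.trans ?_ h
  change (mfderivWithin 𝓘(ℝ, E) I (extChartAt I x).symm (Set.range I) _).inverse _ = _
  rw [← mfderiv_extChartAt_isInvertible_symm hy]
  rfl

/-- A function in a chart. -/
def chartFun (x : M) (h : M → F) (y : E) : F := h ((extChartAt I x).symm y)

theorem chartFun_contDiffAt {x z : M} (hz : z ∈ (extChartAt I x).source) {h : M → F}
    (hh : ContMDiffAt I 𝓘(ℝ, F) ∞ h z) :
    ContDiffAt ℝ ∞ (chartFun (I := I) x h) (extChartAt I x z) := by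
  have hy := (extChartAt I x).map_source hz
  have h1 : ContMDiffAt 𝓘(ℝ, E) I ∞ (extChartAt I x).symm (extChartAt I x z) :=
    (contMDiffOn_extChartAt_symm x).contMDiffAt ((isOpen_extChartAt_target x).mem_nhds hy)
  rw [← (extChartAt I x).left_inv hz] at hh
  exact (hh.comp _ h1).contDiffAt

theorem chartFun_differentiableAt {x z : M} (hz : z ∈ (extChartAt I x).source) {h : M → F}
    (hh : MDiffAt h z) :
    DifferentiableAt ℝ (chartFun (I := I) x h) (extChartAt I x z) := by
  have hy := (extChartAt I x).map_source hz
  have h1 : MDifferentiableAt 𝓘(ℝ, E) I (extChartAt I x).symm (extChartAt I x z) :=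
    ((contMDiffOn_extChartAt_symm (n := ∞) x).contMDiffAt
      ((isOpen_extChartAt_target x).mem_nhds hy)).mdifferentiableAt (by simp)
  rw [← (extChartAt I x).left_inv hz] at hh
  exact (hh.comp _ h1).differentiableAt

theorem mvfderiv_eq_fderiv_chartFun {x z : M} (hz : z ∈ (extChartAt I x).source) {h : M → F}
    (hh : MDiffAt h z) (v : TangentSpace I z) :
    mvfderiv I h z v
      = fderiv ℝ (chartFun (I := I) x h) (extChartAt I x z)
        (mfderiv I 𝓘(ℝ, E) (extChartAt I x) z v) := by
  have h1 : h =ᶠ[𝓝 z] fun w => chartFun (I := I) x h (extChartAt I x w) := by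
    filter_upwards [(isOpen_extChartAt_source x).mem_nhds hz] with w hw
    rw [chartFun, (extChartAt I x).left_inv hw]
  rw [h1.mvfderiv_eq, mvfderiv_comp_of_hasFDerivAt (F := E)
    (mdifferentiableAt_extChartAt (by rwa [extChartAt_source] at hz))
    (chartFun_differentiableAt hz hh).hasFDerivAt]
  rfl

variable [CompleteSpace E]

theorem mdiffAt_chartField {x : M} {X : Π x : M, TangentSpace I x}
    (hX : ContMDiffAt I I.tangent ∞ (fun y => (⟨y, X y⟩ : TangentBundle I M)) x) :
    DifferentiableAt ℝ (chartField x X) (extChartAt I x x) := by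
  have h := contMDiffWithinAt_mpullbackWithin_extChartAt_symm (n := ∞) (m := ∞)
    hX.contMDiffWithinAt uniqueMDiffOn_univ (Set.mem_univ x) (by simp)
  rw [contMDiffWithinAt_vectorSpace_iff_contDiffWithinAt] at h
  refine (h.contDiffAt ?_).differentiableAt (by simp)
  simpa using extChartAt_target_mem_nhds x

/-- The bracket of vector fields is the commutator of derivations. -/
theorem mvfderiv_mlieBracket {x : M} {h : M → F} {X Y : Π x : M, TangentSpace I x}
    (hh : ContMDiffAt I 𝓘(ℝ, F) ∞ h x)
    (hX : ContMDiffAt I I.tangent ∞ (fun y => (⟨y, X y⟩ : TangentBundle I M)) x)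
    (hY : ContMDiffAt I I.tangent ∞ (fun y => (⟨y, Y y⟩ : TangentBundle I M)) x) :
    mvfderiv I (fun y => mvfderiv I h y (Y y)) x (X x)
      - mvfderiv I (fun y => mvfderiv I h y (X y)) x (Y x)
      = mvfderiv I h x (mlieBracket I X Y x) := by
  have hx := mem_extChartAt_source (I := I) x
  have hk := chartFun_contDiffAt hx hh
  set k := chartFun (I := I) x h with hkdef
  -- In the chart, X(Yh) is a Hessian term plus a term in the derivative of the components of Y. The
  -- Hessian is symmetric and drops out of the commutator; the rest antisymmetrises to the bracket.
  have key : ∀ Z : Π x : M, TangentSpace I x,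
      ContMDiffAt I I.tangent ∞ (fun y => (⟨y, Z y⟩ : TangentBundle I M)) x →
      ∀ v : TangentSpace I x, mvfderiv I (fun y => mvfderiv I h y (Z y)) x v
        = fderiv ℝ (fderiv ℝ k) (extChartAt I x x) (mfderiv I 𝓘(ℝ, E) (extChartAt I x) x v)
            (chartField x Z (extChartAt I x x))
          + fderiv ℝ k (extChartAt I x x) (fderiv ℝ (chartField x Z) (extChartAt I x x)
            (mfderiv I 𝓘(ℝ, E) (extChartAt I x) x v)) := by
    intro Z hZ v
    have h1 : (fun y => mvfderiv I h y (Z y)) =ᶠ[𝓝 x]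
        fun y => (fun w => fderiv ℝ k w (chartField x Z w)) (extChartAt I x y) := by
      have h2 := contMDiffAt_iff_contMDiffAt_nhds (n := 1) (by simp) |>.1
        (hh.of_le (by exact_mod_cast le_top))
      filter_upwards [extChartAt_source_mem_nhds (I := I) x, h2] with y hy hy2
      rw [mvfderiv_eq_fderiv_chartFun hy (hy2.mdifferentiableAt (by simp)), chartField_extChartAt hy]
    have h3 : HasFDerivAt (fderiv ℝ k) _ (extChartAt I x x) :=
      ((hk.fderiv_right (m := ∞) (by simp)).differentiableAt (by simp)).hasFDerivAt
    have h4 := (mdiffAt_chartField hZ).hasFDerivAt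
    rw [h1.mvfderiv_eq, mvfderiv_comp_of_hasFDerivAt (F := E)
      (mdifferentiableAt_extChartAt (by simp)) (h3.clm_apply h4)]
    change fderiv ℝ k (extChartAt I x x) (fderiv ℝ (chartField x Z) (extChartAt I x x)
        (mfderiv I 𝓘(ℝ, E) (extChartAt I x) x v)) + _ = _
    rw [add_comm]
    rfl
  rw [key X hX, key Y hY, mvfderiv_eq_fderiv_chartFun hx (hh.mdifferentiableAt (by simp)), ← chartField_extChartAt hx,
    ← chartField_extChartAt hx]
  have h5 : mfderiv I 𝓘(ℝ, E) (extChartAt I x) x (mlieBracket I X Y x)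
      = lieBracket ℝ (chartField x X) (chartField x Y) (extChartAt I x x) := by
    have h6 := isInvertible_mfderiv_extChartAt hx
    have h7 : mlieBracket I X Y x = (mfderiv I 𝓘(ℝ, E) (extChartAt I x) x).inverse
        (lieBracketWithin ℝ (E := E) (chartField x X) (chartField x Y) Set.univ (extChartAt I x x)) := by
      rw [mlieBracket, mlieBracketWithin_apply]
      simp only [I.range_eq_univ, Set.preimage_univ, Set.inter_univ]
      unfold chartField
      simp only [I.range_eq_univ]
    rw [h7, lieBracketWithin_univ]
    exact h6.self_apply_inverse _
  rw [h5, lieBracket, map_sub]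
  have h7 := (hk.isSymmSndFDerivAt (by
    rw [minSmoothness_of_isRCLikeNormedField]
    exact WithTop.coe_le_coe.2 (le_top : (2 : ℕ∞) ≤ ⊤))).eq (chartField x X (extChartAt I x x))
    (chartField x Y (extChartAt I x x))
  rw [h7]
  abel

end Calculus

/-! ### Closed 1-forms: local primitives, and global ones on simply connected manifolds -/

section Poincare

open Topology

variable {E : Type*} [NormedAddCommGroup E] [NormedSpace ℝ E]
  {H : Type*} [TopologicalSpace H] {I : ModelWithCorners ℝ E H}
  {M : Type*} [TopologicalSpace M] [ChartedSpace H M] [IsManifold I ∞ M] [I.Boundaryless]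
  {F : Type*} [NormedAddCommGroup F] [NormedSpace ℝ F]

/-- A function whose differential vanishes near a point is locally constant there. -/
theorem eventually_eq_of_mvfderiv_eq_zero {h : M → F} {x : M}
    (hd : ∀ᶠ y in 𝓝 x, MDiffAt h y) (hz : ∀ᶠ y in 𝓝 x, mvfderiv I h y = 0) :
    ∀ᶠ y in 𝓝 x, h y = h x := by
  have hx := mem_extChartAt_source (I := I) x
  have hc := (continuousOn_extChartAt_symm (I := I) x).continuousAt
    (extChartAt_target_mem_nhds (I := I) x)
  have h1 : ∀ᶠ y in 𝓝 (extChartAt I x x), y ∈ (extChartAt I x).target ∧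
      MDiffAt h ((extChartAt I x).symm y) ∧ mvfderiv I h ((extChartAt I x).symm y) = 0 := by
    refine Filter.Eventually.and (extChartAt_target_mem_nhds (I := I) x) ?_
    have hc' : Filter.Tendsto (extChartAt I x).symm (𝓝 (extChartAt I x x)) (𝓝 x) := by
      have := hc.tendsto
      rwa [(extChartAt I x).left_inv hx] at this
    exact hc'.eventually (hd.and hz)
  obtain ⟨r, hr, hball⟩ := Metric.eventually_nhds_iff_ball.1 h1
  have h2 : ∀ y ∈ Metric.ball (extChartAt I x x) r,
      HasFDerivAt (chartFun (I := I) x h) (0 : E →L[ℝ] F) y := by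
    intro y hy
    obtain ⟨hyt, hy1, hy2⟩ := hball y hy
    have hys := (extChartAt I x).map_target hyt
    have h3 := chartFun_differentiableAt hys hy1
    have h4 := mvfderiv_eq_fderiv_chartFun hys hy1
    rw [(extChartAt I x).right_inv hyt] at h3 h4
    have h5 : fderiv ℝ (chartFun (I := I) x h) y = 0 := by
      ext w
      obtain ⟨v, rfl⟩ := (isInvertible_mfderiv_extChartAt hys).bijective.2 w
      have := h4 v
      rw [hy2] at this
      exact this.symm
    rw [← h5]
    exact h3.hasFDerivAt
  have h3 : ∀ᶠ z in 𝓝 x, extChartAt I x z ∈ Metric.ball (extChartAt I x x) r :=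
    (continuousAt_extChartAt x).eventually (Metric.ball_mem_nhds _ hr)
  filter_upwards [h3, extChartAt_source_mem_nhds (I := I) x] with z hz hzs
  have h6 := (convex_ball (extChartAt I x x) r).is_const_of_fderivWithin_eq_zero (𝕜 := ℝ)
    (f := chartFun (I := I) x h)
    (fun y hy => (h2 y hy).differentiableAt.differentiableWithinAt)
    (fun y hy => by
      rw [fderivWithin_of_isOpen Metric.isOpen_ball hy, (h2 y hy).fderiv])
    hz (Metric.mem_ball_self hr)
  rwa [chartFun, chartFun, (extChartAt I x).left_inv hzs, (extChartAt I x).left_inv hx] at h6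

theorem eq_of_mvfderiv_eq_zero [PreconnectedSpace M] {h : M → F} (hd : ∀ y, MDiffAt h y)
    (hz : ∀ y, mvfderiv I h y = 0) (x y : M) : h x = h y := by
  have : IsLocallyConstant h := (IsLocallyConstant.iff_eventually_eq h).2 fun x =>
    eventually_eq_of_mvfderiv_eq_zero (.of_forall hd) (.of_forall hz)
  exact this.apply_eq_of_preconnectedSpace x y

/-- A smooth `F`-valued 1-form. -/
def IsSmoothForm (α : Π x : M, TangentSpace I x →L[ℝ] F) : Prop :=
  ∀ (x : M) (X : Π x : M, TangentSpace I x),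
    ContMDiffAt I I.tangent ∞ (fun y => (⟨y, X y⟩ : TangentBundle I M)) x →
      ContMDiffAt I 𝓘(ℝ, F) ∞ (fun y => α y (X y)) x

/-- A closed `F`-valued 1-form. -/
def IsClosedForm (α : Π x : M, TangentSpace I x →L[ℝ] F) : Prop :=
  ∀ (x : M) (X Y : Π x : M, TangentSpace I x),
    ContMDiffAt I I.tangent ∞ (fun y => (⟨y, X y⟩ : TangentBundle I M)) x →
    ContMDiffAt I I.tangent ∞ (fun y => (⟨y, Y y⟩ : TangentBundle I M)) x →
      mvfderiv I (fun y => α y (Y y)) x (X x) - mvfderiv I (fun y => α y (X y)) x (Y x)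
        = α x (mlieBracket I X Y x)

/-- A constant vector field on a vector space. -/
def constField (b : E) : Π y : E, TangentSpace 𝓘(ℝ, E) y := fun _ => b

theorem contMDiff_constField (b : E) : ContMDiff 𝓘(ℝ, E) 𝓘(ℝ, E).tangent ∞
    (fun y => (⟨y, constField b y⟩ : TangentBundle 𝓘(ℝ, E) E)) := by
  rw [contMDiff_vectorSpace_iff_contDiff]
  exact contDiff_const

theorem mlieBracket_constField (a b y : E) :
    mlieBracket 𝓘(ℝ, E) (constField a) (constField b) y = 0 := by
  rw [← mlieBracketWithin_univ, mlieBracketWithin_eq_lieBracketWithin]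
  change lieBracketWithin ℝ (fun _ : E => a) (fun _ : E => b) Set.univ y = 0
  simp [lieBracketWithin]

/-- The coordinate vector fields of a chart. -/
def coordField (I : ModelWithCorners ℝ E H) (x : M) (b : E) : Π z : M, TangentSpace I z :=
  mpullback I 𝓘(ℝ, E) (extChartAt I x) (constField b)

theorem mfderiv_coordField {x z : M} (hz : z ∈ (extChartAt I x).source) (b : E) :
    mfderiv I 𝓘(ℝ, E) (extChartAt I x) z (coordField I x b z) = b :=
  (isInvertible_mfderiv_extChartAt hz).self_apply_inverse _

theorem coordField_mfderiv {x z : M} (hz : z ∈ (extChartAt I x).source) (v : TangentSpace I z) :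
    coordField I x (mfderiv I 𝓘(ℝ, E) (extChartAt I x) z v : E) z = v :=
  (isInvertible_mfderiv_extChartAt hz).inverse_apply_self _

variable [CompleteSpace E]

theorem contMDiffAt_coordField {x z : M} (hz : z ∈ (extChartAt I x).source) (b : E) :
    ContMDiffAt I I.tangent ∞ (fun y => (⟨y, coordField I x b y⟩ : TangentBundle I M)) z := by
  exact ContMDiffAt.mpullback_vectorField_preimage (m := ∞) (n := ∞)
    (contMDiff_constField b).contMDiffAt
    (contMDiffAt_extChartAt' (by rwa [extChartAt_source] at hz))
    (isInvertible_mfderiv_extChartAt hz) (by simp)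

/-- Pullback by the chart commutes with brackets, and constant fields commute. -/
theorem mlieBracket_coordField {x z : M} (hz : z ∈ (extChartAt I x).source) (a b : E) :
    mlieBracket I (coordField I x a) (coordField I x b) z = 0 := by
  have h2 : minSmoothness ℝ 2 ≤ ∞ := by
    rw [minSmoothness_of_isRCLikeNormedField]
    exact WithTop.coe_le_coe.2 (le_top : (2 : ℕ∞) ≤ ⊤)
  have : IsManifold I (minSmoothness ℝ 2) M := IsManifold.of_le h2
  have h := mpullback_mlieBracket (I := I) (f := extChartAt I x) (n := ∞)
    (V := constField a) (W := constField b)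
    ((contMDiff_constField a).mdifferentiable (by simp) (extChartAt I x z))
    ((contMDiff_constField b).mdifferentiable (by simp) (extChartAt I x z))
    (contMDiffAt_extChartAt' (by rwa [extChartAt_source] at hz)) h2
  refine h.symm.trans ?_
  rw [mpullback_apply, mlieBracket_constField, map_zero]

variable [FiniteDimensional ℝ E] [CompleteSpace F]

/-- The Poincaré lemma: a closed form has primitives near every point. -/
theorem IsClosedForm.exists_local_primitive {α : Π x : M, TangentSpace I x →L[ℝ] F}
    (hs : IsSmoothForm α) (hc : IsClosedForm α) (x : M) :
    ∃ (U : Set M) (h : M → F), IsOpen U ∧ x ∈ U ∧ ContMDiffOn I 𝓘(ℝ, F) ∞ h U ∧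
      ∀ y ∈ U, mvfderiv I h y = α y := by
  set c := extChartAt I x with hcdef
  -- β is α read in the chart. Tested on coordinate fields, whose brackets vanish, closedness
  -- becomes symmetry of the derivative of β, so β has a primitive on a ball.
  let β : E → E →L[ℝ] F := fun y =>
    α (c.symm y) ∘L (mfderiv I 𝓘(ℝ, E) c (c.symm y)).inverse
  have hβ : ∀ b, (fun y => β y b) = chartFun (I := I) x (fun z => α z (coordField I x b z)) :=
    fun b => rfl
  have hsm : ∀ b, ∀ y ∈ c.target, ContDiffAt ℝ ∞ (fun y => β y b) y := by
    intro b y hy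
    have h1 := chartFun_contDiffAt (c.map_target hy)
      (hs _ _ (contMDiffAt_coordField (c.map_target hy) b))
    rwa [c.right_inv hy, ← hβ] at h1
  have hβs : ∀ y ∈ c.target, ContDiffAt ℝ ∞ β y := fun y hy =>
    (contDiffOn_clm_apply.2 fun b z hz => (hsm b z hz).contDiffWithinAt).contDiffAt
      ((isOpen_extChartAt_target x).mem_nhds hy)
  obtain ⟨r, hr, hball⟩ := Metric.mem_nhds_iff.1 (extChartAt_target_mem_nhds (I := I) x)
  have hd : ∀ y ∈ c.target, DifferentiableAt ℝ β y := fun y hy =>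
    (hβs y hy).differentiableAt (by simp)
  obtain ⟨f, hf⟩ := (convex_ball (c x) r).exists_forall_hasFDerivAt_of_fderiv_symmetric
    (F := F) Metric.isOpen_ball (fun y hy => (hd y (hball hy)).differentiableWithinAt) (by
      intro y hy a b
      have hyt := hball hy
      have hys := c.map_target hyt
      have key : ∀ a b : E, fderiv ℝ β y a b = mvfderiv I (fun z => α z (coordField I x b z))
          (c.symm y) (coordField I x a (c.symm y)) := by
        intro a b
        rw [mvfderiv_eq_fderiv_chartFun hys
          ((hs _ _ (contMDiffAt_coordField hys b)).mdifferentiableAt (by simp)),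
          mfderiv_coordField hys, ← hβ]
        have h2 : HasFDerivAt (fun y => β y b) _ y :=
          (hd y hyt).hasFDerivAt.clm_apply (hasFDerivAt_const b y)
        rw [c.right_inv hyt, h2.fderiv]
        simp
      have h3 := hc (c.symm y) _ _ (contMDiffAt_coordField hys a) (contMDiffAt_coordField hys b)
      rw [mlieBracket_coordField hys, map_zero, sub_eq_zero] at h3
      rw [key, key, h3])
  have hfs : ContDiffOn ℝ ∞ f (Metric.ball (c x) r) := by
    rw [contDiffOn_infty_iff_fderiv_of_isOpen Metric.isOpen_ball]
    refine ⟨fun y hy => (hf y hy).differentiableAt.differentiableWithinAt, fun y hy => ?_⟩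
    exact ((hβs y (hball hy)).contDiffWithinAt).congr (fun z hz => (hf z hz).fderiv)
      (hf y hy).fderiv
  refine ⟨c.source ∩ c ⁻¹' Metric.ball (c x) r, fun z => f (c z),
    (continuousOn_extChartAt x).isOpen_inter_preimage (isOpen_extChartAt_source x)
      Metric.isOpen_ball, ⟨mem_extChartAt_source x, Metric.mem_ball_self hr⟩, ?_, ?_⟩
  · exact (contMDiffOn_iff_contDiffOn.2 hfs).comp
      ((contMDiffOn_extChartAt (n := ∞)).mono (fun z hz => by
        have := hz.1; rwa [hcdef, extChartAt_source] at this)) (fun z hz => hz.2)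
  · intro z hz
    have hzs := hz.1
    rw [hcdef, extChartAt_source] at hzs
    rw [mvfderiv_comp_of_hasFDerivAt (F := E) (mdifferentiableAt_extChartAt hzs) (hf _ hz.2)]
    ext v
    have h5 : ∀ w : M, w = z → α w (coordField I x
        (mfderiv I 𝓘(ℝ, E) c z v : E) w) = α z v := by
      rintro w rfl
      rw [coordField_mfderiv hz.1]
    exact h5 _ (c.left_inv hz.1)

/-- On a simply connected manifold, closed forms are exact. -/
theorem IsClosedForm.exists_primitive [SimplyConnectedSpace M] [LocallyPathConnectedSpace M]
    {α : Π x : M, TangentSpace I x →L[ℝ] F}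
    (hs : IsSmoothForm α) (hc : IsClosedForm α) :
    ∃ f : M → F, ContMDiff I 𝓘(ℝ, F) ∞ f ∧ ∀ x, mvfderiv I f x = α x := by
  choose U h hU hxU hh hd using fun x => hc.exists_local_primitive hs x
  have hmd : ∀ i, ∀ y ∈ U i, MDiffAt (h i) y := fun i y hy =>
    ((hh i).contMDiffAt ((hU i).mem_nhds hy)).mdifferentiableAt (by simp)
  -- Differences of local primitives are locally constant and form an additive cocycle. Subtracting
  -- its coboundary makes the primitives agree on overlaps.
  obtain ⟨s, hs1, hs2⟩ := exists_coboundary_of_cocycle (G := Multiplicative F) U hU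
    (fun x => ⟨x, hxU x⟩) (fun i j y => Multiplicative.ofAdd (h i y - h j y))
    (by
      intro i j y hy
      have hm : U i ∩ U j ∈ 𝓝 y := ((hU i).inter (hU j)).mem_nhds hy
      have := eventually_eq_of_mvfderiv_eq_zero (I := I) (h := fun z => h i z - h j z) (x := y)
        (by
          filter_upwards [hm] with z hz
          exact (hmd i z hz.1).sub (hmd j z hz.2))
        (by
          filter_upwards [hm] with z hz
          have := mvfderiv_sub (hmd i z hz.1) (hmd j z hz.2)
          rw [hd i z hz.1, hd j z hz.2, sub_self] at this
          exact this)
      filter_upwards [this] with z hz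
      rw [hz])
    (by
      intro i j l y hy
      rw [← ofAdd_add, sub_add_sub_cancel])
  have hs3 : ∀ i j, ∀ y ∈ U i ∩ U j,
      h i y - (s i y).toAdd = h j y - (s j y).toAdd := by
    intro i j y hy
    rw [hs2 i j y hy, toAdd_mul, toAdd_ofAdd]
    abel
  -- The global primitive uses at y the neighbourhood indexed by y itself; near x it has to be
  -- rewritten with the single neighbourhood of x.
  have hloc : ∀ x, (fun y => h y y - (s y y).toAdd) =ᶠ[𝓝 x]
      fun y => h x y - (s x x).toAdd := by
    intro x
    filter_upwards [(hU x).mem_nhds (hxU x), hs1 x x (hxU x)] with y hy hy2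
    rw [hs3 y x y ⟨hxU y, hy⟩, hy2]
  refine ⟨fun y => h y y - (s y y).toAdd, fun x => ?_, fun x => ?_⟩
  · refine ContMDiffAt.congr_of_eventuallyEq ?_ (hloc x)
    exact ((hh x).contMDiffAt ((hU x).mem_nhds (hxU x))).sub contMDiffAt_const
  · rw [(hloc x).mvfderiv_eq]
    have := mvfderiv_sub (hmd x x (hxU x))
      (mdifferentiableAt_const (I := I) (I' := 𝓘(ℝ, F)) (c := (s x x).toAdd))
    rw [mvfderiv_const, sub_zero, hd x x (hxU x)] at this
    exact this

end Poincare

/-! ### Quaternion algebra: units, norms, conjugation -/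

section QuaternionCalculus

/-- Conjugation of quaternions, as a continuous linear map. -/
def quatStar : ℍ[ℝ] →L[ℝ] ℍ[ℝ] :=
  LinearMap.toContinuousLinearMap
    { toFun := fun q => star q
      map_add' := fun p q => star_add p q
      map_smul' := fun c q => by simp }

@[simp] theorem quatStar_apply (q : ℍ[ℝ]) : quatStar q = star q := rfl

/-- The first imaginary unit. -/
def unitI : ℍ[ℝ] := ⟨0, 1, 0, 0⟩

/-- The second imaginary unit. -/
def unitJ : ℍ[ℝ] := ⟨0, 0, 1, 0⟩

@[simp] theorem unitI_re : unitI.re = 0 := rfl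

@[simp] theorem unitI_imI : unitI.imI = 1 := rfl

@[simp] theorem unitI_imJ : unitI.imJ = 0 := rfl

@[simp] theorem unitI_imK : unitI.imK = 0 := rfl

@[simp] theorem unitJ_re : unitJ.re = 0 := rfl

@[simp] theorem unitJ_imI : unitJ.imI = 0 := rfl

@[simp] theorem unitJ_imJ : unitJ.imJ = 1 := rfl

@[simp] theorem unitJ_imK : unitJ.imK = 0 := rfl

@[simp] theorem omega2_re : omega2.re = 0 := rfl

@[simp] theorem omega2_imI : omega2.imI = 0 := rfl

@[simp] theorem omega2_imJ : omega2.imJ = 0 := rfl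

@[simp] theorem omega2_imK : omega2.imK = 1 := rfl

theorem unitI_mul_unitJ : unitI * unitJ = omega2 := by
  ext <;> simp

theorem omega2_mul_omega2 : omega2 * omega2 = -1 := by
  ext <;> simp

theorem star_omega2 : star omega2 = -omega2 := by
  ext <;> simp

theorem star_mul_self_of_norm_eq_one {q : ℍ[ℝ]} (h : ‖q‖ = 1) : star q * q = 1 := by
  rw [Quaternion.star_mul_self, Quaternion.normSq_eq_norm_mul_self, h]
  simp

theorem self_mul_star_of_norm_eq_one {q : ℍ[ℝ]} (h : ‖q‖ = 1) : q * star q = 1 := by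
  rw [Quaternion.self_mul_star, Quaternion.normSq_eq_norm_mul_self, h]
  simp

/-- The inner product is the real part of a b*, and the real part is invariant under cyclic
permutation; hence conjugation by a unit quaternion is an isometry. -/
theorem inner_star_mul_mul {q : ℍ[ℝ]} (h : ‖q‖ = 1) (a b : ℍ[ℝ]) :
    (inner ℝ (star q * a * q) (star q * b * q) : ℝ) = inner ℝ a b := by
  have h1 : star q * a * q * star (star q * b * q) = star q * (a * star b) * q := by
    have := self_mul_star_of_norm_eq_one h
    simp only [star_mul, star_star]
    calc star q * a * q * (star q * (star b * q)) = star q * a * (q * star q) * (star b * q) := by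
          noncomm_ring
      _ = _ := by rw [this]; noncomm_ring
  have h2 : ∀ c : ℍ[ℝ], (star q * c * q).re = c.re := by
    intro c
    have h3 : (star q * c * q).re = (q * star q * c).re := by
      simp only [Quaternion.re_mul, Quaternion.re_star, Quaternion.imI_star, Quaternion.imJ_star,
        Quaternion.imK_star, Quaternion.imI_mul, Quaternion.imJ_mul, Quaternion.imK_mul]
      ring
    rw [h3, self_mul_star_of_norm_eq_one h, one_mul]
  rw [Quaternion.inner_def, Quaternion.inner_def, h1, h2]

end QuaternionCalculus

/-! ### Product rules for quaternion-valued and vector-valued functions -/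

section FrameCalculus

open Topology

variable {H : Type*} [TopologicalSpace H] {E : Type*} [NormedAddCommGroup E] [NormedSpace ℝ E]
  {I : ModelWithCorners ℝ E H} {M : Type*} [TopologicalSpace M] [ChartedSpace H M]
  {F : Type*} [NormedAddCommGroup F] [NormedSpace ℝ F]

theorem mvfderiv_quat_mul {f g : M → ℍ[ℝ]} {x : M} (hf : MDifferentiableAt I 𝓘(ℝ, ℍ[ℝ]) f x) (hg : MDifferentiableAt I 𝓘(ℝ, ℍ[ℝ]) g x)
    (X : TangentSpace I x) :
    mvfderiv I (fun y => f y * g y) x X = mvfderiv I f x X * g x + f x * mvfderiv I g x X :=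
  mvfderiv_bilinear (ContinuousLinearMap.mul ℝ ℍ[ℝ]) hf hg X

theorem mdiffAt_quat_mul {f g : M → ℍ[ℝ]} {x : M} (hf : MDifferentiableAt I 𝓘(ℝ, ℍ[ℝ]) f x) (hg : MDifferentiableAt I 𝓘(ℝ, ℍ[ℝ]) g x) :
    MDifferentiableAt I 𝓘(ℝ, ℍ[ℝ]) (fun y => f y * g y) x :=
  mdiffAt_bilinear (ContinuousLinearMap.mul ℝ ℍ[ℝ]) hf hg

theorem mvfderiv_quat_star {f : M → ℍ[ℝ]} {x : M} (hf : MDifferentiableAt I 𝓘(ℝ, ℍ[ℝ]) f x) (X : TangentSpace I x) :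
    mvfderiv I (fun y => star (f y)) x X = star (mvfderiv I f x X) :=
  mvfderiv_clm_comp hf quatStar X

theorem mdiffAt_clm_comp {G : Type*} [NormedAddCommGroup G] [NormedSpace ℝ G] {f : M → F} {x : M}
    (hf : MDiffAt f x) (L : F →L[ℝ] G) : MDiffAt (fun y => L (f y)) x :=
  L.mdifferentiableAt.comp x hf

theorem mdiffAt_quat_star {f : M → ℍ[ℝ]} {x : M} (hf : MDifferentiableAt I 𝓘(ℝ, ℍ[ℝ]) f x) :
    MDifferentiableAt I 𝓘(ℝ, ℍ[ℝ]) (fun y => star (f y)) x :=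
  mdiffAt_clm_comp hf quatStar

theorem mvfderiv_smul_const {f : M → ℝ} {x : M} (hf : MDiffAt f x) (c : F)
    (X : TangentSpace I x) :
    mvfderiv I (fun y => f y • c) x X = mvfderiv I f x X • c :=
  mvfderiv_clm_comp hf (ContinuousLinearMap.toSpanSingleton ℝ c) X

theorem mdiffAt_smul_const {f : M → ℝ} {x : M} (hf : MDiffAt f x) (c : F) :
    MDiffAt (fun y => f y • c) x :=
  mdiffAt_clm_comp hf (ContinuousLinearMap.toSpanSingleton ℝ c)

theorem mvfderiv_smul_fun {f : M → ℝ} {g : M → F} {x : M} (hf : MDiffAt f x) (hg : MDiffAt g x)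
    (X : TangentSpace I x) :
    mvfderiv I (fun y => f y • g y) x X = mvfderiv I f x X • g x + f x • mvfderiv I g x X :=
  mvfderiv_bilinear (ContinuousLinearMap.lsmul ℝ ℝ) hf hg X

theorem mdiffAt_smul_fun {f : M → ℝ} {g : M → F} {x : M} (hf : MDiffAt f x) (hg : MDiffAt g x) :
    MDiffAt (fun y => f y • g y) x :=
  mdiffAt_bilinear (ContinuousLinearMap.lsmul ℝ ℝ) hf hg

theorem mvfderiv_add_apply {f g : M → F} {x : M} (hf : MDiffAt f x) (hg : MDiffAt g x)
    (X : TangentSpace I x) :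
    mvfderiv I (fun y => f y + g y) x X = mvfderiv I f x X + mvfderiv I g x X := by
  have := mvfderiv_add hf hg
  exact DFunLike.congr_fun this X

theorem mvfderiv_sub_apply {f g : M → F} {x : M} (hf : MDiffAt f x) (hg : MDiffAt g x)
    (X : TangentSpace I x) :
    mvfderiv I (fun y => f y - g y) x X = mvfderiv I f x X - mvfderiv I g x X := by
  have := mvfderiv_sub hf hg
  exact DFunLike.congr_fun this X

theorem contMDiffAt_bilinear [IsManifold I ∞ M] {G K : Type*} [NormedAddCommGroup G]
    [NormedSpace ℝ G] [NormedAddCommGroup K] [NormedSpace ℝ K] (B : F →L[ℝ] G →L[ℝ] K)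
    {f : M → F} {g : M → G} {x : M}
    (hf : ContMDiffAt I 𝓘(ℝ, F) ∞ f x) (hg : ContMDiffAt I 𝓘(ℝ, G) ∞ g x) :
    ContMDiffAt I 𝓘(ℝ, K) ∞ (fun y => B (f y) (g y)) x :=
  (B.contMDiff.contMDiffAt.comp x hf).clm_apply hg

theorem contMDiffAt_quat_mul [IsManifold I ∞ M] {f g : M → ℍ[ℝ]} {x : M}
    (hf : ContMDiffAt I 𝓘(ℝ, ℍ[ℝ]) ∞ f x) (hg : ContMDiffAt I 𝓘(ℝ, ℍ[ℝ]) ∞ g x) :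
    ContMDiffAt I 𝓘(ℝ, ℍ[ℝ]) ∞ (fun y => f y * g y) x :=
  contMDiffAt_bilinear (ContinuousLinearMap.mul ℝ ℍ[ℝ]) hf hg

theorem contMDiffAt_clm_comp {G : Type*} [NormedAddCommGroup G] [NormedSpace ℝ G] (L : F →L[ℝ] G)
    {f : M → F} {x : M} (hf : ContMDiffAt I 𝓘(ℝ, F) ∞ f x) :
    ContMDiffAt I 𝓘(ℝ, G) ∞ (fun y => L (f y)) x :=
  L.contMDiff.contMDiffAt.comp x hf

end FrameCalculus

/-! ### Oriented orthonormal frames and their connection form -/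

section Frames

open Topology

variable {M : Type*} [TopologicalSpace M] [ChartedSpace (EuclideanSpace ℝ (Fin 2)) M]
  [IsManifold (𝓡 2) ∞ M]
  [RiemannianBundle (fun x : M => TangentSpace (𝓡 2) x)]
  [IsContMDiffRiemannianBundle (𝓡 2) ∞ (EuclideanSpace ℝ (Fin 2))
    (fun x : M => TangentSpace (𝓡 2) x)]

/-- Smoothness at a point of a vector field on a surface. -/
abbrev IsSmoothAt (Y : Π x : M, TangentSpace (𝓡 2) x) (x : M) : Prop :=
  ContMDiffAt (𝓡 2) (𝓡 2).tangent ∞ (fun y => (⟨y, Y y⟩ : TangentBundle (𝓡 2) M)) x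

theorem leviCivita_metric_apply {x : M} {Y Z : Π x : M, TangentSpace (𝓡 2) x}
    (hY : IsSmoothAt Y x) (hZ : IsSmoothAt Z x) (v : TangentSpace (𝓡 2) x) :
    mvfderiv (𝓡 2) (fun y => (inner ℝ (Y y) (Z y) : ℝ)) x v
      = inner ℝ (leviCivita Y x v) (Z x) + inner ℝ (Y x) (leviCivita Z x v) := by
  have h := leviCivita_metric (X := FiberBundle.extend (EuclideanSpace ℝ (Fin 2)) v)
    (FiberBundle.mdifferentiableAt_extend (𝓡 2) (EuclideanSpace ℝ (Fin 2))
      (V := fun x : M => TangentSpace (𝓡 2) x) v)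
    (hY.mdifferentiableAt (by simp)) (hZ.mdifferentiableAt (by simp))
  rwa [FiberBundle.extend_apply_self] at h

theorem smoothAt_inner {x : M} {X Y : Π x : M, TangentSpace (𝓡 2) x}
    (hX : IsSmoothAt X x)
    (hY : IsSmoothAt Y x) :
    ContMDiffAt (𝓡 2) 𝓘(ℝ, ℝ) ∞ (fun y => (inner ℝ (X y) (Y y) : ℝ)) x :=
  ContMDiffAt.inner_bundle (E := fun x : M => TangentSpace (𝓡 2) x) hX hY

theorem mdiffAt_inner_of_smooth {x : M} {X Y : Π x : M, TangentSpace (𝓡 2) x}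
    (hX : IsSmoothAt X x) (hY : IsSmoothAt Y x) :
    MDifferentiableAt (𝓡 2) 𝓘(ℝ, ℝ) (fun y => (inner ℝ (X y) (Y y) : ℝ)) x :=
  (smoothAt_inner hX hY).mdifferentiableAt (by simp)

theorem leviCivita_sub_eq_mlieBracket {x : M} {X Y : Π x : M, TangentSpace (𝓡 2) x}
    (hX : IsSmoothAt X x) (hY : IsSmoothAt Y x) :
    leviCivita Y x (X x) - leviCivita X x (Y x) = mlieBracket (𝓡 2) X Y x := by
  have h := (CovariantDerivative.torsion_eq_zero_iff _).1
    (leviCivita_torsion (I := 𝓡 2) (M := M)) (hX.mdifferentiableAt (by simp))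
    (hY.mdifferentiableAt (by simp))
  exact h

variable {o : ∀ x : M, Orientation ℝ (TangentSpace (𝓡 2) x) (Fin 2)}
  {e : Fin 2 → Π x : M, TangentSpace (𝓡 2) x} {U : Set M}

namespace IsOrientedFrameOn

theorem contMDiffAt (he : IsOrientedFrameOn o e U) (hU : IsOpen U) {x : M} (hx : x ∈ U)
    (i : Fin 2) :
    IsSmoothAt (e i) x :=
  (he.1 i).contMDiffAt (hU.mem_nhds hx)

theorem inner_self (he : IsOrientedFrameOn o e U) {x : M} (hx : x ∈ U) (i : Fin 2) :
    (inner ℝ (e i x) (e i x) : ℝ) = 1 := by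
  rw [real_inner_self_eq_norm_sq, (he.2 x hx).1.1 i]
  norm_num

theorem inner_zero_one (he : IsOrientedFrameOn o e U) {x : M} (hx : x ∈ U) :
    (inner ℝ (e 0 x) (e 1 x) : ℝ) = 0 :=
  (he.2 x hx).1.2 (by decide)

theorem inner_one_zero (he : IsOrientedFrameOn o e U) {x : M} (hx : x ∈ U) :
    (inner ℝ (e 1 x) (e 0 x) : ℝ) = 0 :=
  (he.2 x hx).1.2 (by decide)

theorem expansion (he : IsOrientedFrameOn o e U) {x : M} (hx : x ∈ U)
    (X : TangentSpace (𝓡 2) x) :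
    X = (inner ℝ (e 0 x) X : ℝ) • e 0 x + (inner ℝ (e 1 x) X : ℝ) • e 1 x := by
  have hc : Fintype.card (Fin 2) = Module.finrank ℝ (TangentSpace (𝓡 2) x) := by
    rw [(fact_finrank_tangentSpace x).out]; rfl
  let b := basisOfOrthonormalOfCardEqFinrank (he.2 x hx).1 hc
  have hb : Orthonormal ℝ b := by
    rw [coe_basisOfOrthonormalOfCardEqFinrank]; exact (he.2 x hx).1
  have h := (b.toOrthonormalBasis hb).sum_repr' X
  rw [Fin.sum_univ_two] at h
  simp only [Module.Basis.coe_toOrthonormalBasis, b, coe_basisOfOrthonormalOfCardEqFinrank] at h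
  exact h.symm

theorem inner_eq (he : IsOrientedFrameOn o e U) {x : M} (hx : x ∈ U)
    (X Y : TangentSpace (𝓡 2) x) :
    (inner ℝ X Y : ℝ) = inner ℝ (e 0 x) X * inner ℝ (e 0 x) Y
      + inner ℝ (e 1 x) X * inner ℝ (e 1 x) Y := by
  conv_lhs => rw [he.expansion hx X]
  rw [inner_add_left, inner_smul_left, inner_smul_left]
  rfl

theorem ext_inner (he : IsOrientedFrameOn o e U) {x : M} (hx : x ∈ U)
    {X Y : TangentSpace (𝓡 2) x} (h : ∀ i, (inner ℝ (e i x) X : ℝ) = inner ℝ (e i x) Y) :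
    X = Y := by
  rw [he.expansion hx X, he.expansion hx Y, h 0, h 1]

theorem inner_rotation (he : IsOrientedFrameOn o e U) {x : M} (hx : x ∈ U)
    (X : TangentSpace (𝓡 2) x) :
    (inner ℝ (e 0 x) ((o x).rightAngleRotation X) : ℝ) = -inner ℝ (e 1 x) X ∧
      (inner ℝ (e 1 x) ((o x).rightAngleRotation X) : ℝ) = inner ℝ (e 0 x) X := by
  have h := (he.2 x hx).2
  have h1 : ∀ Y Z : TangentSpace (𝓡 2) x, (inner ℝ Y ((o x).rightAngleRotation Z) : ℝ)
      = -inner ℝ ((o x).rightAngleRotation Y) Z := by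
    intro Y Z
    rw [Orientation.inner_rightAngleRotation_left, Orientation.inner_rightAngleRotation_right]
  constructor
  · rw [h1, ← h]
  · rw [h1, h, Orientation.rightAngleRotation_rightAngleRotation, inner_neg_left, neg_neg]

end IsOrientedFrameOn

@[simp] theorem frameCoord_re (e : Fin 2 → Π x : M, TangentSpace (𝓡 2) x) (x : M)
    (X : TangentSpace (𝓡 2) x) : (frameCoord e x X).re = 0 := rfl

@[simp] theorem frameCoord_imI (e : Fin 2 → Π x : M, TangentSpace (𝓡 2) x) (x : M)
    (X : TangentSpace (𝓡 2) x) : (frameCoord e x X).imI = inner ℝ (e 0 x) X := rfl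

@[simp] theorem frameCoord_imJ (e : Fin 2 → Π x : M, TangentSpace (𝓡 2) x) (x : M)
    (X : TangentSpace (𝓡 2) x) : (frameCoord e x X).imJ = inner ℝ (e 1 x) X := rfl

@[simp] theorem frameCoord_imK (e : Fin 2 → Π x : M, TangentSpace (𝓡 2) x) (x : M)
    (X : TangentSpace (𝓡 2) x) : (frameCoord e x X).imK = 0 := rfl

theorem frameCoord_eq (e : Fin 2 → Π x : M, TangentSpace (𝓡 2) x) (x : M)
    (X : TangentSpace (𝓡 2) x) :
    frameCoord e x X = (inner ℝ (e 0 x) X : ℝ) • unitI + (inner ℝ (e 1 x) X : ℝ) • unitJ := by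
  ext <;> simp

theorem frameCoord_add (e : Fin 2 → Π x : M, TangentSpace (𝓡 2) x) (x : M)
    (X Y : TangentSpace (𝓡 2) x) :
    frameCoord e x (X + Y) = frameCoord e x X + frameCoord e x Y := by
  simp only [frameCoord_eq, inner_add_right]; module

theorem frameCoord_smul (e : Fin 2 → Π x : M, TangentSpace (𝓡 2) x) (x : M) (c : ℝ)
    (X : TangentSpace (𝓡 2) x) :
    frameCoord e x (c • X) = c • frameCoord e x X := by
  simp only [frameCoord_eq, inner_smul_right]; module

theorem star_frameCoord (e : Fin 2 → Π x : M, TangentSpace (𝓡 2) x) (x : M)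
    (X : TangentSpace (𝓡 2) x) : star (frameCoord e x X) = -frameCoord e x X := by
  ext <;> simp

namespace IsOrientedFrameOn

theorem frameCoord_zero (he : IsOrientedFrameOn o e U) {x : M} (hx : x ∈ U) :
    frameCoord e x (e 0 x) = unitI := by
  rw [frameCoord_eq, he.inner_self hx, he.inner_one_zero hx]; simp

theorem frameCoord_one (he : IsOrientedFrameOn o e U) {x : M} (hx : x ∈ U) :
    frameCoord e x (e 1 x) = unitJ := by
  rw [frameCoord_eq, he.inner_self hx, he.inner_zero_one hx]; simp

theorem frameCoord_rotation (he : IsOrientedFrameOn o e U) {x : M} (hx : x ∈ U)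
    (X : TangentSpace (𝓡 2) x) :
    frameCoord e x ((o x).rightAngleRotation X) = omega2 * frameCoord e x X := by
  obtain ⟨h0, h1⟩ := he.inner_rotation hx X
  ext <;> simp [h0, h1]

theorem inner_frameCoord (he : IsOrientedFrameOn o e U) {x : M} (hx : x ∈ U)
    (X Y : TangentSpace (𝓡 2) x) :
    (inner ℝ (frameCoord e x X) (frameCoord e x Y) : ℝ) = inner ℝ X Y := by
  rw [he.inner_eq hx X Y, Quaternion.inner_def]
  simp

/-- Differentiating |e₁|² = 1 leaves no component along e₁; a single connection form remains. -/
theorem leviCivita_zero (he : IsOrientedFrameOn o e U) (hU : IsOpen U) {x : M} (hx : x ∈ U)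
    (v : TangentSpace (𝓡 2) x) :
    leviCivita (e 0) x v = (inner ℝ (leviCivita (e 0) x v) (e 1 x) : ℝ) • e 1 x := by
  have h := leviCivita_metric_apply (he.contMDiffAt hU hx 0) (he.contMDiffAt hU hx 0) v
  have h1 : (fun y => (inner ℝ (e 0 y) (e 0 y) : ℝ)) =ᶠ[𝓝 x] fun _ => 1 := by
    filter_upwards [hU.mem_nhds hx] with y hy using he.inner_self hy 0
  rw [h1.mvfderiv_eq, mvfderiv_const, real_inner_comm] at h
  have h0 : (inner ℝ (e 0 x) (leviCivita (e 0) x v) : ℝ) = 0 := by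
    have : (0 : ℝ) = _ := h
    linarith
  conv_lhs => rw [he.expansion hx (leviCivita (e 0) x v), h0, zero_smul, zero_add,
    real_inner_comm]

theorem leviCivita_one (he : IsOrientedFrameOn o e U) (hU : IsOpen U) {x : M} (hx : x ∈ U)
    (v : TangentSpace (𝓡 2) x) :
    leviCivita (e 1) x v = -(inner ℝ (leviCivita (e 0) x v) (e 1 x) : ℝ) • e 0 x := by
  have h := leviCivita_metric_apply (he.contMDiffAt hU hx 1) (he.contMDiffAt hU hx 1) v
  have h1 : (fun y => (inner ℝ (e 1 y) (e 1 y) : ℝ)) =ᶠ[𝓝 x] fun _ => 1 := by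
    filter_upwards [hU.mem_nhds hx] with y hy using he.inner_self hy 1
  rw [h1.mvfderiv_eq, mvfderiv_const, real_inner_comm] at h
  have h0 : (inner ℝ (e 1 x) (leviCivita (e 1) x v) : ℝ) = 0 := by
    have : (0 : ℝ) = _ := h
    linarith
  have h' := leviCivita_metric_apply (he.contMDiffAt hU hx 0) (he.contMDiffAt hU hx 1) v
  have h2 : (fun y => (inner ℝ (e 0 y) (e 1 y) : ℝ)) =ᶠ[𝓝 x] fun _ => 0 := by
    filter_upwards [hU.mem_nhds hx] with y hy using he.inner_zero_one hy
  rw [h2.mvfderiv_eq, mvfderiv_const] at h'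
  have h3 : (inner ℝ (e 0 x) (leviCivita (e 1) x v) : ℝ)
      = -inner ℝ (leviCivita (e 0) x v) (e 1 x) := by
    have : (0 : ℝ) = _ := h'
    linarith
  conv_lhs => rw [he.expansion hx (leviCivita (e 1) x v), h0, zero_smul, add_zero, h3]

theorem mdiffAt_frameCoord (he : IsOrientedFrameOn o e U) (hU : IsOpen U) {x : M} (hx : x ∈ U)
    {Y : Π x : M, TangentSpace (𝓡 2) x} (hY : IsSmoothAt Y x) :
    MDifferentiableAt (𝓡 2) 𝓘(ℝ, ℍ[ℝ]) (fun y => frameCoord e y (Y y)) x := by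
  simp only [frameCoord_eq]
  exact (mdiffAt_smul_const (mdiffAt_inner_of_smooth (he.contMDiffAt hU hx 0) hY) _).add
    (mdiffAt_smul_const (mdiffAt_inner_of_smooth (he.contMDiffAt hU hx 1) hY) _)

theorem contMDiffAt_frameCoord (he : IsOrientedFrameOn o e U) (hU : IsOpen U) {x : M}
    (hx : x ∈ U) {Y : Π x : M, TangentSpace (𝓡 2) x}
    (hY : IsSmoothAt Y x) :
    ContMDiffAt (𝓡 2) 𝓘(ℝ, ℍ[ℝ]) ∞ (fun y => frameCoord e y (Y y)) x := by
  simp only [frameCoord_eq]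
  exact (contMDiffAt_clm_comp (ContinuousLinearMap.toSpanSingleton ℝ unitI)
    (smoothAt_inner (he.contMDiffAt hU hx 0) hY)).add
    (contMDiffAt_clm_comp (ContinuousLinearMap.toSpanSingleton ℝ unitJ)
    (smoothAt_inner (he.contMDiffAt hU hx 1) hY))

/-- The derivative of the coordinates of a vector field in a moving frame. -/
theorem mvfderiv_frameCoord (he : IsOrientedFrameOn o e U) (hU : IsOpen U) {x : M} (hx : x ∈ U)
    {Y : Π x : M, TangentSpace (𝓡 2) x} (hY : IsSmoothAt Y x) (v : TangentSpace (𝓡 2) x) :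
    mvfderiv (𝓡 2) (fun y => frameCoord e y (Y y)) x v
      = frameCoord e x (leviCivita Y x v)
        - (1 / 2 * inner ℝ (leviCivita (e 0) x v) (e 1 x) : ℝ) •
          (omega2 * frameCoord e x (Y x) - frameCoord e x (Y x) * omega2) := by
  have h0 := mdiffAt_inner_of_smooth (he.contMDiffAt hU hx 0) hY
  have h1 := mdiffAt_inner_of_smooth (he.contMDiffAt hU hx 1) hY
  simp only [frameCoord_eq]
  rw [mvfderiv_add_apply (mdiffAt_smul_const h0 _) (mdiffAt_smul_const h1 _),
    mvfderiv_smul_const h0, mvfderiv_smul_const h1,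
    leviCivita_metric_apply (he.contMDiffAt hU hx 0) hY,
    leviCivita_metric_apply (he.contMDiffAt hU hx 1) hY, he.leviCivita_one hU hx v]
  -- Since k anticommutes with i and j, half of [k, F] is kF, the rotation of F by J: the correction
  -- is the connection form times J.
  have hz := he.leviCivita_zero hU hx v
  generalize (inner ℝ (leviCivita (e 0) x v) (e 1 x) : ℝ) = w at hz ⊢
  rw [hz]
  simp only [inner_smul_left]
  ext <;> simp <;> ring

end IsOrientedFrameOn

end Frames

/-! ### Conjugating the frame by a spinor -/

section RotatedFrames

open Topology

variable {M : Type*} [TopologicalSpace M] [ChartedSpace (EuclideanSpace ℝ (Fin 2)) M]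
  [IsManifold (𝓡 2) ∞ M]
  [RiemannianBundle (fun x : M => TangentSpace (𝓡 2) x)]
  [IsContMDiffRiemannianBundle (𝓡 2) ∞ (EuclideanSpace ℝ (Fin 2))
    (fun x : M => TangentSpace (𝓡 2) x)]

/-- The spinorial covariant derivative in a moving frame. -/
def spinDeriv (e : Fin 2 → Π x : M, TangentSpace (𝓡 2) x) (v : M → ℍ[ℝ]) (x : M)
    (X : TangentSpace (𝓡 2) x) : ℍ[ℝ] :=
  mvfderiv (𝓡 2) v x X
    + (1 / 2 * inner ℝ (leviCivita (e 0) x X) (e 1 x) : ℝ) • (omega2 * v x)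

namespace IsOrientedFrameOn

variable {o : ∀ x : M, Orientation ℝ (TangentSpace (𝓡 2) x) (Fin 2)}
  {e : Fin 2 → Π x : M, TangentSpace (𝓡 2) x} {U : Set M}

/-- Clifford multiplication is parallel: the commutator with k in the derivative of the frame
coordinates cancels the connection terms hidden in the two occurrences of `spinDeriv`, because the
conjugate of k is -k. -/
theorem mvfderiv_conj_frameCoord (he : IsOrientedFrameOn o e U) (hU : IsOpen U) {x : M}
    (hx : x ∈ U) {v : M → ℍ[ℝ]} (hv : MDifferentiableAt (𝓡 2) 𝓘(ℝ, ℍ[ℝ]) v x)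
    {Y : Π x : M, TangentSpace (𝓡 2) x} (hY : IsSmoothAt Y x) (X : TangentSpace (𝓡 2) x) :
    mvfderiv (𝓡 2) (fun y => star (v y) * frameCoord e y (Y y) * v y) x X
      = star (v x) * frameCoord e x (leviCivita Y x X) * v x
        + (star (spinDeriv e v x X) * frameCoord e x (Y x) * v x
          + star (v x) * frameCoord e x (Y x) * spinDeriv e v x X) := by
  have hf := he.mdiffAt_frameCoord hU hx hY
  rw [mvfderiv_quat_mul (mdiffAt_quat_mul (mdiffAt_quat_star hv) hf) hv,
    mvfderiv_quat_mul (mdiffAt_quat_star hv) hf, mvfderiv_quat_star hv,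
    he.mvfderiv_frameCoord hU hx hY, spinDeriv]
  generalize (1 / 2 * inner ℝ (leviCivita (e 0) x X) (e 1 x) : ℝ) = c
  simp only [star_add, Quaternion.star_smul, star_mul, star_omega2, mul_add, add_mul, mul_sub, sub_mul,
    smul_mul_assoc, mul_smul_comm, mul_assoc, mul_neg, neg_mul, smul_sub, smul_neg]
  module

/-- The volume element is parallel: the two connection terms are multiples of k, commute with k and
cancel. -/
theorem mvfderiv_conj_omega2 (e : Fin 2 → Π x : M, TangentSpace (𝓡 2) x) {x : M}
    {v : M → ℍ[ℝ]} (hv : MDifferentiableAt (𝓡 2) 𝓘(ℝ, ℍ[ℝ]) v x) (X : TangentSpace (𝓡 2) x) :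
    mvfderiv (𝓡 2) (fun y => star (v y) * omega2 * v y) x X
      = star (spinDeriv e v x X) * omega2 * v x + star (v x) * omega2 * spinDeriv e v x X := by
  have hc : MDifferentiableAt (𝓡 2) 𝓘(ℝ, ℍ[ℝ]) (fun _ : M => omega2) x :=
    mdifferentiableAt_const
  rw [mvfderiv_quat_mul (mdiffAt_quat_mul (mdiffAt_quat_star hv) hc) hv,
    mvfderiv_quat_mul (mdiffAt_quat_star hv) hc, mvfderiv_quat_star hv, mvfderiv_const, spinDeriv]
  generalize (1 / 2 * inner ℝ (leviCivita (e 0) x X) (e 1 x) : ℝ) = c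
  simp only [star_add, Quaternion.star_smul, star_mul, star_omega2, mul_add, add_mul,
    smul_mul_assoc, mul_smul_comm, mul_assoc, mul_neg, neg_mul, smul_neg,
    zero_apply, mul_zero, add_zero]
  module

theorem contMDiffAt_conj_frameCoord (he : IsOrientedFrameOn o e U) (hU : IsOpen U) {x : M}
    (hx : x ∈ U) {v : M → ℍ[ℝ]} (hv : ContMDiffAt (𝓡 2) 𝓘(ℝ, ℍ[ℝ]) ∞ v x)
    {Y : Π x : M, TangentSpace (𝓡 2) x} (hY : IsSmoothAt Y x) :
    ContMDiffAt (𝓡 2) 𝓘(ℝ, ℍ[ℝ]) ∞ (fun y => star (v y) * frameCoord e y (Y y) * v y) x :=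
  contMDiffAt_quat_mul (contMDiffAt_quat_mul (contMDiffAt_clm_comp quatStar hv)
    (he.contMDiffAt_frameCoord hU hx hY)) hv

theorem contMDiffAt_conj_omega2 {x : M} {v : M → ℍ[ℝ]}
    (hv : ContMDiffAt (𝓡 2) 𝓘(ℝ, ℍ[ℝ]) ∞ v x) :
    ContMDiffAt (𝓡 2) 𝓘(ℝ, ℍ[ℝ]) ∞ (fun y => star (v y) * omega2 * v y) x :=
  contMDiffAt_quat_mul (contMDiffAt_quat_mul (contMDiffAt_clm_comp quatStar hv)
    contMDiffAt_const) hv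

end IsOrientedFrameOn

end RotatedFrames

/-! ### The tangential form and the normal field of a spinor; Gauss and Weingarten formulas -/

section Spinors

open Topology

variable {M : Type*} [TopologicalSpace M] [ChartedSpace (EuclideanSpace ℝ (Fin 2)) M]
  [IsManifold (𝓡 2) ∞ M]
  [RiemannianBundle (fun x : M => TangentSpace (𝓡 2) x)]
  [IsContMDiffRiemannianBundle (𝓡 2) ∞ (EuclideanSpace ℝ (Fin 2))
    (fun x : M => TangentSpace (𝓡 2) x)]
  {o : SurfaceOrientation M} {σ : SpinStructure o}

namespace SpinStructure

/-- A spin frame around a point. -/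
def idx (σ : SpinStructure o) (x : M) : σ.ι := (σ.cover x).choose

theorem mem_idx (σ : SpinStructure o) (x : M) : x ∈ σ.U (σ.idx x) := (σ.cover x).choose_spec

theorem star_trans_mul (σ : SpinStructure o) {i j : σ.ι} {x : M} (hx : x ∈ σ.U i ∩ σ.U j) :
    star (σ.trans i j x) * σ.trans i j x = 1 := by
  obtain ⟨a, ha⟩ := σ.mem_spin i j x hx
  have h1 : (σ.trans i j x).imI = 0 := by rw [ha]
  have h2 : (σ.trans i j x).imJ = 0 := by rw [ha]
  have h3 : (σ.trans i j x).re = Real.cos a := by rw [ha]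
  have h4 : (σ.trans i j x).imK = Real.sin a := by rw [ha]
  rw [Quaternion.star_mul_self, Quaternion.normSq_def', h1, h2, h3, h4]
  simp

theorem omega2_mul_trans (σ : SpinStructure o) {i j : σ.ι} {x : M} (hx : x ∈ σ.U i ∩ σ.U j) :
    omega2 * σ.trans i j x = σ.trans i j x * omega2 := by
  obtain ⟨a, ha⟩ := σ.mem_spin i j x hx
  have h1 : (σ.trans i j x).imI = 0 := by rw [ha]
  have h2 : (σ.trans i j x).imJ = 0 := by rw [ha]
  ext <;> simp [h1, h2]

end SpinStructure

namespace SpinorField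

variable (φ : SpinorField σ)

theorem contMDiffAt_v {i : σ.ι} {x : M} (hx : x ∈ σ.U i) :
    ContMDiffAt (𝓡 2) 𝓘(ℝ, ℍ[ℝ]) ∞ (φ.v i) x :=
  (φ.smooth_v i).contMDiffAt ((σ.isOpen_U i).mem_nhds hx)

theorem mdiffAt_v {i : σ.ι} {x : M} (hx : x ∈ σ.U i) :
    MDifferentiableAt (𝓡 2) 𝓘(ℝ, ℍ[ℝ]) (φ.v i) x :=
  (φ.contMDiffAt_v hx).mdifferentiableAt (by simp)

theorem nabla_eq_spinDeriv (i : σ.ι) (x : M) (X : TangentSpace (𝓡 2) x) :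
    φ.nabla i x X = spinDeriv (σ.frame i) (φ.v i) x X := rfl

/-- The quaternion-valued form `X ↦ ⟨X · φ, φ⟩`. -/
def form (x : M) : TangentSpace (𝓡 2) x →L[ℝ] ℍ[ℝ] :=
  LinearMap.toContinuousLinearMap
    { toFun := fun X => star (φ.v (σ.idx x) x) * frameCoord (σ.frame (σ.idx x)) x X
        * φ.v (σ.idx x) x
      map_add' := fun X Y => by rw [frameCoord_add, mul_add, add_mul]
      map_smul' := fun c X => by
        rw [frameCoord_smul, mul_smul_comm, smul_mul_assoc, RingHom.id_apply] }

/-- The quaternion-valued function `⟨ω₂ · φ, φ⟩`. -/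
def normal (x : M) : ℍ[ℝ] := star (φ.v (σ.idx x) x) * omega2 * φ.v (σ.idx x) x

/-- The transition g acts on v by left multiplication and on tangent coordinates by conjugation, so
the factors cancel as `star g * g` = 1. The form is therefore global, although its definition picks
a spin frame at each point. -/
theorem form_eq {i : σ.ι} {x : M} (hx : x ∈ σ.U i) (X : TangentSpace (𝓡 2) x) :
    φ.form x X = star (φ.v i x) * frameCoord (σ.frame i) x X * φ.v i x := by
  have hx' : x ∈ σ.U (σ.idx x) ∩ σ.U i := ⟨σ.mem_idx x, hx⟩
  have h := σ.star_trans_mul hx'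
  change star (φ.v (σ.idx x) x) * frameCoord (σ.frame (σ.idx x)) x X * φ.v (σ.idx x) x = _
  rw [φ.compat _ _ x hx', σ.lift _ _ x hx', star_mul]
  set g := σ.trans (σ.idx x) i x
  calc _ = star (φ.v i x) * (star g * g) * frameCoord (σ.frame i) x X * (star g * g) * φ.v i x := by
        noncomm_ring
    _ = _ := by rw [h]; noncomm_ring

/-- Here frame independence comes from the fact that Spin(2), consisting of cos a + k sin a,
commutes with k. -/
theorem normal_eq {i : σ.ι} {x : M} (hx : x ∈ σ.U i) :
    φ.normal x = star (φ.v i x) * omega2 * φ.v i x := by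
  have hx' : x ∈ σ.U (σ.idx x) ∩ σ.U i := ⟨σ.mem_idx x, hx⟩
  have h := σ.star_trans_mul hx'
  have h' := σ.omega2_mul_trans hx'
  rw [normal, φ.compat _ _ x hx', star_mul]
  set g := σ.trans (σ.idx x) i x
  calc _ = star (φ.v i x) * star g * (omega2 * g) * φ.v i x := by noncomm_ring
    _ = star (φ.v i x) * (star g * g) * omega2 * φ.v i x := by rw [h']; noncomm_ring
    _ = _ := by rw [h]; noncomm_ring

theorem form_eventuallyEq {i : σ.ι} {x : M} (hx : x ∈ σ.U i)
    (Y : Π x : M, TangentSpace (𝓡 2) x) :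
    (fun y => φ.form y (Y y)) =ᶠ[𝓝 x]
      fun y => star (φ.v i y) * frameCoord (σ.frame i) y (Y y) * φ.v i y := by
  filter_upwards [(σ.isOpen_U i).mem_nhds hx] with y hy using φ.form_eq hy (Y y)

theorem normal_eventuallyEq {i : σ.ι} {x : M} (hx : x ∈ σ.U i) :
    φ.normal =ᶠ[𝓝 x] fun y => star (φ.v i y) * omega2 * φ.v i y := by
  filter_upwards [(σ.isOpen_U i).mem_nhds hx] with y hy using φ.normal_eq hy

theorem contMDiffAt_form {x : M} {Y : Π x : M, TangentSpace (𝓡 2) x} (hY : IsSmoothAt Y x) :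
    ContMDiffAt (𝓡 2) 𝓘(ℝ, ℍ[ℝ]) ∞ (fun y => φ.form y (Y y)) x :=
  ((σ.isFrame _).contMDiffAt_conj_frameCoord (σ.isOpen_U _) (σ.mem_idx x)
    (φ.contMDiffAt_v (σ.mem_idx x)) hY).congr_of_eventuallyEq
    (φ.form_eventuallyEq (σ.mem_idx x) Y)

theorem contMDiff_normal : ContMDiff (𝓡 2) 𝓘(ℝ, ℍ[ℝ]) ∞ φ.normal := fun x =>
  (IsOrientedFrameOn.contMDiffAt_conj_omega2
    (φ.contMDiffAt_v (σ.mem_idx x))).congr_of_eventuallyEq (φ.normal_eventuallyEq (σ.mem_idx x))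

/-- `|φ| = 1`. -/
def UnitNorm : Prop := ∀ i, ∀ x ∈ σ.U i, ‖φ.v i x‖ = 1

/-- The endomorphism `A` with `∇_X φ = A φ` for a spinor field which is constant along an
immersion. -/
def connTerm (τ : ℝ) (S : Π x : M, TangentSpace (𝓡 2) x →L[ℝ] TangentSpace (𝓡 2) x)
    (T : Π x : M, TangentSpace (𝓡 2) x) (lam : M → ℝ) (i : σ.ι) (x : M)
    (X : TangentSpace (𝓡 2) x) : ℍ[ℝ] :=
  -((1 / 2 : ℝ) • (frameCoord (σ.frame i) x (S x X) * omega2))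
    + (τ / 2) • frameCoord (σ.frame i) x X
    - (τ * inner ℝ X (T x)) • (frameCoord (σ.frame i) x (T x) + lam x • omega2)

variable {φ} {τ : ℝ} {S : Π x : M, TangentSpace (𝓡 2) x →L[ℝ] TangentSpace (𝓡 2) x}
  {T : Π x : M, TangentSpace (𝓡 2) x} {lam : M → ℝ}

theorem connTerm_mul (i : σ.ι) (x : M) (X : TangentSpace (𝓡 2) x) (q : ℍ[ℝ]) :
    connTerm τ S T lam i x X * q = -((1 / 2 : ℝ) • cl σ i x (S x X) (omega2 * q))
      + (τ / 2) • cl σ i x X q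
      - (τ * inner ℝ X (T x)) • (cl σ i x (T x) q + lam x • (omega2 * q)) := by
  simp only [connTerm, cl, add_mul, sub_mul, neg_mul, smul_mul_assoc, mul_assoc]

theorem isConstantNil3_iff : φ.IsConstantNil3 τ S T lam ↔
    ∀ i, ∀ x ∈ σ.U i, ∀ X : TangentSpace (𝓡 2) x,
      φ.nabla i x X = connTerm τ S T lam i x X * φ.v i x := by
  simp only [IsConstantNil3, connTerm_mul]

/-- The potential is imaginary. This makes |φ| constant and turns derivatives of conjugates into
commutators. -/
theorem star_connTerm (i : σ.ι) (x : M) (X : TangentSpace (𝓡 2) x) :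
    star (connTerm τ S T lam i x X) = -connTerm τ S T lam i x X := by
  ext <;> simp [connTerm] <;> ring

/-- By the Clifford relation, and since k anticommutes with tangent vectors, the S-term contributes
a normal component, the second fundamental form. The τ-terms are left as a commutator with X -
2⟨X,T⟩(T + λk), the shape in which they match the connection of Nil₃(τ). -/
theorem frameCoord_comm_connTerm {i : σ.ι} {x : M} (hx : x ∈ σ.U i)
    (X Y : TangentSpace (𝓡 2) x) :
    frameCoord (σ.frame i) x Y * connTerm τ S T lam i x X
        - connTerm τ S T lam i x X * frameCoord (σ.frame i) x Y
      = (inner ℝ (S x X) Y : ℝ) • omega2 + (τ / 2) •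
        (frameCoord (σ.frame i) x Y * (frameCoord (σ.frame i) x X
            - (2 * inner ℝ X (T x) : ℝ) • (frameCoord (σ.frame i) x (T x) + lam x • omega2))
          - (frameCoord (σ.frame i) x X
            - (2 * inner ℝ X (T x) : ℝ) • (frameCoord (σ.frame i) x (T x) + lam x • omega2))
          * frameCoord (σ.frame i) x Y) := by
  rw [(σ.isFrame i).inner_eq hx (S x X) Y]
  ext <;> simp [connTerm] <;> ring

theorem omega2_comm_connTerm (i : σ.ι) (x : M) (X : TangentSpace (𝓡 2) x) :
    omega2 * connTerm τ S T lam i x X - connTerm τ S T lam i x X * omega2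
      = -frameCoord (σ.frame i) x (S x X) + (τ / 2) •
        (omega2 * (frameCoord (σ.frame i) x X
            - (2 * inner ℝ X (T x) : ℝ) • (frameCoord (σ.frame i) x (T x) + lam x • omega2))
          - (frameCoord (σ.frame i) x X
            - (2 * inner ℝ X (T x) : ℝ) • (frameCoord (σ.frame i) x (T x) + lam x • omega2))
          * omega2) := by
  ext <;> simp [connTerm] <;> ring

/-- The vector field `T + λ ν` along the immersion, read through `φ`. -/
def vert (φ : SpinorField σ) (T : Π x : M, TangentSpace (𝓡 2) x) (lam : M → ℝ) (x : M) : ℍ[ℝ] :=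
  φ.form x (T x) + lam x • φ.normal x

theorem conj_comm {v : ℍ[ℝ]} (hv : v * star v = 1) (a b : ℍ[ℝ]) :
    star v * (a * b - b * a) * v
      = (star v * a * v) * (star v * b * v) - (star v * b * v) * (star v * a * v) := by
  have h : ∀ a b : ℍ[ℝ], (star v * a * v) * (star v * b * v) = star v * (a * b) * v := by
    intro a b
    calc _ = star v * a * (v * star v) * b * v := by noncomm_ring
      _ = _ := by rw [hv]; noncomm_ring
  rw [h, h, mul_sub, sub_mul]

/-- Read in the ambient space, the twisted vector is the negative of the reflection of X that fixes
the vertical direction's sign-reversed line: X minus twice ⟨X,T⟩ times T + λν, the analogue of a -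
2a₃E₃ in the connection of Nil₃(τ). -/
theorem conj_twisted {i : σ.ι} {x : M} (hx : x ∈ σ.U i) (X : TangentSpace (𝓡 2) x) :
    star (φ.v i x) * (frameCoord (σ.frame i) x X
      - (2 * inner ℝ X (T x) : ℝ) • (frameCoord (σ.frame i) x (T x) + lam x • omega2)) * φ.v i x
    = φ.form x X - (2 * inner ℝ X (T x) : ℝ) • φ.vert T lam x := by
  rw [vert, φ.form_eq hx, φ.form_eq hx, φ.normal_eq hx]
  simp only [mul_sub, sub_mul, mul_add, add_mul, mul_smul_comm, smul_mul_assoc]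

/-- The Gauss formula for a constant spinor field. -/
theorem IsConstantNil3.mvfderiv_form (hc : φ.IsConstantNil3 τ S T lam) (hu : φ.UnitNorm) {x : M}
    {Y : Π x : M, TangentSpace (𝓡 2) x} (hY : IsSmoothAt Y x) (X : TangentSpace (𝓡 2) x) :
    mvfderiv (𝓡 2) (fun y => φ.form y (Y y)) x X
      = φ.form x (leviCivita Y x X) + (inner ℝ (S x X) (Y x) : ℝ) • φ.normal x
        + (τ / 2) • (φ.form x (Y x) * (φ.form x X - (2 * inner ℝ X (T x) : ℝ) • φ.vert T lam x)
          - (φ.form x X - (2 * inner ℝ X (T x) : ℝ) • φ.vert T lam x) * φ.form x (Y x)) := by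
  have hx := σ.mem_idx x
  set i := σ.idx x
  have hv := self_mul_star_of_norm_eq_one (hu i x hx)
  rw [(φ.form_eventuallyEq hx Y).mvfderiv_eq,
    (σ.isFrame i).mvfderiv_conj_frameCoord (σ.isOpen_U i) hx (φ.mdiffAt_v hx) hY X,
    ← nabla_eq_spinDeriv, isConstantNil3_iff.1 hc i x hx X, ← conj_twisted hx,
    φ.form_eq hx, φ.form_eq hx, φ.normal_eq hx, ← conj_comm hv, star_mul, star_connTerm]
  have h := frameCoord_comm_connTerm (τ := τ) (S := S) (T := T) (lam := lam) hx X (Y x)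
  have h2 := congrArg (fun q => star (φ.v i x) * q * φ.v i x) h
  beta_reduce at h2
  rw [mul_add, add_mul, mul_smul_comm, smul_mul_assoc, mul_smul_comm, smul_mul_assoc] at h2
  rw [add_assoc, ← h2]
  noncomm_ring

/-- The Weingarten formula for a constant spinor field. -/
theorem IsConstantNil3.mvfderiv_normal (hc : φ.IsConstantNil3 τ S T lam) (hu : φ.UnitNorm) {x : M}
    (X : TangentSpace (𝓡 2) x) :
    mvfderiv (𝓡 2) φ.normal x X
      = -φ.form x (S x X)
        + (τ / 2) • (φ.normal x * (φ.form x X - (2 * inner ℝ X (T x) : ℝ) • φ.vert T lam x)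
          - (φ.form x X - (2 * inner ℝ X (T x) : ℝ) • φ.vert T lam x) * φ.normal x) := by
  have hx := σ.mem_idx x
  set i := σ.idx x
  have hv := self_mul_star_of_norm_eq_one (hu i x hx)
  rw [(φ.normal_eventuallyEq hx).mvfderiv_eq,
    IsOrientedFrameOn.mvfderiv_conj_omega2 (σ.frame i) (φ.mdiffAt_v hx) X,
    ← nabla_eq_spinDeriv, isConstantNil3_iff.1 hc i x hx X, ← conj_twisted hx,
    φ.form_eq hx, φ.normal_eq hx, ← conj_comm hv, star_mul, star_connTerm]
  have h := omega2_comm_connTerm (τ := τ) (S := S) (T := T) (lam := lam) i x X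
  have h2 := congrArg (fun q => star (φ.v i x) * q * φ.v i x) h
  beta_reduce at h2
  rw [mul_add, add_mul, mul_smul_comm, smul_mul_assoc, mul_neg, neg_mul] at h2
  rw [← h2]
  noncomm_ring

end SpinorField

end Spinors

/-! ### Imaginary quaternions and the Levi-Civita connection of the Heisenberg group -/

section QuaternionR3

/-- The imaginary part of a quaternion, as a vector of `ℝ³`. -/
def toR3 : ℍ[ℝ] →L[ℝ] R3 :=
  LinearMap.toContinuousLinearMap
    { toFun := fun q => !₂[q.imI, q.imJ, q.imK]
      map_add' := fun p q => by ext i; fin_cases i <;> simp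
      map_smul' := fun c q => by ext i; fin_cases i <;> simp }

@[simp] theorem toR3_zero (q : ℍ[ℝ]) : toR3 q 0 = q.imI := rfl

@[simp] theorem toR3_one (q : ℍ[ℝ]) : toR3 q 1 = q.imJ := rfl

@[simp] theorem toR3_two (q : ℍ[ℝ]) : toR3 q 2 = q.imK := rfl

theorem inner_toR3 {a b : ℍ[ℝ]} (ha : a.re = 0) :
    (inner ℝ (toR3 a) (toR3 b) : ℝ) = inner ℝ a b := by
  rw [Quaternion.inner_def, PiLp.inner_apply, Fin.sum_univ_three]
  simp [ha]
  ring

/-- The triple product of imaginary quaternions. It ties the orientation of ℝ³ to the convention ij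
= k. -/
theorem det_toR3 {a b c : ℍ[ℝ]} (ha : a.re = 0) (hb : b.re = 0) (hc : c.re = 0) :
    (Matrix.of ![(toR3 a).ofLp, (toR3 b).ofLp, (toR3 c).ofLp]).det = -(a * b * c).re := by
  rw [Matrix.det_fin_three]
  simp [ha, hb, hc]
  ring

/-- The Levi-Civita connection of `Nil₃(τ)` on left-invariant vector fields, in terms of
quaternions. -/
def quatConn (τ : ℝ) (a b : ℍ[ℝ]) : ℍ[ℝ] :=
  (τ / 2) • ((a - (2 * a.imK) • omega2) * b - b * (a - (2 * a.imK) • omega2))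

/-- The connection has the form μ(a) × b with μ = diag(τ, τ, -τ), and a commutator of imaginary
quaternions is twice a cross product. -/
theorem toR3_quatConn (τ : ℝ) (a b : ℍ[ℝ]) :
    toR3 (quatConn τ a b) = Nil3.conn τ (toR3 a) (toR3 b) := by
  ext i; fin_cases i <;> simp [quatConn, Nil3.conn] <;> ring

theorem quatConn_self_right (τ : ℝ) (a b : ℍ[ℝ]) :
    quatConn τ a b = -((τ / 2) • (b * (a - (2 * a.imK) • omega2)
      - (a - (2 * a.imK) • omega2) * b)) := by
  rw [quatConn, ← smul_neg, neg_sub]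

theorem re_eq_zero_of_star_eq_neg {a : ℍ[ℝ]} (h : star a = -a) : a.re = 0 := by
  have := congrArg QuaternionAlgebra.re h
  rw [Quaternion.re_star, Quaternion.re_neg] at this
  linarith

/-- Every imaginary unit is conjugate to `k`. -/
theorem exists_conj_eq_omega2 {E : ℍ[ℝ]} (hE : E * E = -1) :
    ∃ q : ℍ[ℝ], ‖q‖ = 1 ∧ star q * E * q = omega2 := by
  -- p = 1 - Ek satisfies Ep = pk, so its normalisation conjugates E to k. It vanishes only for E =
  -- -k, where i does the job.
  by_cases h : 1 - E * omega2 = 0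
  · have h1 : E = -omega2 := by
      have : (1 - E * omega2) * omega2 = 0 := by rw [h, zero_mul]
      rw [sub_mul, one_mul, mul_assoc, omega2_mul_omega2] at this
      have h2 : omega2 + E = 0 := by simpa using this
      exact eq_neg_of_add_eq_zero_right h2
    refine ⟨unitI, ?_, ?_⟩
    · have : ‖unitI‖ * ‖unitI‖ = 1 := by
        rw [← Quaternion.normSq_eq_norm_mul_self, Quaternion.normSq_def']
        simp
      nlinarith [norm_nonneg unitI]
    · rw [h1]
      ext <;> simp
  · set p := 1 - E * omega2 with hp
    have h1 : E * p = p * omega2 := by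
      rw [hp, mul_sub, sub_mul, mul_assoc E, omega2_mul_omega2, ← mul_assoc, hE]
      noncomm_ring
    have hn : ‖p‖ ≠ 0 := norm_ne_zero_iff.2 h
    have hq : ‖(‖p‖⁻¹ : ℝ) • p‖ = 1 := by
      rw [norm_smul, norm_inv, norm_norm, inv_mul_cancel₀ hn]
    refine ⟨(‖p‖⁻¹ : ℝ) • p, hq, ?_⟩
    rw [mul_assoc, mul_smul_comm, h1, ← smul_mul_assoc, ← mul_assoc,
      star_mul_self_of_norm_eq_one hq, one_mul]

end QuaternionR3

/-! ### Sums, differences and scalar multiples of differentiable functions -/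

section Sums

variable {H : Type*} [TopologicalSpace H] {E : Type*} [NormedAddCommGroup E] [NormedSpace ℝ E]
  {I : ModelWithCorners ℝ E H} {M : Type*} [TopologicalSpace M] [ChartedSpace H M]
  {F : Type*} [NormedAddCommGroup F] [NormedSpace ℝ F]

theorem mdiffAt_add_fun {f g : M → F} {x : M} (hf : MDiffAt f x) (hg : MDiffAt g x) :
    MDiffAt (fun y => f y + g y) x :=
  hf.add hg

theorem mdiffAt_sub_fun {f g : M → F} {x : M} (hf : MDiffAt f x) (hg : MDiffAt g x) :
    MDiffAt (fun y => f y - g y) x :=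
  hf.sub hg

theorem contMDiffAt_smul_fun [IsManifold I ∞ M] {f : M → ℝ} {g : M → F} {x : M}
    (hf : ContMDiffAt I 𝓘(ℝ, ℝ) ∞ f x) (hg : ContMDiffAt I 𝓘(ℝ, F) ∞ g x) :
    ContMDiffAt I 𝓘(ℝ, F) ∞ (fun y => f y • g y) x :=
  contMDiffAt_bilinear (ContinuousLinearMap.lsmul ℝ ℝ) hf hg

end Sums

/-! ### Integrating the Maurer-Cartan equation in the Heisenberg group -/

section NilIntegration

open Topology

variable {M : Type*} [TopologicalSpace M] [ChartedSpace (EuclideanSpace ℝ (Fin 2)) M]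
  [IsManifold (𝓡 2) ∞ M] [SimplyConnectedSpace M] [LocallyPathConnectedSpace M]

/-- On a simply connected surface, a `𝔫𝔦𝔩₃(τ)`-valued form which satisfies the Maurer-Cartan
equation is the Darboux derivative of a map into `Nil₃(τ)`. -/
theorem exists_nilDeriv_eq (τ : ℝ) {α : Π x : M, TangentSpace (𝓡 2) x →L[ℝ] R3}
    (hs : IsSmoothForm α)
    (hmc : ∀ (x : M) (X Y : Π x : M, TangentSpace (𝓡 2) x), IsSmoothAt X x → IsSmoothAt Y x →
      mvfderiv (𝓡 2) (fun y => α y (Y y)) x (X x) - mvfderiv (𝓡 2) (fun y => α y (X y)) x (Y x)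
        = α x (mlieBracket (𝓡 2) X Y x) - Nil3.bracket τ (α x (X x)) (α x (Y x))) :
    ∃ f : M → R3, ContMDiff (𝓡 2) (𝓡 3) ∞ f ∧ ∀ x X, nilDeriv τ f x X = α x X := by
  let α' : Fin 3 → Π x : M, TangentSpace (𝓡 2) x →L[ℝ] ℝ := fun i x =>
    (EuclideanSpace.proj i : R3 →L[ℝ] ℝ) ∘L α x
  have hα's : ∀ i, IsSmoothForm (I := 𝓡 2) (α' i) := fun i x X hX =>
    contMDiffAt_clm_comp (EuclideanSpace.proj i : R3 →L[ℝ] ℝ) (hs x X hX)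
  have hdiff : ∀ (i : Fin 3) (x : M) (X : Π x : M, TangentSpace (𝓡 2) x), IsSmoothAt X x →
      MDifferentiableAt (𝓡 2) 𝓘(ℝ, ℝ) (fun y => α' i y (X y)) x := fun i x X hX =>
    (hα's i x X hX).mdifferentiableAt (by simp)
  have hder : ∀ (i : Fin 3) (x : M) (X Y : Π x : M, TangentSpace (𝓡 2) x), IsSmoothAt X x →
      IsSmoothAt Y x → mvfderiv (𝓡 2) (fun y => α' i y (Y y)) x (X x)
        - mvfderiv (𝓡 2) (fun y => α' i y (X y)) x (Y x)
        = α' i x (mlieBracket (𝓡 2) X Y x) - Nil3.bracket τ (α x (X x)) (α x (Y x)) i := by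
    intro i x X Y hX hY
    have h := congrArg (EuclideanSpace.proj i : R3 →L[ℝ] ℝ) (hmc x X Y hX hY)
    rw [map_sub, map_sub,
      ← mvfderiv_clm_comp ((hs x Y hY).mdifferentiableAt (by simp)),
      ← mvfderiv_clm_comp ((hs x X hX).mdifferentiableAt (by simp))] at h
    exact h
  -- The bracket takes values in the centre, the third axis, so the first two components are closed
  -- and can be integrated at once.
  have hcl : ∀ i : Fin 3, i ≠ 2 → IsClosedForm (I := 𝓡 2) (α' i) := by
    intro i hi x X Y hX hY
    rw [hder i x X Y hX hY]
    fin_cases i <;> simp [Nil3.bracket] at hi ⊢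
  obtain ⟨f0, hf0, hd0⟩ := (hcl 0 (by decide)).exists_primitive (hα's 0)
  obtain ⟨f1, hf1, hd1⟩ := (hcl 1 (by decide)).exists_primitive (hα's 1)
  -- The third coordinate must satisfy df₂ = α₂ + τ(f₀ df₁ - f₁ df₀). The bracket term in dα₂ is
  -- exactly what d of the second summand cancels.
  let β : Π x : M, TangentSpace (𝓡 2) x →L[ℝ] ℝ := fun x =>
    α' 2 x + τ • (f0 x • α' 1 x - f1 x • α' 0 x)
  have hm0 : ∀ x, MDifferentiableAt (𝓡 2) 𝓘(ℝ, ℝ) f0 x := hf0.mdifferentiable (by simp)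
  have hm1 : ∀ x, MDifferentiableAt (𝓡 2) 𝓘(ℝ, ℝ) f1 x := hf1.mdifferentiable (by simp)
  have hβs : IsSmoothForm (I := 𝓡 2) β := by
    intro x X hX
    have h := (contMDiffAt_smul_fun (hf0 x) (hα's 1 x X hX)).sub
      (contMDiffAt_smul_fun (hf1 x) (hα's 0 x X hX))
    exact (hα's 2 x X hX).add (contMDiffAt_clm_comp (ContinuousLinearMap.lsmul ℝ ℝ τ) h)
  have hβd : ∀ (x : M) (X : Π x : M, TangentSpace (𝓡 2) x), IsSmoothAt X x →
      ∀ v : TangentSpace (𝓡 2) x, mvfderiv (𝓡 2) (fun y => β y (X y)) x v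
        = mvfderiv (𝓡 2) (fun y => α' 2 y (X y)) x v
          + τ * ((α' 0 x v * α' 1 x (X x) + f0 x * mvfderiv (𝓡 2) (fun y => α' 1 y (X y)) x v)
            - (α' 1 x v * α' 0 x (X x) + f1 x * mvfderiv (𝓡 2) (fun y => α' 0 y (X y)) x v)) := by
    intro x X hX v
    have e : (fun y => β y (X y)) = fun y => α' 2 y (X y) + (ContinuousLinearMap.lsmul ℝ ℝ τ)
        (f0 y • α' 1 y (X y) - f1 y • α' 0 y (X y)) := rfl
    have h0 := mdiffAt_smul_fun (hm0 x) (hdiff 1 x X hX)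
    have h1 := mdiffAt_smul_fun (hm1 x) (hdiff 0 x X hX)
    rw [e, mvfderiv_add_apply (hdiff 2 x X hX) (mdiffAt_clm_comp (mdiffAt_sub_fun h0 h1) _),
      mvfderiv_clm_comp (mdiffAt_sub_fun h0 h1), mvfderiv_sub_apply h0 h1,
      mvfderiv_smul_fun (hm0 x) (hdiff 1 x X hX), mvfderiv_smul_fun (hm1 x) (hdiff 0 x X hX),
      hd0, hd1]
    rfl
  have hβc : IsClosedForm (I := 𝓡 2) β := by
    intro x X Y hX hY
    rw [hβd x Y hY, hβd x X hX]
    have h0 := hder 0 x X Y hX hY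
    have h1 := hder 1 x X Y hX hY
    have h2 := hder 2 x X Y hX hY
    have b0 : Nil3.bracket τ (α x (X x)) (α x (Y x)) 0 = 0 := rfl
    have b1 : Nil3.bracket τ (α x (X x)) (α x (Y x)) 1 = 0 := rfl
    have b2 : Nil3.bracket τ (α x (X x)) (α x (Y x)) 2
      = 2 * τ * (α' 0 x (X x) * α' 1 x (Y x) - α' 1 x (X x) * α' 0 x (Y x)) := rfl
    rw [b0] at h0
    rw [b1] at h1
    rw [b2] at h2
    have e : β x (mlieBracket (𝓡 2) X Y x) = α' 2 x (mlieBracket (𝓡 2) X Y x)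
        + τ * (f0 x * α' 1 x (mlieBracket (𝓡 2) X Y x)
          - f1 x * α' 0 x (mlieBracket (𝓡 2) X Y x)) := rfl
    rw [e]
    linear_combination h2 + τ * f0 x * h1 - τ * f1 x * h0
  obtain ⟨f2, hf2, hd2⟩ := hβc.exists_primitive hβs
  have hm2 : ∀ x, MDifferentiableAt (𝓡 2) 𝓘(ℝ, ℝ) f2 x := hf2.mdifferentiable (by simp)
  let b : Fin 3 → R3 := fun i => EuclideanSpace.single i 1
  refine ⟨fun x => f0 x • b 0 + f1 x • b 1 + f2 x • b 2, ?_, ?_⟩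
  · exact ((hf0.smul contMDiff_const).add (hf1.smul contMDiff_const)).add
      (hf2.smul contMDiff_const)
  · intro x X
    have h0 := mdiffAt_smul_const (hm0 x) (b 0)
    have h1 := mdiffAt_smul_const (hm1 x) (b 1)
    have h2 := mdiffAt_smul_const (hm2 x) (b 2)
    rw [nilDeriv, mvfderiv_add_apply (mdiffAt_add_fun h0 h1) h2, mvfderiv_add_apply h0 h1,
      mvfderiv_smul_const (hm0 x), mvfderiv_smul_const (hm1 x), mvfderiv_smul_const (hm2 x),
      hd0, hd1, hd2]
    have e0 : α' 0 x X = α x X 0 := rfl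
    have e1 : α' 1 x X = α x X 1 := rfl
    have e2 : β x X = α x X 2 + τ * (f0 x * α x X 1 - f1 x * α x X 0) := rfl
    rw [e0, e1, e2]
    ext i; fin_cases i <;> simp [Nil3.mc, b]

end NilIntegration

/-! ### From a constant spinor to an immersion -/

section ConstantSpinors

open Topology

variable {M : Type*} [TopologicalSpace M] [ChartedSpace (EuclideanSpace ℝ (Fin 2)) M]
  [IsManifold (𝓡 2) ∞ M]
  [RiemannianBundle (fun x : M => TangentSpace (𝓡 2) x)]
  [IsContMDiffRiemannianBundle (𝓡 2) ∞ (EuclideanSpace ℝ (Fin 2))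
    (fun x : M => TangentSpace (𝓡 2) x)]
  {o : SurfaceOrientation M} {σ : SpinStructure o}

/-- All conditions on an isometric immersion into `Nil₃(τ)` except for the one on the vertical
field; for `τ = 0`, these are the isometric immersions into `ℝ³`. -/
structure IsNilImmersion (o : SurfaceOrientation M) (τ : ℝ)
    (S : Π x : M, TangentSpace (𝓡 2) x →L[ℝ] TangentSpace (𝓡 2) x) (f nu : M → R3) : Prop where
  smooth_f : ContMDiff (𝓡 2) (𝓡 3) ∞ f
  smooth_nu : ContMDiff (𝓡 2) (𝓡 3) ∞ nu
  isometric : ∀ (x : M) (X Y : TangentSpace (𝓡 2) x),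
    (inner ℝ (nilDeriv τ f x X) (nilDeriv τ f x Y) : ℝ) = inner ℝ X Y
  unit : ∀ x, ‖nu x‖ = 1
  normal : ∀ (x : M) (X : TangentSpace (𝓡 2) x), (inner ℝ (nilDeriv τ f x X) (nu x) : ℝ) = 0
  oriented : ∀ (x : M) (X : TangentSpace (𝓡 2) x), X ≠ 0 →
    PositivelyOriented (nilDeriv τ f x X) (nilDeriv τ f x (o.J x X)) (nu x)
  shape : ∀ (x : M) (X : TangentSpace (𝓡 2) x),
    nilCov τ f nu x X = - nilDeriv τ f x (S x X)

theorem mc_zero (p w : R3) : Nil3.mc 0 p w = w := by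
  ext i; fin_cases i <;> simp [Nil3.mc]

theorem conn_zero (a b : R3) : Nil3.conn 0 a b = 0 := by
  ext i; fin_cases i <;> simp [Nil3.conn]

theorem isImmersionR3_iff {S : Π x : M, TangentSpace (𝓡 2) x →L[ℝ] TangentSpace (𝓡 2) x}
    {f nu : M → R3} : IsImmersionR3 o S f nu ↔ IsNilImmersion o 0 S f nu := by
  have h : ∀ x X, nilDeriv 0 f x X = mvfderiv (𝓡 2) f x X := fun x X => mc_zero _ _
  have h' : ∀ x X, nilCov 0 f nu x X = mvfderiv (𝓡 2) nu x X := fun x X => by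
    rw [nilCov, conn_zero, add_zero]
  constructor
  · rintro ⟨h1, h2, h3, h4, h5, h6, h7⟩
    refine ⟨h1, h2, ?_, h4, ?_, ?_, ?_⟩ <;> simpa only [h, h']
  · rintro ⟨h1, h2, h3, h4, h5, h6, h7⟩
    simp only [h, h'] at h3 h5 h6 h7
    exact ⟨h1, h2, h3, h4, h5, h6, h7⟩

theorem isImmersionNil3_iff {τ : ℝ}
    {S : Π x : M, TangentSpace (𝓡 2) x →L[ℝ] TangentSpace (𝓡 2) x}
    {T : Π x : M, TangentSpace (𝓡 2) x} {lam : M → ℝ} {f nu : M → R3} :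
    IsImmersionNil3 o τ S T lam f nu ↔ IsNilImmersion o τ S f nu ∧
      ∀ x, nilDeriv τ f x (T x) + lam x • nu x = !₂[0, 0, 1] :=
  ⟨fun ⟨h1, h2, h3, h4, h5, h6, h7, h8⟩ => ⟨⟨h1, h2, h3, h4, h5, h6, h7⟩, h8⟩,
    fun ⟨⟨h1, h2, h3, h4, h5, h6, h7⟩, h8⟩ => ⟨h1, h2, h3, h4, h5, h6, h7, h8⟩⟩

namespace SpinorField

variable {φ : SpinorField σ} {τ : ℝ}
  {S : Π x : M, TangentSpace (𝓡 2) x →L[ℝ] TangentSpace (𝓡 2) x}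
  {T : Π x : M, TangentSpace (𝓡 2) x} {lam : M → ℝ}

theorem isConstantR3_iff : φ.IsConstantR3 S ↔ φ.IsConstantNil3 0 S 0 0 := by
  simp [IsConstantR3, IsConstantNil3]

/-- The right multiple of a spinor field by a quaternion. -/
def mulRight (φ : SpinorField σ) (q : ℍ[ℝ]) : SpinorField σ where
  v i x := φ.v i x * q
  smooth_v i := fun x hx =>
    (contMDiffAt_quat_mul (φ.contMDiffAt_v hx) contMDiffAt_const).contMDiffWithinAt
  compat i j x hx := by rw [φ.compat i j x hx, mul_assoc]

theorem mulRight_v (q : ℍ[ℝ]) (i : σ.ι) (x : M) : (φ.mulRight q).v i x = φ.v i x * q := rfl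

theorem mulRight_nabla (q : ℍ[ℝ]) {i : σ.ι} {x : M} (hx : x ∈ σ.U i) (X : TangentSpace (𝓡 2) x) :
    (φ.mulRight q).nabla i x X = φ.nabla i x X * q := by
  have h : mvfderiv (𝓡 2) ((φ.mulRight q).v i) x X = mvfderiv (𝓡 2) (φ.v i) x X * q := by
    have := mvfderiv_quat_mul (φ.mdiffAt_v hx)
      (mdifferentiableAt_const (I := 𝓡 2) (I' := 𝓘(ℝ, ℍ[ℝ])) (c := q)) X
    rw [mvfderiv_const] at this
    refine this.trans ?_
    simp
  rw [nabla, h, nabla, add_mul, smul_mul_assoc, mul_assoc, mulRight_v]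

/-- The equation involves left multiplications only, so constants act on solutions from the right.
Real constants normalise |φ|, unit quaternions rotate the ambient frame. -/
theorem IsConstantNil3.mulRight (hc : φ.IsConstantNil3 τ S T lam) (q : ℍ[ℝ]) :
    (φ.mulRight q).IsConstantNil3 τ S T lam := by
  rw [isConstantNil3_iff] at hc ⊢
  intro i x hx X
  rw [mulRight_nabla q hx, hc i x hx X, mul_assoc]
  rfl

theorem mulRight_form (q : ℍ[ℝ]) (x : M) (X : TangentSpace (𝓡 2) x) :
    (φ.mulRight q).form x X = star q * φ.form x X * q := by
  rw [form_eq _ (σ.mem_idx x), form_eq _ (σ.mem_idx x), mulRight_v, star_mul]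
  noncomm_ring

theorem mulRight_normal (q : ℍ[ℝ]) (x : M) :
    (φ.mulRight q).normal x = star q * φ.normal x * q := by
  rw [normal_eq _ (σ.mem_idx x), normal_eq _ (σ.mem_idx x), mulRight_v, star_mul]
  noncomm_ring

theorem mulRight_vert (q : ℍ[ℝ]) (x : M) :
    (φ.mulRight q).vert T lam x = star q * φ.vert T lam x * q := by
  rw [vert, vert, mulRight_form, mulRight_normal, mul_add, add_mul, mul_smul_comm, smul_mul_assoc]

theorem UnitNorm.mulRight (hu : φ.UnitNorm) {q : ℍ[ℝ]} (hq : ‖q‖ = 1) :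
    (φ.mulRight q).UnitNorm := by
  intro i x hx
  rw [mulRight_v, norm_mul, hu i x hx, hq, one_mul]

/-- The squared norm of a spinor field, as a quaternion. -/
def normForm (φ : SpinorField σ) (x : M) : ℍ[ℝ] := star (φ.v (σ.idx x) x) * φ.v (σ.idx x) x

theorem norm_v_eq {i j : σ.ι} {x : M} (hi : x ∈ σ.U i) (hj : x ∈ σ.U j) :
    star (φ.v i x) * φ.v i x = star (φ.v j x) * φ.v j x := by
  rw [φ.compat i j x ⟨hi, hj⟩, star_mul, mul_assoc, ← mul_assoc (star (σ.trans i j x)),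
    σ.star_trans_mul ⟨hi, hj⟩, one_mul]

theorem mvfderiv_star_mul_self {i : σ.ι} {x : M} (hx : x ∈ σ.U i) (X : TangentSpace (𝓡 2) x) :
    mvfderiv (𝓡 2) (fun y => star (φ.v i y) * φ.v i y) x X
      = star (φ.nabla i x X) * φ.v i x + star (φ.v i x) * φ.nabla i x X := by
  have hv := φ.mdiffAt_v hx
  rw [mvfderiv_quat_mul (mdiffAt_quat_star hv) hv, mvfderiv_quat_star hv, nabla]
  generalize (1 / 2 * inner ℝ (leviCivita (σ.frame i 0) x X) (σ.frame i 1 x) : ℝ) = c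
  simp only [star_add, Quaternion.star_smul, star_mul, star_omega2, mul_add, add_mul,
    smul_mul_assoc, mul_smul_comm, mul_assoc, mul_neg, neg_mul, smul_neg]
  module

/-- The derivative of |φ|² is v*(A* + A)v, which vanishes for imaginary A. -/
theorem constNorm_of_nabla_eq [PreconnectedSpace M] {A : ∀ (_ : σ.ι) (x : M),
      TangentSpace (𝓡 2) x → ℍ[ℝ]} (hA : ∀ i x X, star (A i x X) = -A i x X)
    (h : ∀ i, ∀ x ∈ σ.U i, ∀ X : TangentSpace (𝓡 2) x, φ.nabla i x X = A i x X * φ.v i x) :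
    φ.ConstNorm := by
  have hev : ∀ x, φ.normForm =ᶠ[𝓝 x] fun y => star (φ.v (σ.idx x) y) * φ.v (σ.idx x) y := by
    intro x
    filter_upwards [(σ.isOpen_U _).mem_nhds (σ.mem_idx x)] with y hy
    exact norm_v_eq (σ.mem_idx y) hy
  have hconst := eq_of_mvfderiv_eq_zero (I := 𝓡 2) (h := φ.normForm)
    (fun x => (mdiffAt_quat_mul (mdiffAt_quat_star (φ.mdiffAt_v (σ.mem_idx x)))
      (φ.mdiffAt_v (σ.mem_idx x))).congr_of_eventuallyEq (hev x))
    (fun x => by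
      rw [(hev x).mvfderiv_eq]
      ext1 X
      rw [mvfderiv_star_mul_self (σ.mem_idx x), h _ x (σ.mem_idx x), star_mul, hA]
      simp [mul_assoc])
  rcases isEmpty_or_nonempty M with hM | ⟨⟨x₀⟩⟩
  · exact ⟨0, fun i x => (hM.false x).elim⟩
  · refine ⟨‖φ.v (σ.idx x₀) x₀‖, fun i x hx => ?_⟩
    have h1 := hconst x x₀
    rw [normForm, norm_v_eq (σ.mem_idx x) hx, normForm] at h1
    have h2 := congrArg norm h1
    rw [norm_mul, norm_mul, norm_star, norm_star] at h2
    exact (mul_self_inj (norm_nonneg _) (norm_nonneg _)).1 h2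

theorem IsConstantNil3.constNorm [PreconnectedSpace M] (hc : φ.IsConstantNil3 τ S T lam) :
    φ.ConstNorm :=
  constNorm_of_nabla_eq (fun i x X => star_connTerm i x X) (isConstantNil3_iff.1 hc)

theorem Nontrivial.exists_unitNorm (hn : φ.Nontrivial) (hN : φ.ConstNorm) :
    ∃ c : ℝ, c ≠ 0 ∧ (φ.mulRight (c : ℍ[ℝ])).UnitNorm := by
  obtain ⟨c, hc⟩ := hN
  obtain ⟨i, x, hx, h0⟩ := hn
  have hc0 : c ≠ 0 := by
    rw [← hc i x hx]
    exact norm_ne_zero_iff.2 h0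
  have hcp : 0 ≤ c := by
    rw [← hc i x hx]
    exact norm_nonneg _
  refine ⟨c⁻¹, inv_ne_zero hc0, fun j y hy => ?_⟩
  rw [mulRight_v, norm_mul, hc j y hy, Quaternion.norm_coe, norm_inv, Real.norm_of_nonneg hcp,
    mul_inv_cancel₀ hc0]

theorem star_form (x : M) (X : TangentSpace (𝓡 2) x) : star (φ.form x X) = -φ.form x X := by
  rw [φ.form_eq (σ.mem_idx x), star_mul, star_mul, star_frameCoord, star_star]
  noncomm_ring

theorem star_normal (x : M) : star (φ.normal x) = -φ.normal x := by
  rw [φ.normal_eq (σ.mem_idx x), star_mul, star_mul, star_omega2, star_star]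
  noncomm_ring

theorem isSmoothForm_toR3 : IsSmoothForm (I := 𝓡 2) fun x => toR3 ∘L φ.form x :=
  fun _ _ hX => contMDiffAt_clm_comp toR3 (φ.contMDiffAt_form hX)

variable (hu : φ.UnitNorm)
include hu

theorem inner_form (x : M) (X Y : TangentSpace (𝓡 2) x) :
    (inner ℝ (φ.form x X) (φ.form x Y) : ℝ) = inner ℝ X Y := by
  have hx := σ.mem_idx x
  rw [φ.form_eq hx, φ.form_eq hx, inner_star_mul_mul (hu _ x hx), (σ.isFrame _).inner_frameCoord hx]

theorem inner_form_normal (x : M) (X : TangentSpace (𝓡 2) x) :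
    (inner ℝ (φ.form x X) (φ.normal x) : ℝ) = 0 := by
  have hx := σ.mem_idx x
  rw [φ.form_eq hx, φ.normal_eq hx, inner_star_mul_mul (hu _ x hx), Quaternion.inner_def]
  simp

theorem inner_normal (x : M) : (inner ℝ (φ.normal x) (φ.normal x) : ℝ) = 1 := by
  have hx := σ.mem_idx x
  rw [φ.normal_eq hx, inner_star_mul_mul (hu _ x hx), Quaternion.inner_def]
  simp

theorem conj_mul_conj {i : σ.ι} {x : M} (hx : x ∈ σ.U i) (a b : ℍ[ℝ]) :
    (star (φ.v i x) * a * φ.v i x) * (star (φ.v i x) * b * φ.v i x)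
      = star (φ.v i x) * (a * b) * φ.v i x := by
  have hv := self_mul_star_of_norm_eq_one (hu i x hx)
  calc _ = star (φ.v i x) * a * (φ.v i x * star (φ.v i x)) * b * φ.v i x := by noncomm_ring
    _ = _ := by rw [hv]; noncomm_ring

/-- X · JX = |X|² ω₂ before conjugation; this yields the orientation of the immersion. -/
theorem form_mul_form_J (x : M) (X : TangentSpace (𝓡 2) x) :
    φ.form x X * φ.form x (o.J x X) = (inner ℝ X X : ℝ) • φ.normal x := by
  have hx := σ.mem_idx x
  rw [φ.form_eq hx, φ.form_eq hx, φ.normal_eq hx, conj_mul_conj hu hx, ← smul_mul_assoc,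
    ← mul_smul_comm, SurfaceOrientation.J, (σ.isFrame _).frameCoord_rotation hx,
    (σ.isFrame _).inner_eq hx X X]
  congr 2
  ext <;> simp
  ring

theorem normal_mul_normal (x : M) : φ.normal x * φ.normal x = -1 := by
  have hx := σ.mem_idx x
  rw [φ.normal_eq hx, conj_mul_conj hu hx, omega2_mul_omega2, mul_neg, neg_mul, mul_one,
    star_mul_self_of_norm_eq_one (hu _ x hx)]

/-- Commutators are twice cross products in the basis (e₁, e₂, ν). This identity and `normal_comm`
express them through J. -/
theorem form_comm (x : M) (X Y : TangentSpace (𝓡 2) x) :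
    φ.form x Y * φ.form x X - φ.form x X * φ.form x Y
      = -(2 * inner ℝ (o.J x X) Y : ℝ) • φ.normal x := by
  have hx := σ.mem_idx x
  obtain ⟨h0, h1⟩ := (σ.isFrame _).inner_rotation hx X
  rw [φ.form_eq hx, φ.form_eq hx, φ.normal_eq hx, conj_mul_conj hu hx, conj_mul_conj hu hx,
    ← smul_mul_assoc, ← mul_smul_comm, ← sub_mul, ← mul_sub, SurfaceOrientation.J,
    (σ.isFrame _).inner_eq hx _ Y, h0, h1]
  congr 2
  ext <;> simp <;> ring

theorem normal_comm (x : M) (X : TangentSpace (𝓡 2) x) :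
    φ.normal x * φ.form x X - φ.form x X * φ.normal x = (2 : ℝ) • φ.form x (o.J x X) := by
  have hx := σ.mem_idx x
  rw [φ.form_eq hx, φ.form_eq hx, φ.normal_eq hx, conj_mul_conj hu hx, conj_mul_conj hu hx,
    ← smul_mul_assoc, ← mul_smul_comm, ← sub_mul, ← mul_sub, SurfaceOrientation.J,
    (σ.isFrame _).frameCoord_rotation hx]
  congr 2
  ext <;> simp <;> ring

theorem vert_mul_vert {x : M} (h1 : lam x ^ 2 + ‖T x‖ ^ 2 = 1) :
    φ.vert T lam x * φ.vert T lam x = -1 := by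
  have hx := σ.mem_idx x
  rw [← real_inner_self_eq_norm_sq, (σ.isFrame _).inner_eq hx (T x) (T x)] at h1
  have e : φ.vert T lam x = star (φ.v (σ.idx x) x) *
      (frameCoord (σ.frame (σ.idx x)) x (T x) + lam x • omega2) * φ.v (σ.idx x) x := by
    rw [vert, φ.form_eq hx, φ.normal_eq hx, mul_add, add_mul, mul_smul_comm, smul_mul_assoc]
  have e2 : (frameCoord (σ.frame (σ.idx x)) x (T x) + lam x • omega2) *
      (frameCoord (σ.frame (σ.idx x)) x (T x) + lam x • omega2) = -1 := by
    ext
    · simp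
      linear_combination -h1
    · simp; ring
    · simp; ring
    · simp; ring
  rw [e, conj_mul_conj hu hx, e2, mul_neg, neg_mul, mul_one,
    star_mul_self_of_norm_eq_one (hu _ x hx)]

theorem mdiffAt_form {x : M} {Y : Π x : M, TangentSpace (𝓡 2) x} (hY : IsSmoothAt Y x) :
    MDifferentiableAt (𝓡 2) 𝓘(ℝ, ℍ[ℝ]) (fun y => φ.form y (Y y)) x :=
  (φ.contMDiffAt_form hY).mdifferentiableAt (by simp)

theorem mdiffAt_normal (x : M) : MDifferentiableAt (𝓡 2) 𝓘(ℝ, ℍ[ℝ]) φ.normal x :=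
  φ.contMDiff_normal.mdifferentiable (by simp) x

/-- Daniel's equations say that the vertical field is left-invariant. -/
theorem IsConstantNil3.mvfderiv_vert (hc : φ.IsConstantNil3 τ S T lam)
    (hd : DanielEquations o τ S T lam) (hT : IsSmoothField T) (hl : ContMDiff (𝓡 2) 𝓘(ℝ, ℝ) ∞ lam)
    (x : M) : mvfderiv (𝓡 2) (φ.vert T lam) x = 0 := by
  have hl' := hl.mdifferentiable (by simp) x
  have hn := mdiffAt_normal hu x
  ext1 X
  have h1 := mvfderiv_add_apply (mdiffAt_form hu (hT x)) (mdiffAt_smul_fun hl' hn) X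
  rw [mvfderiv_smul_fun hl' hn, hc.mvfderiv_form hu (hT x), hc.mvfderiv_normal hu,
    (hd x X).1, (hd x X).2, map_smul, map_sub, map_smul] at h1
  refine h1.trans ?_
  have e1 := form_comm hu x X (T x)
  have e2 := normal_comm hu x X
  have e3 : φ.vert T lam x = φ.form x (T x) + lam x • φ.normal x := rfl
  set B := φ.form x X - (2 * inner ℝ X (T x) : ℝ) • φ.vert T lam x with hB
  -- B differs from the image of X by a multiple of the vertical field, which commutes with itself.
  -- Hence the commutator of the vertical field with B equals that with X, and it is τJX-type terms
  -- alone that Daniel's equations have to cancel.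
  have e4 : (φ.form x (T x) * B - B * φ.form x (T x)) + lam x • (φ.normal x * B - B * φ.normal x)
      = (φ.form x (T x) * φ.form x X - φ.form x X * φ.form x (T x))
        + lam x • (φ.normal x * φ.form x X - φ.form x X * φ.normal x) := by
    rw [hB, e3]
    simp only [mul_sub, sub_mul, mul_add, add_mul, mul_smul_comm, smul_mul_assoc]
    module
  rw [e1, e2] at e4
  have e5 := congrArg (fun q => (τ / 2) • q) e4
  beta_reduce at e5
  rw [inner_sub_left, inner_smul_left]
  have e6 : ∀ a b c d e f : ℍ[ℝ], a + b = c → d + (c + e) = f → d + (a + b + e) = f := by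
    rintro a b c d e f rfl h; exact h
  calc _ = lam x • (φ.form x (S x X) - τ • φ.form x (o.J x X))
        + (inner ℝ (S x X) (T x) : ℝ) • φ.normal x
        + (-(inner ℝ (S x X) (T x) - τ * inner ℝ (o.J x X) (T x) : ℝ) • φ.normal x
          - lam x • φ.form x (S x X))
        + (τ / 2) • ((φ.form x (T x) * B - B * φ.form x (T x))
          + lam x • (φ.normal x * B - B * φ.normal x)) := by
        simp only [conj_trivial]
        module
    _ = 0 := by
        rw [e5]
        module

/-- The vertical direction can be normalised by a rotation of `Nil₃(τ)` at the origin. -/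
theorem IsConstantNil3.exists_vert_eq_omega2 [PreconnectedSpace M] [Nonempty M]
    (hc : φ.IsConstantNil3 τ S T lam)
    (hd : DanielEquations o τ S T lam) (hT : IsSmoothField T) (hl : ContMDiff (𝓡 2) 𝓘(ℝ, ℝ) ∞ lam)
    (h1 : ∀ x, lam x ^ 2 + ‖T x‖ ^ 2 = 1) :
    ∃ ψ : SpinorField σ, ψ.UnitNorm ∧ ψ.IsConstantNil3 τ S T lam ∧
      ∀ x, ψ.vert T lam x = omega2 := by
  obtain ⟨x₀⟩ : Nonempty M := inferInstance
  have hconst := eq_of_mvfderiv_eq_zero (I := 𝓡 2) (h := φ.vert T lam)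
    (fun x => mdiffAt_add_fun (mdiffAt_form hu (hT x))
      (mdiffAt_smul_fun (hl.mdifferentiable (by simp) x) (mdiffAt_normal hu x)))
    (hc.mvfderiv_vert hu hd hT hl)
  obtain ⟨q, hq, hq2⟩ := exists_conj_eq_omega2 (vert_mul_vert hu (h1 x₀))
  exact ⟨φ.mulRight q, hu.mulRight hq, hc.mulRight q, fun x => by
    rw [mulRight_vert, hconst x x₀, hq2]⟩

theorem imK_form {x : M} (hv : φ.vert T lam x = omega2) (X : TangentSpace (𝓡 2) x) :
    (φ.form x X).imK = inner ℝ X (T x) := by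
  have h : (inner ℝ (φ.form x X) omega2 : ℝ) = (φ.form x X).imK := by
    rw [Quaternion.inner_def]; simp
  rw [← h, ← hv, vert, inner_add_right, inner_smul_right, inner_form hu, inner_form_normal hu,
    mul_zero, add_zero]

/-- When the vertical field is k, the number ⟨X,T⟩ is the third component of the image of X, and the
τ-term of the Gauss and Weingarten formulas is minus the connection of Nil₃(τ). The alignment is
only required for τ ≠ 0, so that ℝ³ is covered too. -/
theorem twisted_eq_quatConn (hv : τ ≠ 0 → ∀ x, φ.vert T lam x = omega2) (x : M)
    (X : TangentSpace (𝓡 2) x) (b : ℍ[ℝ]) :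
    (τ / 2) • (b * (φ.form x X - (2 * inner ℝ X (T x) : ℝ) • φ.vert T lam x)
      - (φ.form x X - (2 * inner ℝ X (T x) : ℝ) • φ.vert T lam x) * b)
      = -quatConn τ (φ.form x X) b := by
  by_cases h : τ = 0
  · simp [h, quatConn]
  · rw [quatConn_self_right, neg_neg, imK_form hu (hv h x), hv h x]

/-- A constant spinor field with aligned vertical direction comes from an immersion. -/
theorem IsConstantNil3.exists_isNilImmersion [SimplyConnectedSpace M]
    [LocallyPathConnectedSpace M] (hc : φ.IsConstantNil3 τ S T lam) (hS : IsSymmetricField S)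
    (hv : τ ≠ 0 → ∀ x, φ.vert T lam x = omega2) :
    ∃ f nu : M → R3, IsNilImmersion o τ S f nu ∧
      (τ ≠ 0 → ∀ x, nilDeriv τ f x (T x) + lam x • nu x = !₂[0, 0, 1]) := by
  have hform : ∀ (x : M) (Y : Π x : M, TangentSpace (𝓡 2) x), IsSmoothAt Y x →
      ∀ X : TangentSpace (𝓡 2) x, mvfderiv (𝓡 2) (fun y => (toR3 ∘L φ.form y) (Y y)) x X
        = toR3 (φ.form x (leviCivita Y x X)) + (inner ℝ (S x X) (Y x) : ℝ) • toR3 (φ.normal x)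
          - Nil3.conn τ (toR3 (φ.form x X)) (toR3 (φ.form x (Y x))) := by
    intro x Y hY X
    have h := mvfderiv_clm_comp (mdiffAt_form hu hY) toR3 X
    rw [hc.mvfderiv_form hu hY, twisted_eq_quatConn hu hv, map_add, map_add, map_neg, map_smul,
      toR3_quatConn, ← sub_eq_add_neg] at h
    exact h
  -- Antisymmetrising the Gauss formula: the normal part cancels because S is symmetric, the
  -- tangential part gives the bracket of fields because ∇ has no torsion, and the ambient
  -- connection gives the Lie algebra bracket.
  obtain ⟨f, hf, hfd⟩ := exists_nilDeriv_eq τ (isSmoothForm_toR3 (φ := φ)) (by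
    intro x X Y hX hY
    rw [hform x Y hY, hform x X hX, ← leviCivita_sub_eq_mlieBracket hX hY,
      ← Nil3.conn_torsion_free]
    simp only [ContinuousLinearMap.comp_apply, map_sub]
    rw [hS.2 x (X x) (Y x), real_inner_comm]
    abel)
  have hfd' : ∀ x X, nilDeriv τ f x X = toR3 (φ.form x X) := hfd
  have hre : ∀ x X, (φ.form x X).re = 0 := fun x X => re_eq_zero_of_star_eq_neg (star_form x X)
  have hren : ∀ x, (φ.normal x).re = 0 := fun x => re_eq_zero_of_star_eq_neg (star_normal x)
  refine ⟨f, fun x => toR3 (φ.normal x), ⟨hf, ?_, ?_, ?_, ?_, ?_, ?_⟩, ?_⟩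
  · exact fun x => contMDiffAt_clm_comp toR3 (φ.contMDiff_normal x)
  · intro x X Y
    rw [hfd', hfd', inner_toR3 (hre x X), inner_form hu]
  · intro x
    have h : ‖toR3 (φ.normal x)‖ ^ 2 = 1 := by
      rw [← real_inner_self_eq_norm_sq, inner_toR3 (hren x), inner_normal hu]
    nlinarith [norm_nonneg (toR3 (φ.normal x))]
  · intro x X
    rw [hfd', inner_toR3 (hre x X), inner_form_normal hu]
  · intro x X hX
    -- The determinant is -Re(|X|² N²) = |X|², with N the normal.
    rw [PositivelyOriented, hfd', hfd', det_toR3 (hre _ _) (hre _ _) (hren _),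
      form_mul_form_J hu, smul_mul_assoc, normal_mul_normal hu]
    have h2 : 0 < ‖X‖ ^ 2 := pow_pos (norm_pos_iff.2 hX) 2
    refine lt_of_lt_of_eq h2 ?_
    simp
  · intro x X
    rw [nilCov, mvfderiv_clm_comp (mdiffAt_normal hu x), hc.mvfderiv_normal hu,
      twisted_eq_quatConn hu hv, hfd', hfd', ← toR3_quatConn, map_add, map_neg, map_neg]
    abel
  · intro hτ x
    rw [hfd']
    have h := congrArg toR3 (hv hτ x)
    rw [vert, map_add, map_smul] at h
    rw [h]
    ext i; fin_cases i <;> simp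

end SpinorField

end ConstantSpinors

/-! ### Gauss formula and Daniel's equations for an immersion -/

section Immersions

open Topology

variable {M : Type*} [TopologicalSpace M] [ChartedSpace (EuclideanSpace ℝ (Fin 2)) M]
  [IsManifold (𝓡 2) ∞ M]

theorem exists_smoothAt_eq {x : M} (v : TangentSpace (𝓡 2) x) :
    ∃ X : Π y : M, TangentSpace (𝓡 2) y,
      ContMDiffAt (𝓡 2) (𝓡 2).tangent ∞ (fun y => (⟨y, X y⟩ : TangentBundle (𝓡 2) M)) x ∧
        X x = v :=
  ⟨_, contMDiffAt_coordField (mem_extChartAt_source x) _,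
    coordField_mfderiv (mem_extChartAt_source x) v⟩

/-- The bilinear map `(p, w) ↦ (0, 0, p₀ w₁ - p₁ w₀)`. -/
def areaForm : R3 →L[ℝ] R3 →L[ℝ] R3 :=
  LinearMap.toContinuousLinearMap
    { toFun := fun p => LinearMap.toContinuousLinearMap
        { toFun := fun w => !₂[0, 0, p 0 * w 1 - p 1 * w 0]
          map_add' := fun v w => by ext i; fin_cases i <;> simp; ring
          map_smul' := fun c w => by ext i; fin_cases i <;> simp; ring }
      map_add' := fun p q => by ext w i; fin_cases i <;> simp; ring
      map_smul' := fun c w => by ext w i; fin_cases i <;> simp; ring }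

theorem areaForm_apply (p w : R3) : areaForm p w = !₂[0, 0, p 0 * w 1 - p 1 * w 0] := rfl

theorem mc_eq (τ : ℝ) (p w : R3) : Nil3.mc τ p w = w - (τ • areaForm) p w := by
  ext i; fin_cases i <;> simp [Nil3.mc, areaForm_apply]

theorem areaForm_mc (τ : ℝ) (p q v w : R3) :
    areaForm (Nil3.mc τ p v) (Nil3.mc τ q w) = areaForm v w := by
  simp [areaForm_apply, Nil3.mc]

theorem bracket_eq (τ : ℝ) (a b : R3) :
    Nil3.bracket τ a b = (τ • areaForm) a b - (τ • areaForm) b a := by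
  ext i; fin_cases i <;> simp [Nil3.bracket, areaForm_apply]; ring

theorem conn_add_right (τ : ℝ) (a b c : R3) :
    Nil3.conn τ a (b + c) = Nil3.conn τ a b + Nil3.conn τ a c := by
  ext i; fin_cases i <;> simp [Nil3.conn] <;> ring

theorem conn_smul_right (τ : ℝ) (a : R3) (c : ℝ) (b : R3) :
    Nil3.conn τ a (c • b) = c • Nil3.conn τ a b := by
  ext i; fin_cases i <;> simp [Nil3.conn] <;> ring

/-- The form `f⁻¹ df`. -/
def nilForm (τ : ℝ) (f : M → R3) (x : M) : TangentSpace (𝓡 2) x →L[ℝ] R3 :=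
  mvfderiv (𝓡 2) f x - (τ • areaForm) (f x) ∘L mvfderiv (𝓡 2) f x

theorem nilForm_apply (τ : ℝ) (f : M → R3) (x : M) (X : TangentSpace (𝓡 2) x) :
    nilForm τ f x X = nilDeriv τ f x X := by
  rw [nilDeriv, mc_eq]; rfl

theorem contMDiffAt_nilForm {τ : ℝ} {f : M → R3} {x : M} (hf : ContMDiffAt (𝓡 2) (𝓡 3) ∞ f x)
    {X : Π x : M, TangentSpace (𝓡 2) x}
    (hX : ContMDiffAt (𝓡 2) (𝓡 2).tangent ∞ (fun y => (⟨y, X y⟩ : TangentBundle (𝓡 2) M)) x) :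
    ContMDiffAt (𝓡 2) (𝓡 3) ∞ (fun y => nilForm τ f y (X y)) x :=
  (hf.mvfderiv_apply hX).sub (contMDiffAt_bilinear (τ • areaForm) hf (hf.mvfderiv_apply hX))

/-- The Maurer-Cartan equation. -/
theorem mvfderiv_nilForm_sub {τ : ℝ} {f : M → R3} {x : M} (hf : ContMDiffAt (𝓡 2) (𝓡 3) ∞ f x)
    {X Y : Π x : M, TangentSpace (𝓡 2) x}
    (hX : ContMDiffAt (𝓡 2) (𝓡 2).tangent ∞ (fun y => (⟨y, X y⟩ : TangentBundle (𝓡 2) M)) x)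
    (hY : ContMDiffAt (𝓡 2) (𝓡 2).tangent ∞ (fun y => (⟨y, Y y⟩ : TangentBundle (𝓡 2) M)) x) :
    mvfderiv (𝓡 2) (fun y => nilForm τ f y (Y y)) x (X x)
        - mvfderiv (𝓡 2) (fun y => nilForm τ f y (X y)) x (Y x)
      = nilForm τ f x (mlieBracket (𝓡 2) X Y x)
        - Nil3.bracket τ (nilForm τ f x (X x)) (nilForm τ f x (Y x)) := by
  have hd : MDifferentiableAt (𝓡 2) 𝓘(ℝ, R3) f x := hf.mdifferentiableAt (by simp)
  -- After antisymmetrisation the second derivatives of f give the bracket of fields, and the term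
  -- bilinear in df gives the Lie algebra bracket.
  have key : ∀ Z : Π x : M, TangentSpace (𝓡 2) x,
      ContMDiffAt (𝓡 2) (𝓡 2).tangent ∞ (fun y => (⟨y, Z y⟩ : TangentBundle (𝓡 2) M)) x →
      ∀ v, mvfderiv (𝓡 2) (fun y => nilForm τ f y (Z y)) x v
        = mvfderiv (𝓡 2) (fun y => mvfderiv (𝓡 2) f y (Z y)) x v
          - ((τ • areaForm) (mvfderiv (𝓡 2) f x v) (mvfderiv (𝓡 2) f x (Z x))
            + (τ • areaForm) (f x) (mvfderiv (𝓡 2) (fun y => mvfderiv (𝓡 2) f y (Z y)) x v)) := by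
    intro Z hZ v
    have h1 : MDifferentiableAt (𝓡 2) 𝓘(ℝ, R3) (fun y => mvfderiv (𝓡 2) f y (Z y)) x :=
      (hf.mvfderiv_apply hZ).mdifferentiableAt (by simp)
    rw [← mvfderiv_bilinear (τ • areaForm) hd h1, ← mvfderiv_sub_apply h1
      (mdiffAt_bilinear _ hd h1)]
    rfl
  rw [key Y hY, key X hX, bracket_eq, nilForm_apply, nilForm_apply, nilForm_apply, nilDeriv,
    nilDeriv, nilDeriv]
  have e : ∀ v w, (τ • areaForm) (Nil3.mc τ (f x) v) (Nil3.mc τ (f x) w) = (τ • areaForm) v w :=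
    fun v w => congrArg (τ • ·) (areaForm_mc τ _ _ v w)
  rw [e, e, mc_eq, ← mvfderiv_mlieBracket hf hX hY, map_sub]
  abel

variable [RiemannianBundle (fun x : M => TangentSpace (𝓡 2) x)]
  [IsContMDiffRiemannianBundle (𝓡 2) ∞ (EuclideanSpace ℝ (Fin 2))
    (fun x : M => TangentSpace (𝓡 2) x)]
  {o : SurfaceOrientation M}

namespace IsNilImmersion

variable {τ : ℝ} {S : Π x : M, TangentSpace (𝓡 2) x →L[ℝ] TangentSpace (𝓡 2) x} {f nu : M → R3}

theorem inner_nilForm (hf : IsNilImmersion o τ S f nu) (x : M) (X Y : TangentSpace (𝓡 2) x) :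
    (inner ℝ (nilForm τ f x X) (nilForm τ f x Y) : ℝ) = inner ℝ X Y := by
  rw [nilForm_apply, nilForm_apply, hf.isometric]

theorem inner_nilForm_normal (hf : IsNilImmersion o τ S f nu) (x : M) (X : TangentSpace (𝓡 2) x) :
    (inner ℝ (nilForm τ f x X) (nu x) : ℝ) = 0 := by
  rw [nilForm_apply, hf.normal]

theorem inner_normal (hf : IsNilImmersion o τ S f nu) (x : M) :
    (inner ℝ (nu x) (nu x) : ℝ) = 1 := by
  rw [real_inner_self_eq_norm_sq, hf.unit, one_pow]

theorem smoothAt (hf : IsNilImmersion o τ S f nu) {x : M} {X : Π x : M, TangentSpace (𝓡 2) x}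
    (hX : IsSmoothAt X x) : ContMDiffAt (𝓡 2) (𝓡 3) ∞ (fun y => nilForm τ f y (X y)) x :=
  contMDiffAt_nilForm (hf.smooth_f x) hX

theorem mdiffAt (hf : IsNilImmersion o τ S f nu) {x : M} {X : Π x : M, TangentSpace (𝓡 2) x}
    (hX : IsSmoothAt X x) :
    MDifferentiableAt (𝓡 2) 𝓘(ℝ, R3) (fun y => nilForm τ f y (X y)) x :=
  (hf.smoothAt hX).mdifferentiableAt (by simp)

theorem mdiffAt_nu (hf : IsNilImmersion o τ S f nu) (x : M) :
    MDifferentiableAt (𝓡 2) 𝓘(ℝ, R3) nu x :=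
  (hf.smooth_nu x).mdifferentiableAt (by simp)

/-- The derivative of the ambient metric along the immersion. -/
theorem mvfderiv_inner_R3 {g h : M → R3} {x : M} (hg : MDifferentiableAt (𝓡 2) 𝓘(ℝ, R3) g x)
    (hh : MDifferentiableAt (𝓡 2) 𝓘(ℝ, R3) h x) (v : TangentSpace (𝓡 2) x) (a : R3) (τ : ℝ) :
    mvfderiv (𝓡 2) (fun y => (inner ℝ (g y) (h y) : ℝ)) x v
      = inner ℝ (mvfderiv (𝓡 2) g x v + Nil3.conn τ a (g x)) (h x)
        + inner ℝ (g x) (mvfderiv (𝓡 2) h x v + Nil3.conn τ a (h x)) := by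
  have h1 := mvfderiv_bilinear (innerSL ℝ) hg hh v
  refine h1.trans ?_
  rw [inner_add_left, inner_add_right]
  have h2 := Nil3.conn_metric τ a (g x) (h x)
  have e1 : (innerSL ℝ) (mvfderiv (𝓡 2) g x v) (h x) = inner ℝ (mvfderiv (𝓡 2) g x v) (h x) := rfl
  have e2 : (innerSL ℝ) (g x) (mvfderiv (𝓡 2) h x v) = inner ℝ (g x) (mvfderiv (𝓡 2) h x v) := rfl
  rw [e1, e2]
  linarith

/-- The tangential part of the ambient derivative is the Levi-Civita connection. -/
theorem inner_deriv_tangent (hf : IsNilImmersion o τ S f nu) {x : M}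
    {X Y Z : Π x : M, TangentSpace (𝓡 2) x} (hX : IsSmoothAt X x) (hY : IsSmoothAt Y x)
    (hZ : IsSmoothAt Z x) :
    (inner ℝ (mvfderiv (𝓡 2) (fun y => nilForm τ f y (Y y)) x (X x)
      + Nil3.conn τ (nilForm τ f x (X x)) (nilForm τ f x (Y x))) (nilForm τ f x (Z x)) : ℝ)
      = inner ℝ (leviCivita Y x (X x)) (Z x) := by
  let D : (Π x : M, TangentSpace (𝓡 2) x) → (Π x : M, TangentSpace (𝓡 2) x) → R3 := fun X Y =>
    mvfderiv (𝓡 2) (fun y => nilForm τ f y (Y y)) x (X x)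
      + Nil3.conn τ (nilForm τ f x (X x)) (nilForm τ f x (Y x))
  -- The uniqueness argument for the Levi-Civita connection: t is skew in the last two slots since
  -- both connections are metric, and symmetric in the first two since both are torsion-free.
  -- Alternating the two symmetries through six steps gives t = -t.
  let t : (Π x : M, TangentSpace (𝓡 2) x) → (Π x : M, TangentSpace (𝓡 2) x) →
      (Π x : M, TangentSpace (𝓡 2) x) → ℝ := fun X Y Z =>
    inner ℝ (D X Y) (nilForm τ f x (Z x)) - inner ℝ (leviCivita Y x (X x)) (Z x)
  have hskew : ∀ X Y Z, IsSmoothAt Y x → IsSmoothAt Z x → t X Y Z = -t X Z Y := by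
    intro X Y Z hY hZ
    have h1 := mvfderiv_inner_R3 (hf.mdiffAt hY) (hf.mdiffAt hZ) (X x) (nilForm τ f x (X x)) τ
    simp only [hf.inner_nilForm] at h1
    rw [leviCivita_metric_apply hY hZ] at h1
    have e1 := real_inner_comm (D X Z) (nilForm τ f x (Y x))
    have e2 := real_inner_comm (leviCivita Z x (X x)) (Y x)
    simp only [t]
    change _ = inner ℝ (D X Y) _ + inner ℝ _ (D X Z) at h1
    linarith
  have hsymm : ∀ X Y Z, IsSmoothAt X x → IsSmoothAt Y x → t X Y Z = t Y X Z := by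
    intro X Y Z hX hY
    have h1 := mvfderiv_nilForm_sub (τ := τ) (hf.smooth_f x) hX hY
    have h2 : D X Y - D Y X = nilForm τ f x (mlieBracket (𝓡 2) X Y x) := by
      have h3 := Nil3.conn_torsion_free τ (nilForm τ f x (X x)) (nilForm τ f x (Y x))
      rw [← h3] at h1
      calc D X Y - D Y X = _ := add_sub_add_comm _ _ _ _
        _ = _ := by rw [h1]; abel
    rw [← leviCivita_sub_eq_mlieBracket hX hY] at h2
    have h3 := congrArg (fun w => (inner ℝ w (nilForm τ f x (Z x)) : ℝ)) h2
    beta_reduce at h3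
    rw [hf.inner_nilForm, inner_sub_left, inner_sub_left] at h3
    simp only [t]
    linarith
  have h1 := hskew X Y Z hY hZ
  have h2 := hsymm X Z Y hX hZ
  have h3 := hskew Z X Y hX hY
  have h4 := hsymm Z Y X hZ hY
  have h5 := hskew Y Z X hZ hX
  have h6 := hsymm Y X Z hY hX
  have h7 : t X Y Z = 0 := by linarith
  exact sub_eq_zero.1 h7

/-- Differentiate ⟨df Y, ν⟩ = 0 with the metric ambient connection and insert the shape operator for
the derivative of ν. -/
theorem inner_deriv_normal (hf : IsNilImmersion o τ S f nu) {x : M}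
    {Y : Π x : M, TangentSpace (𝓡 2) x} (hY : IsSmoothAt Y x) (v : TangentSpace (𝓡 2) x) :
    (inner ℝ (mvfderiv (𝓡 2) (fun y => nilForm τ f y (Y y)) x v
      + Nil3.conn τ (nilForm τ f x v) (nilForm τ f x (Y x))) (nu x) : ℝ)
      = inner ℝ (S x v) (Y x) := by
  have h1 := mvfderiv_inner_R3 (hf.mdiffAt hY) (hf.mdiffAt_nu x) v (nilForm τ f x v) τ
  have h2 := hf.shape x v
  rw [nilCov, ← nilForm_apply, ← nilForm_apply] at h2
  simp only [hf.inner_nilForm_normal] at h1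
  rw [mvfderiv_const, h2, inner_neg_right, hf.inner_nilForm, real_inner_comm] at h1
  have h3 : (0 : ℝ) = _ := h1
  rw [real_inner_comm, real_inner_comm (Y x)]
  linarith

theorem eq_of_inner {a b c : R3} (hon : Orthonormal ℝ ![a, b, c]) {v w : R3}
    (h1 : (inner ℝ v a : ℝ) = inner ℝ w a) (h2 : (inner ℝ v b : ℝ) = inner ℝ w b)
    (h3 : (inner ℝ v c : ℝ) = inner ℝ w c) : v = w := by
  have hc : Fintype.card (Fin 3) = Module.finrank ℝ R3 := by simp
  let B := basisOfOrthonormalOfCardEqFinrank hon hc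
  refine InnerProductSpace.ext_inner_right_basis B fun i => ?_
  rw [show B i = ![a, b, c] i by simp [B]]
  fin_cases i
  exacts [h1, h2, h3]

theorem orthonormal (hf : IsNilImmersion o τ S f nu) {e : Fin 2 → Π x : M, TangentSpace (𝓡 2) x}
    {U : Set M} (he : IsOrientedFrameOn o.at_point e U) {x : M} (hx : x ∈ U) :
    Orthonormal ℝ ![nilForm τ f x (e 0 x), nilForm τ f x (e 1 x), nu x] := by
  rw [orthonormal_iff_ite]
  intro i j
  have h0 := hf.inner_nilForm x
  have h1 : ∀ X, (inner ℝ (nu x) (nilForm τ f x X) : ℝ) = 0 := fun X => by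
    rw [real_inner_comm, hf.inner_nilForm_normal]
  have h2 : ∀ i, ‖nilForm τ f x (e i x)‖ = 1 := fun i => by
    have h := h0 (e i x) (e i x)
    rw [he.inner_self hx, real_inner_self_eq_norm_sq] at h
    exact (pow_eq_one_iff_of_nonneg (norm_nonneg _) two_ne_zero).1 h
  fin_cases i <;> fin_cases j <;>
    simp [h0, h1, h2, hf.inner_nilForm_normal, he.inner_zero_one hx, he.inner_one_zero hx, hf.unit]

theorem ext (hf : IsNilImmersion o τ S f nu) (x : M) {v w : R3}
    (h1 : ∀ X, (inner ℝ v (nilForm τ f x X) : ℝ) = inner ℝ w (nilForm τ f x X))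
    (h2 : (inner ℝ v (nu x) : ℝ) = inner ℝ w (nu x)) : v = w := by
  obtain ⟨U, hU, hx, e, he⟩ := o.exists_frame x
  exact eq_of_inner (hf.orthonormal he hx) (h1 _) (h1 _) h2

/-- The Gauss formula. -/
theorem gauss (hf : IsNilImmersion o τ S f nu) {x : M}
    {Y : Π x : M, TangentSpace (𝓡 2) x} (hY : IsSmoothAt Y x) (v : TangentSpace (𝓡 2) x) :
    mvfderiv (𝓡 2) (fun y => nilForm τ f y (Y y)) x v
      + Nil3.conn τ (nilForm τ f x v) (nilForm τ f x (Y x))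
      = nilForm τ f x (leviCivita Y x v) + (inner ℝ (S x v) (Y x) : ℝ) • nu x := by
  obtain ⟨X, hX, rfl⟩ := exists_smoothAt_eq v
  refine hf.ext x (fun Z => ?_) ?_
  · obtain ⟨Z, hZ, rfl⟩ := exists_smoothAt_eq Z
    rw [hf.inner_deriv_tangent hX hY hZ, inner_add_left, inner_smul_left, hf.inner_nilForm,
      real_inner_comm (nilForm τ f x (Z x)) (nu x), hf.inner_nilForm_normal, mul_zero, add_zero]
  · rw [hf.inner_deriv_normal hY, inner_add_left, inner_smul_left, hf.inner_nilForm_normal,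
      hf.inner_normal, mul_one, zero_add]
    rfl

end IsNilImmersion

/-- Vectors of `ℝ³` as imaginary quaternions. -/
def ofR3 : R3 →L[ℝ] ℍ[ℝ] :=
  LinearMap.toContinuousLinearMap
    { toFun := fun w => ⟨0, w 0, w 1, w 2⟩
      map_add' := fun p q => by
        refine QuaternionAlgebra.ext ?_ ?_ ?_ ?_
        · exact (add_zero 0).symm
        all_goals rfl
      map_smul' := fun c w => by
        refine QuaternionAlgebra.ext ?_ ?_ ?_ ?_
        · exact (mul_zero c).symm
        all_goals rfl }

@[simp] theorem ofR3_re (w : R3) : (ofR3 w).re = 0 := rfl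

@[simp] theorem ofR3_imI (w : R3) : (ofR3 w).imI = w 0 := rfl

@[simp] theorem ofR3_imJ (w : R3) : (ofR3 w).imJ = w 1 := rfl

@[simp] theorem ofR3_imK (w : R3) : (ofR3 w).imK = w 2 := rfl

theorem ofR3_conn (τ : ℝ) (a b : R3) :
    ofR3 (Nil3.conn τ a b) = quatConn τ (ofR3 a) (ofR3 b) := by
  ext <;> simp [quatConn, Nil3.conn] <;> first | (right; ring) | ring

theorem ofR3_injective : Function.Injective ofR3 := fun v w h => by
  ext i
  fin_cases i
  · exact congrArg QuaternionAlgebra.imI h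
  · exact congrArg QuaternionAlgebra.imJ h
  · exact congrArg QuaternionAlgebra.imK h

theorem ofR3_vertical : ofR3 !₂[0, 0, 1] = omega2 := by
  ext <;> simp

theorem inner_R3 (a b : R3) : (inner ℝ a b : ℝ) = a 0 * b 0 + a 1 * b 1 + a 2 * b 2 := by
  simp only [PiLp.inner_apply, Fin.sum_univ_three]
  simp
  ring

theorem ofR3_mul_self {a : R3} (ha : ‖a‖ = 1) : ofR3 a * ofR3 a = -1 := by
  have h : (inner ℝ a a : ℝ) = 1 := by rw [real_inner_self_eq_norm_sq, ha, one_pow]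
  rw [inner_R3] at h
  ext <;> simp <;> linarith

/-- The quaternion product of the first two vectors of an oriented orthonormal basis is the third
one. -/
theorem ofR3_mul_ofR3 {a b c : R3} (hon : Orthonormal ℝ ![a, b, c])
    (hp : PositivelyOriented a b c) : ofR3 a * ofR3 b = ofR3 c := by
  have haa : (inner ℝ a a : ℝ) = 1 := by
    have : ‖a‖ = 1 := hon.1 0
    rw [real_inner_self_eq_norm_sq, this, one_pow]
  have hbb : (inner ℝ b b : ℝ) = 1 := by
    have : ‖b‖ = 1 := hon.1 1
    rw [real_inner_self_eq_norm_sq, this, one_pow]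
  have hcc : (inner ℝ c c : ℝ) = 1 := by
    have : ‖c‖ = 1 := hon.1 2
    rw [real_inner_self_eq_norm_sq, this, one_pow]
  have hab : (inner ℝ a b : ℝ) = 0 := hon.2 (i := 0) (j := 1) (by decide)
  have hca : (inner ℝ c a : ℝ) = 0 := hon.2 (i := 2) (j := 0) (by decide)
  have hcb : (inner ℝ c b : ℝ) = 0 := hon.2 (i := 2) (j := 1) (by decide)
  -- d is the cross product a × b. It is orthogonal to a and b, hence d = t c; orientation gives t >
  -- 0 and Lagrange's identity gives t² = 1.
  set d : R3 := toR3 (ofR3 a * ofR3 b) with hd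
  set t : ℝ := inner ℝ d c with ht
  have hda : (inner ℝ d a : ℝ) = 0 := by rw [inner_R3]; simp [hd]; ring
  have hdb : (inner ℝ d b : ℝ) = 0 := by rw [inner_R3]; simp [hd]; ring
  have htp : 0 < t := by
    rw [PositivelyOriented, Matrix.det_fin_three] at hp
    simp at hp
    rw [ht, inner_R3]
    simp [hd]
    linarith
  have hdc : d = t • c := by
    refine IsNilImmersion.eq_of_inner hon ?_ ?_ ?_
    · rw [hda, inner_smul_left, hca, mul_zero]
    · rw [hdb, inner_smul_left, hcb, mul_zero]
    · rw [inner_smul_left, hcc, mul_one]; rfl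
  have hdd : (inner ℝ d d : ℝ) = inner ℝ a a * inner ℝ b b - inner ℝ a b ^ 2 := by
    simp only [inner_R3]; simp [hd]; ring
  rw [haa, hbb, hab, hdc, inner_smul_left, inner_smul_right, hcc] at hdd
  have ht1 : t = 1 := by
    have : t * (t * 1) = 1 * 1 - 0 ^ 2 := hdd
    nlinarith
  rw [ht1, one_smul] at hdc
  rw [← hdc]
  rw [inner_R3] at hab
  ext <;> simp [hd]
  linarith

namespace IsNilImmersion

variable {τ : ℝ} {S : Π x : M, TangentSpace (𝓡 2) x →L[ℝ] TangentSpace (𝓡 2) x} {f nu : M → R3}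
  {e : Fin 2 → Π x : M, TangentSpace (𝓡 2) x} {U : Set M}

theorem frame_mul_frame (hf : IsNilImmersion o τ S f nu) (he : IsOrientedFrameOn o.at_point e U)
    {x : M} (hx : x ∈ U) :
    ofR3 (nilForm τ f x (e 0 x)) * ofR3 (nilForm τ f x (e 1 x)) = ofR3 (nu x) := by
  refine ofR3_mul_ofR3 (hf.orthonormal he hx) ?_
  have h := hf.oriented x (e 0 x) ((he.2 x hx).1.ne_zero 0)
  rwa [SurfaceOrientation.J, ← (he.2 x hx).2, ← nilForm_apply, ← nilForm_apply] at h

theorem frame_mul_self (hf : IsNilImmersion o τ S f nu) (he : IsOrientedFrameOn o.at_point e U)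
    {x : M} (hx : x ∈ U) (i : Fin 2) :
    ofR3 (nilForm τ f x (e i x)) * ofR3 (nilForm τ f x (e i x)) = -1 := by
  refine ofR3_mul_self ?_
  fin_cases i
  · exact (hf.orthonormal he hx).1 0
  · exact (hf.orthonormal he hx).1 1

/-- The multiplication table of i, j, k, valid for any imaginary r, s with square -1 whose product t
is imaginary. -/
theorem frame_mul_swap {r s t : ℍ[ℝ]} (hr : r * r = -1) (hs : s * s = -1) (ht : r * s = t)
    (hrs : star r = -r) (hss : star s = -s) (hts : star t = -t) :
    s * r = -t ∧ r * t = -s ∧ t * r = s ∧ t * s = -r ∧ s * t = r := by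
  have h1 : s * r = -t := by
    rw [← hts, ← ht, star_mul, hrs, hss, neg_mul_neg]
  refine ⟨h1, ?_, ?_, ?_, ?_⟩
  · rw [← ht, ← mul_assoc, hr, neg_one_mul]
  · rw [← neg_eq_iff_eq_neg.2 h1, neg_mul, mul_assoc, hr, mul_neg_one, neg_neg]
  · rw [← ht, mul_assoc, hs, mul_neg_one]
  · rw [← neg_eq_iff_eq_neg.2 h1, mul_neg, ← mul_assoc, hs, neg_one_mul, neg_neg]

theorem star_ofR3 (a : R3) : star (ofR3 a) = -ofR3 a := by
  ext <;> simp

/-- Cross products of tangent vectors along an immersion. -/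
theorem form_comm_vert (hf : IsNilImmersion o τ S f nu) (x : M) (X T : TangentSpace (𝓡 2) x)
    (l : ℝ) :
    ofR3 (nilForm τ f x X) * ofR3 (nilForm τ f x T + l • nu x)
        - ofR3 (nilForm τ f x T + l • nu x) * ofR3 (nilForm τ f x X)
      = (2 : ℝ) • ofR3 ((inner ℝ (o.J x X) T : ℝ) • nu x - l • nilForm τ f x (o.J x X)) := by
  obtain ⟨U, hU, hx, e, he⟩ := o.exists_frame x
  have hr := hf.frame_mul_self he hx 0
  have hs := hf.frame_mul_self he hx 1
  obtain ⟨h1, h2, h3, h4, h5⟩ := frame_mul_swap hr hs (hf.frame_mul_frame he hx) (star_ofR3 _)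
    (star_ofR3 _) (star_ofR3 _)
  have h0 := hf.frame_mul_frame he hx
  obtain ⟨j0, j1⟩ := he.inner_rotation hx X
  have hJ := he.inner_eq hx (o.J x X) T
  rw [SurfaceOrientation.J, j0, j1] at hJ
  have hJX : o.J x X = -(inner ℝ (e 1 x) X : ℝ) • e 0 x + (inner ℝ (e 0 x) X : ℝ) • e 1 x := by
    rw [he.expansion hx (o.J x X), SurfaceOrientation.J, j0, j1]
  rw [SurfaceOrientation.J, hJ]
  rw [← SurfaceOrientation.J, hJX]
  conv_lhs => rw [he.expansion hx X, he.expansion hx T]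
  generalize (inner ℝ (e 0 x) X : ℝ) = x0
  generalize (inner ℝ (e 1 x) X : ℝ) = x1
  generalize (inner ℝ (e 0 x) T : ℝ) = t0
  generalize (inner ℝ (e 1 x) T : ℝ) = t1
  simp only [map_add, map_smul, map_sub, mul_add, add_mul, smul_mul_assoc, mul_smul_comm, hr, hs,
    h0, h1, h2, h3, h4, h5]
  module

/-- The compatibility equations of Daniel. -/
theorem danielEquations (hf : IsNilImmersion o τ S f nu)
    {T : Π x : M, TangentSpace (𝓡 2) x} {lam : M → ℝ} (hT : IsSmoothField T)
    (hl : ContMDiff (𝓡 2) 𝓘(ℝ, ℝ) ∞ lam)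
    (hv : ∀ x, nilDeriv τ f x (T x) + lam x • nu x = !₂[0, 0, 1]) :
    DanielEquations o τ S T lam := by
  intro x X
  have hlm : MDifferentiableAt (𝓡 2) 𝓘(ℝ, ℝ) lam x := hl.mdifferentiable (by simp) x
  have hv' : ∀ x, nilForm τ f x (T x) + lam x • nu x = !₂[0, 0, 1] := fun x => by
    rw [nilForm_apply, hv]
  have h1 : mvfderiv (𝓡 2) (fun y => nilForm τ f y (T y) + lam y • nu y) x X = 0 := by
    simp only [hv']
    rw [mvfderiv_const]
    rfl
  rw [mvfderiv_add_apply (hf.mdiffAt (hT x)) (mdiffAt_smul_fun hlm (hf.mdiffAt_nu x)),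
    mvfderiv_smul_fun hlm (hf.mdiffAt_nu x)] at h1
  have h2 := hf.gauss (hT x) X
  have h3 := hf.shape x X
  rw [nilCov, ← nilForm_apply, ← nilForm_apply] at h3
  -- E₃ has constant components, so its ambient derivative is just the connection term. Expanding T
  -- + λν by Gauss and Weingarten gives the left side; its tangential and normal parts will be
  -- Daniel's two equations.
  have h4 : nilForm τ f x (leviCivita T x X) + (inner ℝ (S x X) (T x) : ℝ) • nu x
      + mvfderiv (𝓡 2) lam x X • nu x - lam x • nilForm τ f x (S x X)
      = Nil3.conn τ (nilForm τ f x X) !₂[0, 0, 1] := by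
    rw [← hv' x, conn_add_right, conn_smul_right, ← h2]
    have h5 : mvfderiv (𝓡 2) nu x X
        = -nilForm τ f x (S x X) - Nil3.conn τ (nilForm τ f x X) (nu x) := by
      rw [← h3]; abel
    rw [h5] at h1
    rw [← sub_eq_zero, ← h1]; module
  -- ∇_X E₃ = τ X × E₃, because the correction by a multiple of k commutes with k; the cross product
  -- is then written through J.
  have h5 : Nil3.conn τ (nilForm τ f x X) !₂[0, 0, 1]
      = τ • ((inner ℝ (o.J x X) (T x) : ℝ) • nu x - lam x • nilForm τ f x (o.J x X)) := by
    apply ofR3_injective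
    have h6 := hf.form_comm_vert x X (T x) (lam x)
    rw [hv' x, ofR3_vertical] at h6
    have h7 : quatConn τ (ofR3 (nilForm τ f x X)) omega2
        = (τ / 2) • (ofR3 (nilForm τ f x X) * omega2 - omega2 * ofR3 (nilForm τ f x X)) := by
      rw [quatConn, sub_mul, mul_sub, smul_mul_assoc, mul_smul_comm, sub_sub_sub_cancel_right]
    rw [ofR3_conn, ofR3_vertical, h7, h6, map_smul, smul_smul]
    congr 1
    ring
  rw [h5] at h4
  constructor
  · refine ext_inner_right ℝ fun Z => ?_
    have h6 := congrArg (fun w => (inner ℝ w (nilForm τ f x Z) : ℝ)) h4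
    beta_reduce at h6
    simp only [inner_add_left, inner_sub_left, inner_smul_left, hf.inner_nilForm,
      real_inner_comm (nilForm τ f x Z) (nu x), hf.inner_nilForm_normal] at h6
    simp only [inner_sub_left, inner_smul_left]
    simp at h6 ⊢
    linarith
  · have h6 := congrArg (fun w => (inner ℝ w (nu x) : ℝ)) h4
    beta_reduce at h6
    simp only [inner_add_left, inner_sub_left, inner_smul_left,
      hf.inner_nilForm_normal, hf.inner_normal] at h6
    simp only [inner_sub_left, inner_smul_left]
    simp at h6 ⊢
    linarith

end IsNilImmersion

end Immersions

/-! ### From an immersion to a constant spinor: lifting the adapted frame -/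

section SpinLifts

open Topology

/-- A quaternion which intertwines the frame `(r, s, t)` of imaginary units with `(i, j, k)`. -/
def spinVec (r s t u : ℍ[ℝ]) : ℍ[ℝ] := u - r * u * unitI - s * u * unitJ - t * u * omega2

theorem unitI_mul_self : unitI * unitI = -1 := by ext <;> simp

theorem unitJ_mul_self : unitJ * unitJ = -1 := by ext <;> simp

theorem star_unitI : star unitI = -unitI := by ext <;> simp

theorem star_unitJ : star unitJ = -unitJ := by ext <;> simp

/-- `spinVec` averages u over the quaternion group acting by r, s, t on the left and by the inverses
of i, j, k on the right; multiplying by r or s permutes the summands. -/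
theorem mul_spinVec {r s t : ℍ[ℝ]} (hr : r * r = -1) (hs : s * s = -1) (ht : r * s = t)
    (hrs : star r = -r) (hss : star s = -s) (hts : star t = -t) (u : ℍ[ℝ]) :
    r * spinVec r s t u = spinVec r s t u * unitI ∧
      s * spinVec r s t u = spinVec r s t u * unitJ := by
  obtain ⟨h1, h2, h3, h4, h5⟩ := IsNilImmersion.frame_mul_swap hr hs ht hrs hss hts
  obtain ⟨k1, k2, k3, k4, k5⟩ := IsNilImmersion.frame_mul_swap unitI_mul_self unitJ_mul_self
    unitI_mul_unitJ star_unitI star_unitJ star_omega2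
  constructor
  · simp only [spinVec, mul_sub, sub_mul, ← mul_assoc, hr, ht, h2]
    simp only [mul_assoc, unitI_mul_self, k1, k3]
    noncomm_ring
  · simp only [spinVec, mul_sub, sub_mul, ← mul_assoc, hs, h1, h5]
    simp only [mul_assoc, unitJ_mul_self, unitI_mul_unitJ, k4]
    noncomm_ring

/-- Sum the averages of u = 1, i, j, k, each times the conjugate of u. The terms with r, s, t cancel
and the total is 4, whatever r, s, t are. -/
theorem exists_spinVec_ne_zero (r s t : ℍ[ℝ]) : ∃ u, spinVec r s t u ≠ 0 := by
  by_contra! h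
  have h1 : spinVec r s t 1 - spinVec r s t unitI * unitI - spinVec r s t unitJ * unitJ
      - spinVec r s t omega2 * omega2 = ((4 : ℝ) : ℍ[ℝ]) := by
    ext <;> simp [spinVec] <;> ring
  rw [h, h, h, h] at h1
  have h2 := congrArg QuaternionAlgebra.re h1
  norm_num at h2

theorem eq_coe_of_comm {p : ℍ[ℝ]} (h1 : p * unitI = unitI * p) (h2 : p * unitJ = unitJ * p) :
    p = (p.re : ℍ[ℝ]) := by
  have a := congrArg QuaternionAlgebra.imJ h1
  have b := congrArg QuaternionAlgebra.imK h1
  have c := congrArg QuaternionAlgebra.imK h2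
  simp at a b c
  ext <;> simp <;> linarith

variable {M : Type*} [TopologicalSpace M] [ChartedSpace (EuclideanSpace ℝ (Fin 2)) M]
  [IsManifold (𝓡 2) ∞ M]
  [RiemannianBundle (fun x : M => TangentSpace (𝓡 2) x)]
  [IsContMDiffRiemannianBundle (𝓡 2) ∞ (EuclideanSpace ℝ (Fin 2))
    (fun x : M => TangentSpace (𝓡 2) x)]
  {o : SurfaceOrientation M} {σ : SpinStructure o}

/-- `w` is a local lift of the tangential form `A` to the spin frame `i` over `V`. -/
structure IsSpinLift (σ : SpinStructure o) (A : Π x : M, TangentSpace (𝓡 2) x → ℍ[ℝ]) (i : σ.ι)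
    (V : Set M) (w : M → ℍ[ℝ]) : Prop where
  isOpen : IsOpen V
  subset : V ⊆ σ.U i
  smooth : ∀ y ∈ V, ContMDiffAt (𝓡 2) 𝓘(ℝ, ℍ[ℝ]) ∞ w y
  norm : ∀ y ∈ V, ‖w y‖ = 1
  conj : ∀ y ∈ V, ∀ X, star (w y) * frameCoord (σ.frame i) y X * w y = A y X

/-- Fix u for which the average built from (df e₁, df e₂, ν) is nonzero at x. It stays nonzero
nearby, depends smoothly on the point, and intertwines the adapted frame with (i, j, k); the
conjugate of its normalisation is the lift. -/
theorem IsNilImmersion.exists_spinLift {τ : ℝ}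
    {S : Π x : M, TangentSpace (𝓡 2) x →L[ℝ] TangentSpace (𝓡 2) x} {f nu : M → R3}
    (hf : IsNilImmersion o τ S f nu) {i : σ.ι} {x : M} (hx : x ∈ σ.U i) :
    ∃ V w, x ∈ V ∧ IsSpinLift σ (fun x X => ofR3 (nilForm τ f x X)) i V w := by
  set e := σ.frame i
  have he := σ.isFrame i
  let r : Fin 2 → M → ℍ[ℝ] := fun a y => ofR3 (nilForm τ f y (e a y))
  obtain ⟨u, hu⟩ := exists_spinVec_ne_zero (r 0 x) (r 1 x) (ofR3 (nu x))
  let q : M → ℍ[ℝ] := fun y => spinVec (r 0 y) (r 1 y) (ofR3 (nu y)) u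
  have hrs : ∀ a, ∀ y ∈ σ.U i, ContMDiffAt (𝓡 2) 𝓘(ℝ, ℍ[ℝ]) ∞ (r a) y := fun a y hy =>
    contMDiffAt_clm_comp ofR3 (hf.smoothAt (he.contMDiffAt (σ.isOpen_U i) hy a))
  have hq : ∀ y ∈ σ.U i, ContMDiffAt (𝓡 2) 𝓘(ℝ, ℍ[ℝ]) ∞ q y := by
    intro y hy
    have h : ∀ (g : M → ℍ[ℝ]) (c : ℍ[ℝ]), ContMDiffAt (𝓡 2) 𝓘(ℝ, ℍ[ℝ]) ∞ g y →
        ContMDiffAt (𝓡 2) 𝓘(ℝ, ℍ[ℝ]) ∞ (fun y => g y * u * c) y := fun g c hg =>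
      contMDiffAt_quat_mul (contMDiffAt_quat_mul hg contMDiffAt_const) contMDiffAt_const
    exact ((contMDiffAt_const.sub (h _ _ (hrs 0 y hy))).sub (h _ _ (hrs 1 y hy))).sub
      (h _ _ (contMDiffAt_clm_comp ofR3 (hf.smooth_nu y)))
  have hV : IsOpen (σ.U i ∩ q ⁻¹' {0}ᶜ) :=
    ContinuousOn.isOpen_inter_preimage
      (fun y hy => (hq y hy).continuousAt.continuousWithinAt) (σ.isOpen_U i)
      isOpen_compl_singleton
  refine ⟨σ.U i ∩ q ⁻¹' {0}ᶜ, fun y => ‖q y‖⁻¹ • star (q y), ⟨hx, hu⟩, hV,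
    Set.inter_subset_left, ?_, ?_, ?_⟩
  · rintro y ⟨hy, hy0⟩
    have h1 : ContMDiffAt (𝓡 2) 𝓘(ℝ, ℝ) ∞ (fun y => ‖q y‖⁻¹) y :=
      ContDiffAt.comp_contMDiffAt (f := q) (g := fun p : ℍ[ℝ] => ‖p‖⁻¹)
        ((contDiffAt_norm ℝ hy0).inv (norm_ne_zero_iff.2 hy0)) (hq y hy)
    exact contMDiffAt_smul_fun h1 (contMDiffAt_clm_comp quatStar (hq y hy))
  · rintro y ⟨hy, hy0⟩
    rw [norm_smul, norm_inv, norm_norm, norm_star, inv_mul_cancel₀ (norm_ne_zero_iff.2 hy0)]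
  · rintro y ⟨hy, hy0⟩ X
    have hn : ‖q y‖ ≠ 0 := norm_ne_zero_iff.2 hy0
    obtain ⟨h1, h2⟩ := mul_spinVec (hf.frame_mul_self he hy 0) (hf.frame_mul_self he hy 1)
      (hf.frame_mul_frame he hy) (IsNilImmersion.star_ofR3 _) (IsNilImmersion.star_ofR3 _)
      (IsNilImmersion.star_ofR3 _) u
    have hqq : q y * star (q y) = ((‖q y‖ * ‖q y‖ : ℝ) : ℍ[ℝ]) := by
      rw [Quaternion.self_mul_star, Quaternion.normSq_eq_norm_mul_self]
    change r 0 y * q y = q y * unitI at h1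
    change r 1 y * q y = q y * unitJ at h2
    have h3 : q y * frameCoord e y X * star (q y)
        = (‖q y‖ * ‖q y‖) • ofR3 (nilForm τ f y X) := by
      conv_rhs => rw [he.expansion hy X]
      rw [frameCoord_eq, mul_add, add_mul, mul_smul_comm, mul_smul_comm, ← h1, ← h2,
        smul_mul_assoc, smul_mul_assoc, mul_assoc, mul_assoc, hqq, Quaternion.mul_coe_eq_smul,
        Quaternion.mul_coe_eq_smul]
      simp only [map_add, map_smul]
      simp only [r]
      module
    rw [Quaternion.star_smul, star_star, smul_mul_assoc, smul_mul_assoc, mul_smul_comm, h3,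
      smul_smul, smul_smul]
    have : ‖q y‖⁻¹ * ‖q y‖⁻¹ * (‖q y‖ * ‖q y‖) = 1 := by field_simp
    rw [this, one_smul]

namespace IsSpinLift

variable {A : Π x : M, TangentSpace (𝓡 2) x → ℍ[ℝ]} {i j : σ.ι} {V W : Set M} {v w : M → ℍ[ℝ]}

/-- Two lifts at a point differ by a sign. -/
theorem exists_sign (hv : IsSpinLift σ A i V v) (hw : IsSpinLift σ A j W w) {x : M}
    (hxv : x ∈ V) (hxw : x ∈ W) :
    v x * star (σ.trans i j x * w x) = ((v x * star (σ.trans i j x * w x)).re : ℍ[ℝ]) ∧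
      (v x * star (σ.trans i j x * w x)).re ^ 2 = 1 ∧
      v x = (v x * star (σ.trans i j x * w x)).re • (σ.trans i j x * w x) := by
  have hij : x ∈ σ.U i ∩ σ.U j := ⟨hv.subset hxv, hw.subset hxw⟩
  have hg := σ.star_trans_mul hij
  have hg' : σ.trans i j x * star (σ.trans i j x) = 1 := mul_eq_one_comm.1 hg
  set g := σ.trans i j x
  have hb : star (g * w x) * (g * w x) = 1 := by
    rw [star_mul, mul_assoc, ← mul_assoc (star g), hg, one_mul,
      star_mul_self_of_norm_eq_one (hw.norm x hxw)]
  have ha := self_mul_star_of_norm_eq_one (hv.norm x hxv)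
  have ha' := star_mul_self_of_norm_eq_one (hv.norm x hxv)
  set p := v x * star (g * w x) with hp
  have hpb : v x = p * (g * w x) := by rw [hp, mul_assoc, hb, mul_one]
  have hpp : star p * p = 1 := by
    rw [hp, star_mul, star_star, mul_assoc, ← mul_assoc (star (v x)), ha', one_mul]
    exact mul_eq_one_comm.1 hb
  -- Both lifts conjugate the tangent plane in the same way, so their quotient p commutes with i and
  -- j. It is thus real, and having norm 1 it is a sign.
  have hcomm : ∀ X, p * frameCoord (σ.frame i) x X = frameCoord (σ.frame i) x X * p := by
    intro X
    have h1 := (hv.conj x hxv X).trans (hw.conj x hxw X).symm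
    have h2 := σ.lift i j x hij X
    have h3 : star (g * w x) * frameCoord (σ.frame i) x X * (g * w x)
        = star (w x) * frameCoord (σ.frame j) x X * w x := by
      rw [h2, star_mul]
      calc _ = star (w x) * ((star g * g) * frameCoord (σ.frame j) x X * (star g * g)) * w x := by
            noncomm_ring
        _ = _ := by rw [hg, one_mul, mul_one]
    rw [← h3] at h1
    calc p * frameCoord (σ.frame i) x X
        = v x * (star (g * w x) * frameCoord (σ.frame i) x X * (g * w x)) * star (g * w x) := by
          rw [hp, mul_assoc, mul_assoc (v x), mul_assoc (star (g * w x) * frameCoord (σ.frame i) x X),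
            mul_eq_one_comm.1 hb, mul_one]
      _ = frameCoord (σ.frame i) x X * p := by
          rw [← h1]
          calc _ = (v x * star (v x)) * frameCoord (σ.frame i) x X * (v x * star (g * w x)) := by
                noncomm_ring
            _ = _ := by rw [ha, one_mul]
  have h1 := hcomm (σ.frame i 0 x)
  have h2 := hcomm (σ.frame i 1 x)
  rw [(σ.isFrame i).frameCoord_zero hij.1] at h1
  rw [(σ.isFrame i).frameCoord_one hij.1] at h2
  have hre := eq_coe_of_comm h1 h2
  refine ⟨hre, ?_, ?_⟩
  · rw [hre] at hpp
    have h3 := congrArg QuaternionAlgebra.re hpp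
    simp at h3
    rw [sq]
    exact h3
  · conv_lhs => rw [hpb, hre, Quaternion.coe_mul_eq_smul]

/-- The sign between two lifts. -/
def sign (i j : σ.ι) (v w : M → ℍ[ℝ]) (x : M) : ℤˣ :=
  if 0 < (v x * star (σ.trans i j x * w x)).re then 1 else -1

theorem eq_sign_smul (hv : IsSpinLift σ A i V v) (hw : IsSpinLift σ A j W w) {x : M}
    (hxv : x ∈ V) (hxw : x ∈ W) :
    v x = (((sign i j v w x : ℤˣ) : ℤ) : ℝ) • (σ.trans i j x * w x) := by
  obtain ⟨-, h1, h2⟩ := hv.exists_sign hw hxv hxw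
  rw [sign]
  generalize (v x * star (σ.trans i j x * w x)).re = t at h1 h2
  rcases mul_self_eq_one_iff.1 ((sq _).symm.trans h1) with rfl | rfl
  · simpa using h2
  · simpa [show ¬ (0 : ℝ) < -1 by norm_num] using h2

/-- The quotient is continuous with values ±1, so its sign cannot jump. -/
theorem eventually_sign_eq (hv : IsSpinLift σ A i V v) (hw : IsSpinLift σ A j W w) {x : M}
    (hxv : x ∈ V) (hxw : x ∈ W) : ∀ᶠ y in 𝓝 x, sign i j v w y = sign i j v w x := by
  have hij : x ∈ σ.U i ∩ σ.U j := ⟨hv.subset hxv, hw.subset hxw⟩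
  obtain ⟨-, h1, -⟩ := hv.exists_sign hw hxv hxw
  have hc : ContinuousAt (fun y => (v y * star (σ.trans i j y * w y)).re) x := by
    have hg : ContinuousAt (σ.trans i j) x :=
      ((σ.smooth_trans i j).contMDiffAt
        (((σ.isOpen_U i).inter (σ.isOpen_U j)).mem_nhds hij)).continuousAt
    have h := (hv.smooth x hxv).continuousAt.mul (hg.mul (hw.smooth x hxw).continuousAt).star
    exact Quaternion.continuous_re.continuousAt.comp h
  simp only [sign]
  rcases lt_or_ge 0 (v x * star (σ.trans i j x * w x)).re with h | h
  · filter_upwards [hc.eventually (lt_mem_nhds h)] with y hy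
    rw [if_pos hy, if_pos h]
  · have h' : (v x * star (σ.trans i j x * w x)).re < 0 := lt_of_le_of_ne h fun h0 => by
      rw [h0] at h1; norm_num at h1
    filter_upwards [hc.eventually (gt_mem_nhds h')] with y hy
    rw [if_neg (not_lt.2 hy.le), if_neg (not_lt.2 h)]

theorem sign_mul_sign (hv : IsSpinLift σ A i V v) (hw : IsSpinLift σ A j W w) {l : σ.ι} {W' : Set M}
    {w' : M → ℍ[ℝ]} (hw' : IsSpinLift σ A l W' w') {x : M} (hxv : x ∈ V) (hxw : x ∈ W)
    (hxw' : x ∈ W') : sign i j v w x * sign j l w w' x = sign i l v w' x := by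
  have h1 := hv.eq_sign_smul hw hxv hxw
  have h2 := hw.eq_sign_smul hw' hxw hxw'
  have h3 := hv.eq_sign_smul hw' hxv hxw'
  rw [h2, mul_smul_comm, ← mul_assoc, σ.cocycle i j l x
    ⟨⟨hv.subset hxv, hw.subset hxw⟩, hw'.subset hxw'⟩, smul_smul] at h1
  have h0 : σ.trans i l x * w' x ≠ 0 := fun h => by
    rw [h, smul_zero] at h3
    have := hv.norm x hxv
    rw [h3, norm_zero] at this
    norm_num at this
  have h4 := smul_left_injective ℝ h0 (h1.symm.trans h3)
  beta_reduce at h4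
  apply Units.ext
  rw [Units.val_mul]
  exact_mod_cast h4

end IsSpinLift

theorem intUnits_sq (s : ℤˣ) : ((s : ℤ) : ℝ) * ((s : ℤ) : ℝ) = 1 := by
  rcases Int.units_eq_one_or s with rfl | rfl <;> norm_num

/-- On a simply connected surface, a form which lifts locally to the spin frames is the tangential
form of a spinor field. -/
theorem SpinorField.exists_form_eq [SimplyConnectedSpace M] [LocallyPathConnectedSpace M]
    {A : Π x : M, TangentSpace (𝓡 2) x → ℍ[ℝ]}
    (hA : ∀ x, ∃ V w, x ∈ V ∧ IsSpinLift σ A (σ.idx x) V w) :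
    ∃ φ : SpinorField σ, φ.UnitNorm ∧ ∀ x X, φ.form x X = A x X := by
  choose V w hxV hL using hA
  obtain ⟨s, hs, hsc⟩ := exists_coboundary_of_cocycle V (fun a => (hL a).isOpen)
    (fun x => ⟨x, hxV x⟩) (fun a b => IsSpinLift.sign (σ.idx a) (σ.idx b) (w a) (w b))
    (fun a b x hx => (hL a).eventually_sign_eq (hL b) hx.1 hx.2)
    (fun a b c x hx => (hL a).sign_mul_sign (hL b) (hL c) hx.1.1 hx.1.2 hx.2)
  -- After correction by the signs s, the value in spin frame i no longer depends on which local
  -- lift is used. This makes the field smooth, since its definition at x uses the lift chosen for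
  -- x.
  have key : ∀ i a x, x ∈ σ.U i → x ∈ V a →
      σ.trans i (σ.idx x) x * (((s x x : ℤˣ) : ℤ) : ℝ) • w x x
        = σ.trans i (σ.idx a) x * (((s a x : ℤˣ) : ℤ) : ℝ) • w a x := by
    intro i a x hi ha
    have h1 := (hL x).eq_sign_smul (hL a) (hxV x) ha
    have h2 := hsc x a x ⟨hxV x, ha⟩
    rw [h2, h1, smul_smul, mul_smul_comm, ← mul_assoc, σ.cocycle _ _ _ x
      ⟨⟨hi, σ.mem_idx x⟩, (hL a).subset ha⟩, mul_smul_comm]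
    congr 1
    have h3 := intUnits_sq (IsSpinLift.sign (σ.idx x) (σ.idx a) (w x) (w a) x)
    push_cast
    linear_combination ((s a x : ℤ) : ℝ) * h3
  let φ : SpinorField σ :=
    { v := fun i x => σ.trans i (σ.idx x) x * (((s x x : ℤˣ) : ℤ) : ℝ) • w x x
      smooth_v := by
        intro i x hx
        have hd : x ∈ σ.U i ∩ σ.U (σ.idx x) := ⟨hx, σ.mem_idx x⟩
        have h1 : (fun y => σ.trans i (σ.idx y) y * (((s y y : ℤˣ) : ℤ) : ℝ) • w y y) =ᶠ[𝓝 x]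
            fun y => σ.trans i (σ.idx x) y * (((s x x : ℤˣ) : ℤ) : ℝ) • w x y := by
          filter_upwards [(σ.isOpen_U i).mem_nhds hx, (hL x).isOpen.mem_nhds (hxV x),
            hs x x (hxV x)] with y hy hy' hsy
          rw [key i x y hy hy', hsy]
        refine ContMDiffAt.contMDiffWithinAt (ContMDiffAt.congr_of_eventuallyEq ?_ h1)
        exact contMDiffAt_quat_mul ((σ.smooth_trans i _).contMDiffAt
          (((σ.isOpen_U i).inter (σ.isOpen_U _)).mem_nhds hd))
          (contMDiffAt_clm_comp (ContinuousLinearMap.lsmul ℝ ℝ (((s x x : ℤˣ) : ℤ) : ℝ))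
            ((hL x).smooth x (hxV x)))
      compat := by
        intro i j x hx
        rw [← mul_assoc, σ.cocycle i j _ x ⟨hx, σ.mem_idx x⟩] }
  have hid : ∀ x, star (σ.trans (σ.idx x) (σ.idx x) x) * σ.trans (σ.idx x) (σ.idx x) x = 1 :=
    fun x => σ.star_trans_mul ⟨σ.mem_idx x, σ.mem_idx x⟩
  -- A transition from a spin frame to itself is idempotent by the cocycle condition and invertible,
  -- hence 1.
  have hone : ∀ x, σ.trans (σ.idx x) (σ.idx x) x = 1 := by
    intro x
    have h := σ.cocycle (σ.idx x) (σ.idx x) (σ.idx x) x ⟨⟨σ.mem_idx x, σ.mem_idx x⟩, σ.mem_idx x⟩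
    calc _ = star (σ.trans (σ.idx x) (σ.idx x) x)
          * (σ.trans (σ.idx x) (σ.idx x) x * σ.trans (σ.idx x) (σ.idx x) x) := by
          rw [← mul_assoc, hid, one_mul]
      _ = 1 := by rw [h, hid]
  have hv : ∀ x, φ.v (σ.idx x) x = (((s x x : ℤˣ) : ℤ) : ℝ) • w x x := by
    intro x
    change σ.trans (σ.idx x) (σ.idx x) x * _ = _
    rw [hone, one_mul]
  refine ⟨φ, ?_, ?_⟩
  · intro i x hx
    have h1 : star (φ.v i x) * φ.v i x = 1 := by
      rw [norm_v_eq hx (σ.mem_idx x), hv, Quaternion.star_smul, smul_mul_assoc, mul_smul_comm,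
        smul_smul, intUnits_sq, one_smul, star_mul_self_of_norm_eq_one ((hL x).norm x (hxV x))]
    have h2 := congrArg norm h1
    rw [norm_mul, norm_star, norm_one] at h2
    nlinarith [norm_nonneg (φ.v i x)]
  · intro x X
    rw [φ.form_eq (σ.mem_idx x), hv, Quaternion.star_smul, smul_mul_assoc, smul_mul_assoc,
      mul_smul_comm, smul_smul, intUnits_sq, one_smul, (hL x).conj x (hxV x)]

/-- An isometric immersion of a simply connected surface is described by a unit spinor field. -/
theorem IsNilImmersion.exists_spinorField [SimplyConnectedSpace M] [LocallyPathConnectedSpace M]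
    (σ : SpinStructure o) {τ : ℝ}
    {S : Π x : M, TangentSpace (𝓡 2) x →L[ℝ] TangentSpace (𝓡 2) x} {f nu : M → R3}
    (hf : IsNilImmersion o τ S f nu) :
    ∃ φ : SpinorField σ, φ.UnitNorm ∧ (∀ x X, φ.form x X = ofR3 (nilForm τ f x X)) ∧
      ∀ x, φ.normal x = ofR3 (nu x) := by
  obtain ⟨φ, hu, hφ⟩ := SpinorField.exists_form_eq (σ := σ)
    (A := fun x X => ofR3 (nilForm τ f x X)) fun x => hf.exists_spinLift (σ.mem_idx x)
  refine ⟨φ, hu, hφ, fun x => ?_⟩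
  have hx := σ.mem_idx x
  have he := σ.isFrame (σ.idx x)
  rw [← hf.frame_mul_frame he hx, ← hφ, ← hφ, φ.form_eq hx, φ.form_eq hx,
    SpinorField.conj_mul_conj hu hx, he.frameCoord_zero hx, he.frameCoord_one hx,
    unitI_mul_unitJ, φ.normal_eq hx]

/-- A unit spinor field which satisfies the Gauss formula is constant. -/
theorem SpinorField.isConstantNil3_of_gauss {φ : SpinorField σ} (hu : φ.UnitNorm) {τ : ℝ}
    {S : Π x : M, TangentSpace (𝓡 2) x →L[ℝ] TangentSpace (𝓡 2) x}
    {T : Π x : M, TangentSpace (𝓡 2) x} {lam : M → ℝ}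
    (h : ∀ (x : M) (Y : Π x : M, TangentSpace (𝓡 2) x), IsSmoothAt Y x →
      ∀ X : TangentSpace (𝓡 2) x, mvfderiv (𝓡 2) (fun y => φ.form y (Y y)) x X
      = φ.form x (leviCivita Y x X) + (inner ℝ (S x X) (Y x) : ℝ) • φ.normal x
        + (τ / 2) • (φ.form x (Y x) * (φ.form x X - (2 * inner ℝ X (T x) : ℝ) • φ.vert T lam x)
          - (φ.form x X - (2 * inner ℝ X (T x) : ℝ) • φ.vert T lam x) * φ.form x (Y x))) :
    φ.IsConstantNil3 τ S T lam := by
  rw [isConstantNil3_iff]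
  intro i x hx X
  have he := σ.isFrame i
  have hv := self_mul_star_of_norm_eq_one (hu i x hx)
  have hv' := star_mul_self_of_norm_eq_one (hu i x hx)
  set v := φ.v i x with hvdef
  set C := connTerm τ S T lam i x X with hC
  -- P is the actual potential minus the expected one. It is imaginary since |φ| = 1, and the Gauss
  -- formula makes it commute with i and j; so it is also real, hence 0.
  set P := φ.nabla i x X * star v - C with hP
  have hN : φ.nabla i x X = (P + C) * v := by
    rw [hP, sub_add_cancel, mul_assoc, hv', mul_one]
  have hPs : star P = -P := by
    have h1 : mvfderiv (𝓡 2) (fun y => star (φ.v i y) * φ.v i y) x X = 0 := by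
      have h2 : (fun y => star (φ.v i y) * φ.v i y) =ᶠ[𝓝 x] fun _ => (1 : ℍ[ℝ]) := by
        filter_upwards [(σ.isOpen_U i).mem_nhds hx] with y hy
        exact star_mul_self_of_norm_eq_one (hu i y hy)
      rw [h2.mvfderiv_eq, mvfderiv_const]
      rfl
    rw [mvfderiv_star_mul_self hx, hN, ← hvdef, star_mul] at h1
    have h2 : star (P + C) = -(P + C) := by
      have h3 := congrArg (fun q => v * q * star v) h1
      beta_reduce at h3
      have h4 : v * (star v * star (P + C) * v + star v * ((P + C) * v)) * star v
          = (v * star v) * star (P + C) * (v * star v)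
            + (v * star v) * (P + C) * (v * star v) := by noncomm_ring
      rw [h4, hv, mul_zero, zero_mul] at h3
      simp only [one_mul, mul_one] at h3
      exact eq_neg_of_add_eq_zero_left h3
    rw [star_add, star_connTerm] at h2
    calc star P = star P + -C + C := by abel
      _ = -P := by rw [h2]; abel
  have hcomm : ∀ a, P * frameCoord (σ.frame i) x (σ.frame i a x)
      = frameCoord (σ.frame i) x (σ.frame i a x) * P := by
    intro a
    have hY := he.contMDiffAt (σ.isOpen_U i) hx a
    have h1 := h x (σ.frame i a) hY X
    rw [(φ.form_eventuallyEq hx (σ.frame i a)).mvfderiv_eq,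
      he.mvfderiv_conj_frameCoord (σ.isOpen_U i) hx (φ.mdiffAt_v hx) hY X,
      ← nabla_eq_spinDeriv, hN, ← conj_twisted hx,
      φ.form_eq hx, φ.form_eq hx, φ.normal_eq hx, ← conj_comm hv, star_mul, star_add, hPs,
      star_connTerm] at h1
    have h2 := frameCoord_comm_connTerm (τ := τ) (S := S) (T := T) (lam := lam) hx X (σ.frame i a x)
    have h3 := congrArg (fun q => star v * q * v) h2
    beta_reduce at h3
    rw [mul_add, add_mul, mul_smul_comm, smul_mul_assoc, mul_smul_comm, smul_mul_assoc] at h3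
    rw [add_assoc, ← h3, add_right_inj, ← hvdef] at h1
    set F := frameCoord (σ.frame i) x (σ.frame i a x)
    have h4 : star v * (F * P - P * F) * v = 0 := by
      rw [← sub_eq_zero] at h1
      rw [← h1]
      noncomm_ring
    have h5 := congrArg (fun q => v * q * star v) h4
    beta_reduce at h5
    have h6 : v * (star v * (F * P - P * F) * v) * star v
        = (v * star v) * (F * P - P * F) * (v * star v) := by noncomm_ring
    rw [h6, hv, one_mul, mul_one, mul_zero, zero_mul] at h5
    exact (sub_eq_zero.1 h5).symm
  have h0 := hcomm 0
  have h1 := hcomm 1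
  rw [he.frameCoord_zero hx] at h0
  rw [he.frameCoord_one hx] at h1
  have hP0 : P = 0 := by
    rw [eq_coe_of_comm h0 h1, re_eq_zero_of_star_eq_neg hPs, Quaternion.coe_zero]
  rw [hN, hP0, zero_add]

/-- An isometric immersion of a simply connected surface yields a constant spinor field. -/
theorem IsNilImmersion.exists_isConstantNil3 [SimplyConnectedSpace M] [LocallyPathConnectedSpace M]
    (σ : SpinStructure o) {τ : ℝ}
    {S : Π x : M, TangentSpace (𝓡 2) x →L[ℝ] TangentSpace (𝓡 2) x} {f nu : M → R3}
    {T : Π x : M, TangentSpace (𝓡 2) x} {lam : M → ℝ}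
    (hf : IsNilImmersion o τ S f nu)
    (hv : τ ≠ 0 → ∀ x, nilDeriv τ f x (T x) + lam x • nu x = !₂[0, 0, 1]) :
    ∃ φ : SpinorField σ, φ.Nontrivial ∧ φ.IsConstantNil3 τ S T lam := by
  obtain ⟨φ, hu, hφ, hn⟩ := hf.exists_spinorField σ
  have hvert : τ ≠ 0 → ∀ x, φ.vert T lam x = omega2 := by
    intro hτ x
    rw [SpinorField.vert, hφ, hn, ← map_smul, ← map_add, nilForm_apply, hv hτ, ofR3_vertical]
  refine ⟨φ, ?_, ?_⟩
  · obtain ⟨x⟩ : Nonempty M := inferInstance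
    refine ⟨σ.idx x, x, σ.mem_idx x, fun h => ?_⟩
    have := hu _ x (σ.mem_idx x)
    rw [h, norm_zero] at this
    norm_num at this
  · refine SpinorField.isConstantNil3_of_gauss hu fun x Y hY X => ?_
    have h1 := congrArg ofR3 (hf.gauss hY X)
    rw [map_add, map_add, map_smul, ← mvfderiv_clm_comp (hf.mdiffAt hY), ofR3_conn, ← hφ, ← hφ,
      ← hφ, ← hn] at h1
    simp only [← hφ] at h1
    rw [SpinorField.twisted_eq_quatConn hu hvert, ← h1]
    abel

end SpinLifts

/-! ### The Dirac equation and the energy-momentum tensor of a constant spinor -/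

section DiracSpinors

open Topology

variable {M : Type*} [TopologicalSpace M] [ChartedSpace (EuclideanSpace ℝ (Fin 2)) M]
  [IsManifold (𝓡 2) ∞ M]
  [RiemannianBundle (fun x : M => TangentSpace (𝓡 2) x)]
  [IsContMDiffRiemannianBundle (𝓡 2) ∞ (EuclideanSpace ℝ (Fin 2))
    (fun x : M => TangentSpace (𝓡 2) x)]
  {o : SurfaceOrientation M} {σ : SpinStructure o}

theorem IsOrientedFrameOn.meanCurvature_eq {o : ∀ x : M, Orientation ℝ (TangentSpace (𝓡 2) x) (Fin 2)}
    {e : Fin 2 → Π x : M, TangentSpace (𝓡 2) x} {U : Set M} (he : IsOrientedFrameOn o e U) {x : M}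
    (hx : x ∈ U) (S : Π x : M, TangentSpace (𝓡 2) x →L[ℝ] TangentSpace (𝓡 2) x) :
    2 * meanCurvature S x
      = inner ℝ (e 0 x) (S x (e 0 x)) + inner ℝ (e 1 x) (S x (e 1 x)) := by
  have hc : Fintype.card (Fin 2) = Module.finrank ℝ (TangentSpace (𝓡 2) x) := by
    rw [(fact_finrank_tangentSpace x).out]; rfl
  let b := basisOfOrthonormalOfCardEqFinrank (he.2 x hx).1 hc
  have hb : Orthonormal ℝ b := by
    rw [coe_basisOfOrthonormalOfCardEqFinrank]; exact (he.2 x hx).1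
  have h := LinearMap.trace_eq_sum_inner (S x).toLinearMap (b.toOrthonormalBasis hb)
  rw [Fin.sum_univ_two] at h
  simp only [Module.Basis.coe_toOrthonormalBasis, b, coe_basisOfOrthonormalOfCardEqFinrank] at h
  rw [meanCurvature, h]
  simp only [ContinuousLinearMap.coe_coe]
  ring

namespace SpinorField

variable {φ : SpinorField σ} {τ : ℝ}
  {S : Π x : M, TangentSpace (𝓡 2) x →L[ℝ] TangentSpace (𝓡 2) x}
  {T : Π x : M, TangentSpace (𝓡 2) x} {lam : M → ℝ} {i : σ.ι} {x : M}

/-- The quaternion `A` with `∇_X φ = A φ`. -/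
def coef (φ : SpinorField σ) (i : σ.ι) (x : M) (X : TangentSpace (𝓡 2) x) : ℍ[ℝ] :=
  (‖φ.v i x‖ ^ 2)⁻¹ • (φ.nabla i x X * star (φ.v i x))

theorem star_mul_self_eq_smul (v : ℍ[ℝ]) : star v * v = (‖v‖ ^ 2) • (1 : ℍ[ℝ]) := by
  rw [Quaternion.star_mul_self, Quaternion.normSq_eq_norm_mul_self, sq,
    ← Quaternion.coe_mul_eq_smul, mul_one]

theorem self_mul_star_eq_smul (v : ℍ[ℝ]) : v * star v = (‖v‖ ^ 2) • (1 : ℍ[ℝ]) := by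
  rw [Quaternion.self_mul_star, Quaternion.normSq_eq_norm_mul_self, sq,
    ← Quaternion.coe_mul_eq_smul, mul_one]

theorem coef_mul (h : φ.v i x ≠ 0) (X : TangentSpace (𝓡 2) x) :
    φ.nabla i x X = φ.coef i x X * φ.v i x := by
  have h' : ‖φ.v i x‖ ^ 2 ≠ 0 := pow_ne_zero 2 (norm_ne_zero_iff.2 h)
  rw [coef, smul_mul_assoc, mul_assoc, star_mul_self_eq_smul, mul_smul_comm, mul_one,
    inv_smul_smul₀ h']

theorem eq_coef (h : φ.v i x ≠ 0) {X : TangentSpace (𝓡 2) x} {A : ℍ[ℝ]}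
    (hA : φ.nabla i x X = A * φ.v i x) : φ.coef i x X = A :=
  mul_right_cancel₀ h ((coef_mul h X).symm.trans hA)

theorem nabla_add (X Y : TangentSpace (𝓡 2) x) :
    φ.nabla i x (X + Y) = φ.nabla i x X + φ.nabla i x Y := by
  simp only [nabla, map_add, inner_add_left]
  module

theorem nabla_smul (c : ℝ) (X : TangentSpace (𝓡 2) x) :
    φ.nabla i x (c • X) = c • φ.nabla i x X := by
  simp only [nabla, map_smul, inner_smul_left]
  simp only [RCLike.conj_to_real]
  module

theorem nabla_expansion (hx : x ∈ σ.U i) (X : TangentSpace (𝓡 2) x) :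
    φ.nabla i x X = (inner ℝ (σ.frame i 0 x) X : ℝ) • φ.nabla i x (σ.frame i 0 x)
      + (inner ℝ (σ.frame i 1 x) X : ℝ) • φ.nabla i x (σ.frame i 1 x) := by
  conv_lhs => rw [(σ.isFrame i).expansion hx X, nabla_add, nabla_smul, nabla_smul]

theorem coef_expansion (hx : x ∈ σ.U i) (X : TangentSpace (𝓡 2) x) :
    φ.coef i x X = (inner ℝ (σ.frame i 0 x) X : ℝ) • φ.coef i x (σ.frame i 0 x)
      + (inner ℝ (σ.frame i 1 x) X : ℝ) • φ.coef i x (σ.frame i 1 x) := by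
  rw [coef, nabla_expansion hx, coef, coef, add_mul, smul_mul_assoc, smul_mul_assoc, smul_add,
    smul_comm, smul_comm _ (inner ℝ (σ.frame i 1 x) X : ℝ)]

theorem ConstNorm.v_ne_zero (hN : φ.ConstNorm) (hn : φ.Nontrivial) (hx : x ∈ σ.U i) :
    φ.v i x ≠ 0 := by
  obtain ⟨c, hc⟩ := hN
  obtain ⟨j, y, hy, h0⟩ := hn
  rw [← norm_ne_zero_iff, hc i x hx, ← hc j y hy]
  exact norm_ne_zero_iff.2 h0

/-- Differentiating the constant |φ|² gives v*(A* + A)v = 0. Where φ vanishes, `coef` is 0 by the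
convention for inverses. -/
theorem ConstNorm.star_coef (hN : φ.ConstNorm) (hx : x ∈ σ.U i) (X : TangentSpace (𝓡 2) x) :
    star (φ.coef i x X) = -φ.coef i x X := by
  obtain ⟨c, hc⟩ := hN
  by_cases h0 : φ.v i x = 0
  · rw [coef, h0]; simp
  have h1 : mvfderiv (𝓡 2) (fun y => star (φ.v i y) * φ.v i y) x X = 0 := by
    have h2 : (fun y => star (φ.v i y) * φ.v i y) =ᶠ[𝓝 x] fun _ => (c ^ 2) • (1 : ℍ[ℝ]) := by
      filter_upwards [(σ.isOpen_U i).mem_nhds hx] with y hy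
      rw [star_mul_self_eq_smul, hc i y hy]
    rw [h2.mvfderiv_eq, mvfderiv_const]
    rfl
  rw [mvfderiv_star_mul_self hx, coef_mul h0, star_mul] at h1
  set A := φ.coef i x X
  have h3 := congrArg (fun q => φ.v i x * q * star (φ.v i x)) h1
  beta_reduce at h3
  have h4 : φ.v i x * (star (φ.v i x) * star A * φ.v i x + star (φ.v i x) * (A * φ.v i x))
      * star (φ.v i x) = (φ.v i x * star (φ.v i x)) * (star A + A) * (φ.v i x * star (φ.v i x)) := by
    noncomm_ring
  rw [h4, mul_zero, zero_mul, self_mul_star_eq_smul, smul_one_mul, mul_smul_one] at h3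
  have h' : ‖φ.v i x‖ ^ 2 ≠ 0 := pow_ne_zero 2 (norm_ne_zero_iff.2 h0)
  exact eq_neg_of_add_eq_zero_left ((smul_eq_zero_iff_right h').1 ((smul_eq_zero_iff_right h').1 h3))

theorem ConstNorm.coef_re (hN : φ.ConstNorm) (hx : x ∈ σ.U i) (X : TangentSpace (𝓡 2) x) :
    (φ.coef i x X).re = 0 :=
  re_eq_zero_of_star_eq_neg (hN.star_coef hx X)

theorem energyMomentum_eq (h : φ.v i x ≠ 0) (X Y : TangentSpace (𝓡 2) x) :
    φ.energyMomentum i x X Y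
      = 1 / 2 * (frameCoord (σ.frame i) x X * (omega2 * φ.coef i x Y)
        + frameCoord (σ.frame i) x Y * (omega2 * φ.coef i x X)).re := by
  have h' : ‖φ.v i x‖ ^ 2 ≠ 0 := pow_ne_zero 2 (norm_ne_zero_iff.2 h)
  have key : ∀ p : ℍ[ℝ], (inner ℝ (p * φ.v i x) ((1 / ‖φ.v i x‖ ^ 2 : ℝ) • φ.v i x) : ℝ) = p.re := by
    intro p
    rw [inner_smul_right, Quaternion.inner_def, mul_assoc, self_mul_star_eq_smul, mul_smul_comm,
      mul_one, Quaternion.re_smul, smul_eq_mul]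
    field_simp
  rw [energyMomentum, cl, cl, coef_mul h, coef_mul h, ← key]
  congr 2
  noncomm_ring

/-- The energy-momentum tensor in terms of the components of the connection. -/
theorem energyMomentum_eq_components (h : φ.v i x ≠ 0) (X Y : TangentSpace (𝓡 2) x) :
    2 * φ.energyMomentum i x X Y
      = inner ℝ (σ.frame i 0 x) X * (φ.coef i x Y).imJ
        - inner ℝ (σ.frame i 1 x) X * (φ.coef i x Y).imI
        + inner ℝ (σ.frame i 0 x) Y * (φ.coef i x X).imJ
        - inner ℝ (σ.frame i 1 x) Y * (φ.coef i x X).imI := by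
  rw [energyMomentum_eq h]
  simp
  ring

/-- The Dirac equation in terms of the components of the connection. -/
theorem dirac_eq_iff (hN : φ.ConstNorm) (h : φ.v i x ≠ 0) (hx : x ∈ σ.U i) (H : ℝ) :
    φ.dirac i x = H • (omega2 * φ.v i x)
        - (τ * lam x) • (lam x • φ.v i x + cl σ i x (T x) (omega2 * φ.v i x)) ↔
      (φ.coef i x (σ.frame i 0 x)).imI + (φ.coef i x (σ.frame i 1 x)).imJ = τ * lam x ^ 2 ∧
      (φ.coef i x (σ.frame i 0 x)).imJ - (φ.coef i x (σ.frame i 1 x)).imI = H ∧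
      (φ.coef i x (σ.frame i 0 x)).imK = -(τ * lam x * inner ℝ (σ.frame i 0 x) (T x)) ∧
      (φ.coef i x (σ.frame i 1 x)).imK = -(τ * lam x * inner ℝ (σ.frame i 1 x) (T x)) := by
  have he := σ.isFrame i
  have hr0 := hN.coef_re hx (σ.frame i 0 x)
  have hr1 := hN.coef_re hx (σ.frame i 1 x)
  have h1 : φ.dirac i x = (unitI * φ.coef i x (σ.frame i 0 x)
      + unitJ * φ.coef i x (σ.frame i 1 x)) * φ.v i x := by
    rw [dirac, Fin.sum_univ_two, cl, cl, he.frameCoord_zero hx, he.frameCoord_one hx, coef_mul h,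
      coef_mul h, add_mul, mul_assoc, mul_assoc]
  have h2 : H • (omega2 * φ.v i x)
        - (τ * lam x) • (lam x • φ.v i x + cl σ i x (T x) (omega2 * φ.v i x))
      = (H • omega2 - (τ * lam x) • (lam x • 1 + frameCoord (σ.frame i) x (T x) * omega2))
        * φ.v i x := by
    simp only [cl, sub_mul, add_mul, smul_mul_assoc, one_mul, mul_assoc]
  -- After cancelling v, the real, k, j and i parts give the four conditions in this order; constant
  -- norm has removed the real parts of the two coefficients.
  rw [h1, h2, mul_left_inj' h, Quaternion.ext_iff]
  simp [hr0, hr1]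
  constructor
  · rintro ⟨a, b, c, d⟩
    refine ⟨?_, ?_, ?_, ?_⟩ <;> linarith
  · rintro ⟨a, b, c, d⟩
    refine ⟨?_, ?_, ?_, ?_⟩ <;> linarith

theorem isDiracR3_iff {H : M → ℝ} : φ.IsDiracR3 H ↔ φ.IsDiracNil3 0 H 0 0 := by
  simp [IsDiracR3, IsDiracNil3]

theorem connTerm_expansion (hx : x ∈ σ.U i) (X : TangentSpace (𝓡 2) x) :
    connTerm τ S T lam i x X
      = (inner ℝ (σ.frame i 0 x) X : ℝ) • connTerm τ S T lam i x (σ.frame i 0 x)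
      + (inner ℝ (σ.frame i 1 x) X : ℝ) • connTerm τ S T lam i x (σ.frame i 1 x) := by
  conv_lhs => rw [(σ.isFrame i).expansion hx X]
  simp only [connTerm, map_add, map_smul, frameCoord_add, frameCoord_smul, inner_add_left,
    inner_smul_left, add_mul, smul_mul_assoc]
  simp only [RCLike.conj_to_real]
  module

variable (hN : φ.ConstNorm) (hn : φ.Nontrivial)

section Forward

variable (hc : φ.IsConstantNil3 τ S T lam)
include hN hn hc

theorem IsConstantNil3.coef_eq (hx : x ∈ σ.U i) (X : TangentSpace (𝓡 2) x) :
    φ.coef i x X = connTerm τ S T lam i x X :=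
  eq_coef (hN.v_ne_zero hn hx) (isConstantNil3_iff.1 hc i x hx X)

theorem IsConstantNil3.isDiracNil3 (hS : IsSymmetricField S)
    (h1 : τ ≠ 0 → ∀ x, lam x ^ 2 + ‖T x‖ ^ 2 = 1) :
    φ.IsDiracNil3 τ (meanCurvature S) T lam := by
  intro i x hx
  have he := σ.isFrame i
  rw [dirac_eq_iff hN (hN.v_ne_zero hn hx) hx, hc.coef_eq hN hn hx, hc.coef_eq hN hn hx]
  have hH := he.meanCurvature_eq hx S
  have hs := hS.2 x (σ.frame i 0 x) (σ.frame i 1 x)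
  rw [real_inner_comm] at hs
  have hne : ∀ a, ‖σ.frame i a x‖ = 1 := (he.2 x hx).1.1
  -- Symmetry of S cancels its contribution to the real part, leaving τ - τ|T|², which must equal
  -- τλ². For τ = 0 no normalisation of T and λ is available or needed.
  have hT : τ * (lam x ^ 2 + inner ℝ (σ.frame i 0 x) (T x) ^ 2
      + inner ℝ (σ.frame i 1 x) (T x) ^ 2) = τ := by
    by_cases hτ : τ = 0
    · simp [hτ]
    · have h2 := h1 hτ x
      rw [← real_inner_self_eq_norm_sq, he.inner_eq hx (T x) (T x)] at h2
      rw [add_assoc, sq (inner ℝ (σ.frame i 0 x) (T x) : ℝ), sq (inner ℝ (σ.frame i 1 x) (T x) : ℝ),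
        h2, mul_one]
  refine ⟨?_, ?_, ?_, ?_⟩
  · simp [connTerm, hne]
    linarith
  · simp [connTerm, he.inner_zero_one hx, he.inner_one_zero hx]
    linarith
  · simp [connTerm]; ring
  · simp [connTerm]; ring

/-- The S-term contributes ½⟨SX,Y⟩ from each slot, the term (τ/2)X is skew and cancels in the
symmetrisation, the term in T gives -B, and the k-component does not pair with tangent vectors. -/
theorem IsConstantNil3.two_energyMomentum (hS : IsSymmetricField S) (hx : x ∈ σ.U i)
    (X Y : TangentSpace (𝓡 2) x) :
    2 * φ.energyMomentum i x X Y = inner ℝ (S x X) Y - tensorB o τ T x X Y := by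
  have he := σ.isFrame i
  rw [energyMomentum_eq_components (hN.v_ne_zero hn hx), hc.coef_eq hN hn hx,
    hc.coef_eq hN hn hx, tensorB]
  have e1 := he.inner_eq hx (S x X) Y
  have e2 := hS.2 x X Y
  have e3 := he.inner_eq hx X (S x Y)
  have e4 := he.inner_eq hx (o.J x Y) (T x)
  have e5 := he.inner_eq hx (o.J x X) (T x)
  obtain ⟨j0, j1⟩ := he.inner_rotation hx X
  obtain ⟨j2, j3⟩ := he.inner_rotation hx Y
  rw [SurfaceOrientation.J, j0, j1, ← SurfaceOrientation.J] at e5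
  rw [SurfaceOrientation.J, j2, j3, ← SurfaceOrientation.J] at e4
  rw [e4, e5]
  simp [connTerm]
  linear_combination -(1 / 2) * (e1 + e2 + e3)

theorem IsConstantNil3.dLambdaCondition (hS : IsSymmetricField S)
    (hD : DanielEquations o τ S T lam) : φ.DLambdaCondition τ T lam := by
  intro i x hx X
  have h := hc.two_energyMomentum hN hn hS hx (T x) X
  have h2 := hS.2 x (T x) X
  have h3 : (inner ℝ (o.J x (T x)) X : ℝ) = -inner ℝ (o.J x X) (T x) := by
    rw [SurfaceOrientation.J, SurfaceOrientation.J, Orientation.inner_rightAngleRotation_left,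
      Orientation.inner_rightAngleRotation_left, Orientation.areaForm_swap]
  rw [(hD x X).2, inner_sub_left, inner_smul_left, h3, real_inner_comm, ← h2]
  simp only [RCLike.conj_to_real]
  linarith

end Forward

end SpinorField

end DiracSpinors

/-! ### Smoothness of endomorphism fields; density of the set where T ≠ 0 -/

section EndomorphismFields

open Topology

variable {M : Type*} [TopologicalSpace M] [ChartedSpace (EuclideanSpace ℝ (Fin 2)) M]
  [IsManifold (𝓡 2) ∞ M]
  [RiemannianBundle (fun x : M => TangentSpace (𝓡 2) x)]
  [IsContMDiffRiemannianBundle (𝓡 2) ∞ (EuclideanSpace ℝ (Fin 2))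
    (fun x : M => TangentSpace (𝓡 2) x)]
  {S : Π x : M, TangentSpace (𝓡 2) x →L[ℝ] TangentSpace (𝓡 2) x}

theorem clm_eq_sum (L : EuclideanSpace ℝ (Fin 2) →L[ℝ] EuclideanSpace ℝ (Fin 2)) :
    L = ∑ a : Fin 2, ContinuousLinearMap.smulRightL ℝ _ _ (EuclideanSpace.proj a)
      (L (EuclideanSpace.single a 1)) := by
  ext v : 1
  conv_lhs => rw [show v = ∑ a : Fin 2, v a • EuclideanSpace.single a (1 : ℝ) by
    ext b; fin_cases b <;> simp [Fin.sum_univ_two]]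
  rw [map_sum]
  simp

/-- A field of endomorphisms which maps smooth fields to smooth fields is smooth. -/
theorem contMDiffAt_of_apply {x₀ : M}
    (h : ∀ X : Π x : M, TangentSpace (𝓡 2) x, IsSmoothAt X x₀ →
      IsSmoothAt (fun y => S y (X y)) x₀) :
    ContMDiffAt (𝓡 2)
      ((𝓡 2).prod 𝓘(ℝ, EuclideanSpace ℝ (Fin 2) →L[ℝ] EuclideanSpace ℝ (Fin 2))) ∞
      (fun x => TotalSpace.mk' (EuclideanSpace ℝ (Fin 2) →L[ℝ] EuclideanSpace ℝ (Fin 2))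
        (E := fun x : M => TangentSpace (𝓡 2) x →L[ℝ] TangentSpace (𝓡 2) x) x (S x)) x₀ := by
  rw [contMDiffAt_hom_bundle]
  refine ⟨contMDiffAt_id, ?_⟩
  set t := trivializationAt (EuclideanSpace ℝ (Fin 2)) (fun x : M => TangentSpace (𝓡 2) x) x₀
    with ht
  have hx₀ : x₀ ∈ t.baseSet := FiberBundle.mem_baseSet_trivializationAt' x₀
  have hb : ∀ b : EuclideanSpace ℝ (Fin 2), ContMDiffAt (𝓡 2) 𝓘(ℝ, EuclideanSpace ℝ (Fin 2)) ∞
      (fun y => ContinuousLinearMap.inCoordinates (EuclideanSpace ℝ (Fin 2))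
        (fun x : M => TangentSpace (𝓡 2) x) (EuclideanSpace ℝ (Fin 2))
        (fun x : M => TangentSpace (𝓡 2) x) x₀ y x₀ y (S y) b) x₀ := by
    intro b
    -- The test fields have constant components b in the trivialisation; their images are the
    -- columns of the local matrix of S.
    have hX : IsSmoothAt (fun y => t.symmL ℝ y b) x₀ := by
      refine (t.contMDiffAt_section_iff hx₀).2 ?_
      refine (contMDiffAt_const (c := b)).congr_of_eventuallyEq ?_
      filter_upwards [t.open_baseSet.mem_nhds hx₀] with y hy
      rw [t.symmL_apply hy]
      exact congrArg Prod.snd (t.apply_mk_symm hy b)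
    have h2 := (t.contMDiffAt_section_iff hx₀).1 (h _ hX)
    refine h2.congr_of_eventuallyEq ?_
    filter_upwards [t.open_baseSet.mem_nhds hx₀] with y hy
    exact t.continuousLinearMapAt_apply_of_mem ℝ hy _
  have h3 : (fun y => ContinuousLinearMap.inCoordinates (EuclideanSpace ℝ (Fin 2))
        (fun x : M => TangentSpace (𝓡 2) x) (EuclideanSpace ℝ (Fin 2))
        (fun x : M => TangentSpace (𝓡 2) x) x₀ y x₀ y (S y))
      = fun y => ∑ a : Fin 2, ContinuousLinearMap.smulRightL ℝ _ _ (EuclideanSpace.proj a)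
        (ContinuousLinearMap.inCoordinates (EuclideanSpace ℝ (Fin 2))
        (fun x : M => TangentSpace (𝓡 2) x) (EuclideanSpace ℝ (Fin 2))
        (fun x : M => TangentSpace (𝓡 2) x) x₀ y x₀ y (S y) (EuclideanSpace.single a 1)) := by
    funext y
    exact clm_eq_sum _
  change ContMDiffAt _ _ _ (fun y => ContinuousLinearMap.inCoordinates (EuclideanSpace ℝ (Fin 2))
        (fun x : M => TangentSpace (𝓡 2) x) (EuclideanSpace ℝ (Fin 2))
        (fun x : M => TangentSpace (𝓡 2) x) x₀ y x₀ y (S y)) _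
  rw [h3]
  simp only [Fin.sum_univ_two]
  exact (contMDiffAt_clm_comp _ (hb _)).add (contMDiffAt_clm_comp _ (hb _))

theorem IsSymmetricField.smoothAt_apply (hS : IsSymmetricField S) {x : M}
    {X : Π x : M, TangentSpace (𝓡 2) x} (hX : IsSmoothAt X x) :
    IsSmoothAt (fun y => S y (X y)) x :=
  ContMDiffAt.clm_bundle_apply (E₁ := fun x : M => TangentSpace (𝓡 2) x)
    (E₂ := fun x : M => TangentSpace (𝓡 2) x) (hS.1 x) hX

/-- Under Daniel's equations, the tangential part of the vertical field does not vanish on any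
open set. -/
theorem DanielEquations.not_eventually_eq_zero {o : SurfaceOrientation M} {τ : ℝ} (hτ : τ ≠ 0)
    (hS : IsSymmetricField S) {T : Π x : M, TangentSpace (𝓡 2) x} (hT : IsSmoothField T)
    {lam : M → ℝ} (h1 : ∀ x, lam x ^ 2 + ‖T x‖ ^ 2 = 1) (hD : DanielEquations o τ S T lam) (x : M) :
    ¬ ∀ᶠ y in 𝓝 x, T y = 0 := by
  intro h0
  obtain ⟨U, hU, hx, e, he⟩ := o.exists_frame x
  have hT0 : T x = 0 := h0.self_of_nhds
  have hl : lam x ≠ 0 := fun h => by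
    have := h1 x
    rw [h, hT0, norm_zero] at this
    norm_num at this
  have hL : ∀ X, leviCivita T x X = 0 := by
    intro X
    refine he.ext_inner hx fun i => ?_
    have h2 := leviCivita_metric_apply (he.contMDiffAt hU hx i) (hT x) X
    have h3 : (fun y => (inner ℝ (e i y) (T y) : ℝ)) =ᶠ[𝓝 x] fun _ => 0 := by
      filter_upwards [h0] with y hy
      rw [hy, inner_zero_right]
    rw [h3.mvfderiv_eq, mvfderiv_const, hT0, inner_zero_right, zero_add] at h2
    rw [← h2, inner_zero_right]
    rfl
  -- ∇T = 0 and λ ≠ 0 at x force S = τJ there, which is skew and nonzero, against the symmetry of S.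
  have hSJ : ∀ X, S x X = τ • o.J x X := fun X =>
    sub_eq_zero.1 ((smul_eq_zero_iff_right hl).1 ((hD x X).1.symm.trans (hL X)))
  have h4 := hS.2 x (e 0 x) (e 1 x)
  obtain ⟨-, j1⟩ := he.inner_rotation hx (e 0 x)
  obtain ⟨j0, -⟩ := he.inner_rotation hx (e 1 x)
  rw [hSJ, hSJ, inner_smul_left, inner_smul_right, real_inner_comm, SurfaceOrientation.J,
    SurfaceOrientation.J, j0, j1, he.inner_self hx, he.inner_self hx] at h4
  simp only [RCLike.conj_to_real] at h4
  exact hτ (by linarith)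

end EndomorphismFields

/-! ### From the Dirac equation back to a constant spinor -/

section DiracConverse

open Topology

variable {M : Type*} [TopologicalSpace M] [ChartedSpace (EuclideanSpace ℝ (Fin 2)) M]
  [IsManifold (𝓡 2) ∞ M]
  [RiemannianBundle (fun x : M => TangentSpace (𝓡 2) x)]
  [IsContMDiffRiemannianBundle (𝓡 2) ∞ (EuclideanSpace ℝ (Fin 2))
    (fun x : M => TangentSpace (𝓡 2) x)]
  {o : SurfaceOrientation M} {σ : SpinStructure o}

namespace SpinorField

variable {φ : SpinorField σ} {τ : ℝ}
  {S : Π x : M, TangentSpace (𝓡 2) x →L[ℝ] TangentSpace (𝓡 2) x}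
  {T : Π x : M, TangentSpace (𝓡 2) x} {lam : M → ℝ} {i : σ.ι} {x : M}

theorem UnitNorm.constNorm (hu : φ.UnitNorm) : φ.ConstNorm := ⟨1, hu⟩

theorem UnitNorm.v_ne_zero (hu : φ.UnitNorm) (hx : x ∈ σ.U i) : φ.v i x ≠ 0 := fun h => by
  have := hu i x hx
  rw [h, norm_zero] at this
  norm_num at this

theorem UnitNorm.nontrivial [Nonempty M] (hu : φ.UnitNorm) : φ.Nontrivial := by
  obtain ⟨x⟩ : Nonempty M := inferInstance
  exact ⟨σ.idx x, x, σ.mem_idx x, hu.v_ne_zero (σ.mem_idx x)⟩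

/-- Numerator and squared norm both scale by c², so normalising the spinor does not change its
potential. -/
theorem mulRight_coe_coef {c : ℝ} (hc : c ≠ 0) (hx : x ∈ σ.U i) (X : TangentSpace (𝓡 2) x) :
    (φ.mulRight (c : ℍ[ℝ])).coef i x X = φ.coef i x X := by
  rw [coef, coef, mulRight_nabla _ hx, mulRight_v, norm_mul, Quaternion.norm_coe, star_mul,
    mul_assoc, ← mul_assoc (c : ℍ[ℝ]), Quaternion.self_mul_star, Quaternion.normSq_coe,
    Quaternion.coe_mul_eq_smul, mul_smul_comm, smul_smul, mul_pow, Real.norm_eq_abs, sq_abs,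
    mul_inv, mul_assoc, inv_mul_cancel₀ (pow_ne_zero 2 hc), mul_one]

theorem mulRight_dirac (q : ℍ[ℝ]) (hx : x ∈ σ.U i) :
    (φ.mulRight q).dirac i x = φ.dirac i x * q := by
  simp only [dirac, cl, mulRight_nabla q hx, Fin.sum_univ_two, add_mul, mul_assoc]

theorem IsDiracNil3.mulRight {H : M → ℝ} (h : φ.IsDiracNil3 τ H T lam) (q : ℍ[ℝ]) :
    (φ.mulRight q).IsDiracNil3 τ H T lam := by
  intro i x hx
  rw [mulRight_dirac q hx, h i x hx, mulRight_v]
  simp only [cl, sub_mul, add_mul, smul_mul_assoc, mul_assoc]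

theorem DLambdaCondition.mulRight (h : φ.DLambdaCondition τ T lam) (hN : φ.ConstNorm)
    (hn : φ.Nontrivial) {c : ℝ} (hc : c ≠ 0) :
    (φ.mulRight (c : ℍ[ℝ])).DLambdaCondition τ T lam := by
  intro i x hx X
  have h0 := hN.v_ne_zero hn hx
  have h0' : (φ.mulRight (c : ℍ[ℝ])).v i x ≠ 0 := by
    rw [mulRight_v]
    exact mul_ne_zero h0 fun h => hc (by simpa using congrArg QuaternionAlgebra.re h)
  rw [h i x hx X, energyMomentum_eq h0, energyMomentum_eq h0', mulRight_coe_coef hc hx,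
    mulRight_coe_coef hc hx]

/-- The second fundamental form of the normal field of a spinor field. -/
def secondForm (φ : SpinorField σ) (x : M) (X Y : TangentSpace (𝓡 2) x) : ℝ :=
  -inner ℝ (mvfderiv (𝓡 2) φ.normal x X) (φ.form x Y)

/-- The derivative of the normal is the conjugate of [k, A(X)], which sees only the i- and
j-components of A(X). -/
theorem secondForm_eq (hu : φ.UnitNorm) (hx : x ∈ σ.U i) (X Y : TangentSpace (𝓡 2) x) :
    φ.secondForm x X Y = 2 * (inner ℝ (σ.frame i 0 x) Y * (φ.coef i x X).imJ
      - inner ℝ (σ.frame i 1 x) Y * (φ.coef i x X).imI) := by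
  have h1 : mvfderiv (𝓡 2) φ.normal x X
      = star (φ.v i x) * (omega2 * φ.coef i x X - φ.coef i x X * omega2) * φ.v i x := by
    rw [(φ.normal_eventuallyEq hx).mvfderiv_eq,
      IsOrientedFrameOn.mvfderiv_conj_omega2 (σ.frame i) (φ.mdiffAt_v hx) X,
      ← nabla_eq_spinDeriv, coef_mul (hu.v_ne_zero hx), star_mul, hu.constNorm.star_coef hx]
    noncomm_ring
  rw [secondForm, h1, φ.form_eq hx, inner_star_mul_mul (hu i x hx), Quaternion.inner_def]
  simp
  ring

theorem contMDiffAt_secondForm {X Y : Π x : M, TangentSpace (𝓡 2) x} (hX : IsSmoothAt X x)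
    (hY : IsSmoothAt Y x) :
    ContMDiffAt (𝓡 2) 𝓘(ℝ, ℝ) ∞ (fun y => φ.secondForm y (X y) (Y y)) x :=
  (contMDiffAt_bilinear (innerSL ℝ) ((φ.contMDiff_normal x).mvfderiv_apply hX)
    (φ.contMDiffAt_form hY)).neg

/-- A unit spinor field which satisfies the Dirac equation of `ℝ³` is constant for some symmetric
field of endomorphisms. -/
theorem IsDiracR3.exists_isConstantR3 {H : M → ℝ} (hD : φ.IsDiracR3 H) (hu : φ.UnitNorm) :
    ∃ S : Π x : M, TangentSpace (𝓡 2) x →L[ℝ] TangentSpace (𝓡 2) x,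
      IsSymmetricField S ∧ meanCurvature S = H ∧ φ.IsConstantR3 S := by
  rw [isDiracR3_iff] at hD
  -- The shape operator of the normal field, written in the spin frame chosen at x. That choice
  -- varies wildly with x, so smoothness is proved below by expanding in one fixed frame near each
  -- point.
  let S : Π x : M, TangentSpace (𝓡 2) x →L[ℝ] TangentSpace (𝓡 2) x := fun x =>
    -∑ a : Fin 2, (innerSL ℝ (φ.form x (σ.frame (σ.idx x) a x)) ∘L
      mvfderiv (𝓡 2) φ.normal x).smulRight (σ.frame (σ.idx x) a x)
  have hSX : ∀ x X, S x X = φ.secondForm x X (σ.frame (σ.idx x) 0 x) • σ.frame (σ.idx x) 0 x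
      + φ.secondForm x X (σ.frame (σ.idx x) 1 x) • σ.frame (σ.idx x) 1 x := by
    intro x X
    have h2 : S x X = -∑ a : Fin 2, (inner ℝ (φ.form x (σ.frame (σ.idx x) a x))
        (mvfderiv (𝓡 2) φ.normal x X) : ℝ) • σ.frame (σ.idx x) a x := by
      simp [S]
    rw [h2, Fin.sum_univ_two, secondForm, secondForm, neg_add, neg_smul, neg_smul,
      real_inner_comm, real_inner_comm (mvfderiv (𝓡 2) φ.normal x X)
        (φ.form x (σ.frame (σ.idx x) 1 x))]
  have hS : ∀ x X Y, (inner ℝ (S x X) Y : ℝ) = φ.secondForm x X Y := by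
    intro x X Y
    have he := σ.isFrame (σ.idx x)
    have hx := σ.mem_idx x
    rw [hSX, inner_add_left, inner_smul_left, inner_smul_left]
    conv_rhs => rw [he.expansion hx Y]
    simp only [secondForm, map_add, map_smul, inner_add_right, inner_smul_right]
    simp only [RCLike.conj_to_real]
    ring
  have hco : ∀ i x, x ∈ σ.U i → _ := fun i x hx =>
    (dirac_eq_iff hu.constNorm (hu.v_ne_zero hx) hx (H x)).1 (hD i x hx)
  refine ⟨S, ⟨fun x => contMDiffAt_of_apply fun X hX => ?_, ?_⟩, ?_, ?_⟩
  · have he := σ.isFrame (σ.idx x)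
    have hx := σ.mem_idx x
    have hU := σ.isOpen_U (σ.idx x)
    have h1 := fun a => ContMDiffAt.smul_section
      (contMDiffAt_secondForm (φ := φ) hX (he.contMDiffAt hU hx a)) (he.contMDiffAt hU hx a)
    refine (ContMDiffAt.add_section (h1 0) (h1 1)).congr_of_eventuallyEq ?_
    filter_upwards [hU.mem_nhds hx] with y hy
    have h2 : S y (X y) = φ.secondForm y (X y) (σ.frame (σ.idx x) 0 y) • σ.frame (σ.idx x) 0 y
        + φ.secondForm y (X y) (σ.frame (σ.idx x) 1 y) • σ.frame (σ.idx x) 1 y := by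
      rw [he.expansion hy (S y (X y)), real_inner_comm, hS,
        real_inner_comm (S y (X y)) (σ.frame (σ.idx x) 1 y), hS]
    rw [h2]
    rfl
  · intro x X Y
    have hx := σ.mem_idx x
    rw [hS, real_inner_comm, hS, secondForm_eq hu hx, secondForm_eq hu hx, coef_expansion hx X,
      coef_expansion hx Y]
    obtain ⟨h1, -, -, -⟩ := hco _ x hx
    simp at h1 ⊢
    -- The skew part of the second form is a multiple of the real part of the Dirac equation, which
    -- is 0 here.
    linear_combination (inner ℝ (σ.frame (σ.idx x) 0 x) Y * inner ℝ (σ.frame (σ.idx x) 1 x) X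
      - inner ℝ (σ.frame (σ.idx x) 0 x) X * inner ℝ (σ.frame (σ.idx x) 1 x) Y) * h1
  · funext x
    have he := σ.isFrame (σ.idx x)
    have hx := σ.mem_idx x
    have h := he.meanCurvature_eq hx S
    obtain ⟨-, h1, -, -⟩ := hco _ x hx
    rw [real_inner_comm, hS, real_inner_comm (S x _) (σ.frame (σ.idx x) 1 x), hS,
      secondForm_eq hu hx, secondForm_eq hu hx, he.inner_self hx, he.inner_self hx,
      he.inner_one_zero hx, he.inner_zero_one hx] at h
    linarith
  · rw [isConstantR3_iff, isConstantNil3_iff]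
    intro i x hx X
    rw [coef_mul (hu.v_ne_zero hx)]
    congr 1
    have he := σ.isFrame i
    obtain ⟨h1, h2, h3, h4⟩ := hco i x hx
    have hr := hu.constNorm.coef_re hx X
    have hk : (φ.coef i x X).imK = 0 := by
      rw [coef_expansion hx]
      simp at h3 h4 ⊢
      rw [h3, h4]; ring
    have hs : ∀ a, (inner ℝ (σ.frame i a x) (S x X) : ℝ) = φ.secondForm x X (σ.frame i a x) :=
      fun a => by rw [real_inner_comm, hS]
    have s0 := hs 0
    have s1 := hs 1
    rw [secondForm_eq hu hx, he.inner_self hx, he.inner_one_zero hx] at s0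
    rw [secondForm_eq hu hx, he.inner_self hx, he.inner_zero_one hx] at s1
    ext <;> simp [connTerm, hr, hk, s0, s1]

/-- A unit spinor field which satisfies the Dirac equation of `Nil₃(τ)` is constant. -/
theorem IsDiracNil3.isConstantNil3 (hτ : τ ≠ 0) (hS : IsSymmetricField S) (hT : IsSmoothField T)
    (h1 : ∀ x, lam x ^ 2 + ‖T x‖ ^ 2 = 1) (hD : DanielEquations o τ S T lam) (hu : φ.UnitNorm)
    (hφ : φ.IsDiracNil3 τ (meanCurvature S) T lam) (hlam : φ.DLambdaCondition τ T lam) :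
    φ.IsConstantNil3 τ S T lam := by
  rw [isConstantNil3_iff]
  intro i x hx X
  have he := σ.isFrame i
  have hU := σ.isOpen_U i
  let e := σ.frame i
  let t : Fin 2 → M → ℝ := fun a y => inner ℝ (e a y) (T y)
  let s : Fin 2 → Fin 2 → M → ℝ := fun a b y => inner ℝ (e a y) (S y (e b y))
  -- k₀ and k₁ are the (1,1) and (1,2) entries of S - 2Q - B. By the Dirac equation this symmetric
  -- tensor has trace 0, so they determine it. They are written with `secondForm` to make continuity
  -- available.
  let k₀ : M → ℝ := fun y => s 0 0 y - φ.secondForm y (e 0 y) (e 0 y) - 2 * τ * (t 0 y * t 1 y)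
  let k₁ : M → ℝ := fun y => s 0 1 y
    - 1 / 2 * (φ.secondForm y (e 0 y) (e 1 y) + φ.secondForm y (e 1 y) (e 0 y))
    - τ * (t 1 y * t 1 y - t 0 y * t 0 y)
  have hk : ∀ y ∈ σ.U i, T y ≠ 0 → k₀ y = 0 ∧ k₁ y = 0 := by
    intro y hy hTy
    have h0 := hu.v_ne_zero (i := i) hy
    obtain ⟨-, c2, -, -⟩ := (dirac_eq_iff hu.constNorm h0 hy _).1 (hφ i y hy)
    have hH := he.meanCurvature_eq hy S
    have hsym : s 1 0 y = s 0 1 y := by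
      have := hS.2 y (e 0 y) (e 1 y)
      rwa [real_inner_comm] at this
    have hT2 := he.inner_eq hy (T y) (T y)
    have hJ : (inner ℝ (o.J y (T y)) (T y) : ℝ) = 0 :=
      Orientation.inner_rightAngleRotation_self _ _
    obtain ⟨j0, j1⟩ := he.inner_rotation hy (T y)
    obtain ⟨l00, l01⟩ := he.inner_rotation hy (e 0 y)
    obtain ⟨l10, l11⟩ := he.inner_rotation hy (e 1 y)
    -- The two expressions for dλ, from Daniel's equations and from the condition with Q, compared
    -- on frame vectors. They yield `eA` and `eB`, a linear system for k₀, k₁ with determinant |T|²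
    -- up to sign.
    have hd : ∀ a, -(s 0 a y * t 0 y + s 1 a y * t 1 y) + τ * inner ℝ (o.J y (e a y)) (T y)
        = -(t 0 y * (φ.coef i y (e a y)).imJ - t 1 y * (φ.coef i y (e a y)).imI
          + inner ℝ (e 0 y) (e a y) * (φ.coef i y (T y)).imJ
          - inner ℝ (e 1 y) (e a y) * (φ.coef i y (T y)).imI)
          - τ * ((t 0 y * t 0 y + t 1 y * t 1 y) * inner ℝ (o.J y (e a y)) (T y))
          - τ * inner ℝ (e a y) (o.J y (T y)) := by
      intro a
      have h2 := (hD y (e a y)).2.symm.trans (hlam i y hy (e a y))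
      have h3 := energyMomentum_eq_components h0 (T y) (e a y)
      have h4 := he.inner_eq hy (S y (e a y)) (T y)
      rw [tensorB, hJ, hT2, inner_sub_left, inner_smul_left, h4,
        real_inner_comm (e a y) (o.J y (T y))] at h2
      simp only [RCLike.conj_to_real] at h2
      simp only [t, s]
      linear_combination h2 - h3
    have d0 := hd 0
    have d1 := hd 1
    have q1 : (φ.coef i y (T y)).imI
        = t 0 y * (φ.coef i y (e 0 y)).imI + t 1 y * (φ.coef i y (e 1 y)).imI := by
      rw [coef_expansion hy]; simp [t, e]
    have q2 : (φ.coef i y (T y)).imJ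
        = t 0 y * (φ.coef i y (e 0 y)).imJ + t 1 y * (φ.coef i y (e 1 y)).imJ := by
      rw [coef_expansion hy]; simp [t, e]
    have m0 : (inner ℝ (o.J y (e 0 y)) (T y) : ℝ) = t 1 y := by
      rw [he.inner_eq hy, SurfaceOrientation.J, l00, l01, he.inner_self hy, he.inner_one_zero hy]
      simp [t, e]
    have m1 : (inner ℝ (o.J y (e 1 y)) (T y) : ℝ) = -t 0 y := by
      rw [he.inner_eq hy, SurfaceOrientation.J, l10, l11, he.inner_self hy, he.inner_zero_one hy]
      simp [t, e]
    rw [m0, q1, q2, he.inner_self hy, he.inner_one_zero hy, SurfaceOrientation.J, j0, hsym] at d0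
    rw [m1, q1, q2, he.inner_self hy, he.inner_zero_one hy, SurfaceOrientation.J, j1] at d1
    have hk₀ : k₀ y = s 0 0 y - 2 * (φ.coef i y (e 0 y)).imJ - 2 * τ * (t 0 y * t 1 y) := by
      simp only [k₀]
      rw [secondForm_eq hu hy, he.inner_self hy, he.inner_one_zero hy]
      ring
    have hk₁ : k₁ y = s 0 1 y - ((φ.coef i y (e 1 y)).imJ - (φ.coef i y (e 0 y)).imI)
        - τ * (t 1 y * t 1 y - t 0 y * t 0 y) := by
      simp only [k₁]
      rw [secondForm_eq hu hy, secondForm_eq hu hy, he.inner_self hy, he.inner_self hy,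
        he.inner_one_zero hy, he.inner_zero_one hy]
      ring
    have eA : k₀ y * t 0 y + k₁ y * t 1 y = 0 := by
      rw [hk₀, hk₁]
      change _ = _ - τ * -t 1 y at d0
      linear_combination -d0
    have eB : k₁ y * t 0 y - k₀ y * t 1 y = 0 := by
      rw [hk₀, hk₁]
      change _ = _ - τ * t 0 y at d1
      change 2 * _ = s 0 0 y + s 1 1 y at hH
      change (φ.coef i y (e 0 y)).imJ - (φ.coef i y (e 1 y)).imI = _ at c2
      linear_combination -d1 + t 1 y * hH + 2 * t 1 y * c2
    have hn : t 0 y * t 0 y + t 1 y * t 1 y ≠ 0 := by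
      change _ = t 0 y * t 0 y + t 1 y * t 1 y at hT2
      rw [← hT2]
      exact inner_self_ne_zero.2 hTy
    constructor
    · refine (mul_eq_zero.1 ?_).resolve_right hn
      linear_combination t 0 y * eA - t 1 y * eB
    · refine (mul_eq_zero.1 ?_).resolve_right hn
      linear_combination t 1 y * eA + t 0 y * eB
  have ht : ∀ a, ContinuousAt (t a) x := fun a =>
    (smoothAt_inner (he.contMDiffAt hU hx a) (hT x)).continuousAt
  have hs : ∀ a b, ContinuousAt (s a b) x := fun a b =>
    (smoothAt_inner (he.contMDiffAt hU hx a)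
      (hS.smoothAt_apply (he.contMDiffAt hU hx b))).continuousAt
  have hw : ∀ a b, ContinuousAt (fun y => φ.secondForm y (e a y) (e b y)) x := fun a b =>
    (contMDiffAt_secondForm (he.contMDiffAt hU hx a) (he.contMDiffAt hU hx b)).continuousAt
  -- If k x ≠ 0, then k ≠ 0 near x, so T would vanish on a neighbourhood of x, which Daniel's
  -- equations exclude.
  have hzero : ∀ k : M → ℝ, ContinuousAt k x → (∀ y ∈ σ.U i, T y ≠ 0 → k y = 0) → k x = 0 := by
    intro k hk h
    by_contra h0
    refine hD.not_eventually_eq_zero hτ hS hT h1 x ?_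
    filter_upwards [hU.mem_nhds hx, hk.eventually_ne h0] with y hy hy'
    by_contra hTy
    exact hy' (h y hy hTy)
  have hk₀ : k₀ x = 0 := hzero k₀ (((hs 0 0).sub (hw 0 0)).sub
    (continuousAt_const.mul ((ht 0).mul (ht 1)))) fun y hy hTy => (hk y hy hTy).1
  have hk₁ : k₁ x = 0 := hzero k₁ (((hs 0 1).sub (continuousAt_const.mul ((hw 0 1).add (hw 1 0)))).sub
    (continuousAt_const.mul (((ht 1).mul (ht 1)).sub ((ht 0).mul (ht 0)))))
    fun y hy hTy => (hk y hy hTy).2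
  simp only [k₀] at hk₀
  simp only [k₁] at hk₁
  rw [secondForm_eq hu hx, he.inner_self hx, he.inner_one_zero hx] at hk₀
  rw [secondForm_eq hu hx, secondForm_eq hu hx, he.inner_self hx, he.inner_self hx,
    he.inner_one_zero hx, he.inner_zero_one hx] at hk₁
  have hv0 := hu.v_ne_zero (i := i) hx
  obtain ⟨c1, c2, c3, c4⟩ := (dirac_eq_iff hu.constNorm hv0 hx _).1 (hφ i x hx)
  have hH := he.meanCurvature_eq hx S
  have hr := fun X => hu.constNorm.coef_re hx X
  have hsym := hS.2 x (σ.frame i 0 x) (σ.frame i 1 x)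
  rw [real_inner_comm] at hsym
  have hT1 : lam x ^ 2 + ((inner ℝ (σ.frame i 0 x) (T x) : ℝ) ^ 2
      + (inner ℝ (σ.frame i 1 x) (T x) : ℝ) ^ 2) = 1 := by
    have h2 := h1 x
    rwa [← real_inner_self_eq_norm_sq, he.inner_eq hx (T x) (T x), ← sq, ← sq] at h2
  have hne : ∀ a, ‖σ.frame i a x‖ = 1 := (he.2 x hx).1.1
  rw [coef_mul hv0]
  congr 1
  simp only [t, s, e] at hk₀ hk₁
  rw [coef_expansion hx, connTerm_expansion hx]
  congr 2
  · ext
    · simp [connTerm, hr]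
    · simp [connTerm, hne]
      linear_combination (1 / 2) * (c1 + hk₁ + τ * hT1 + hsym)
    · simp [connTerm, he.inner_one_zero hx]
      linear_combination -(1 / 2) * hk₀
    · simp [connTerm, c3]
      ring
  · ext
    · simp [connTerm, hr]
    · simp [connTerm, he.inner_zero_one hx]
      linear_combination -(1 / 2) * hk₀ - c2 - (1 / 2) * hH
    · simp [connTerm, hne]
      linear_combination (1 / 2) * (c1 + τ * hT1) - (1 / 2) * hk₁
    · simp [connTerm, c4]
      ring

end SpinorField

end DiracConverse

end

/-! ### Assembling the equivalences -/

theorem theorem1 {M : Type*} [TopologicalSpace M] [T2Space M] [SecondCountableTopology M]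
    [SimplyConnectedSpace M] [ChartedSpace (EuclideanSpace ℝ (Fin 2)) M] [IsManifold (𝓡 2) ∞ M]
    [RiemannianBundle (fun x : M => TangentSpace (𝓡 2) x)]
    [IsContMDiffRiemannianBundle (𝓡 2) ∞ (EuclideanSpace ℝ (Fin 2))
      (fun x : M => TangentSpace (𝓡 2) x)]
    (o : SurfaceOrientation M) (σ : SpinStructure o) :
    -- immersions into Euclidean space with prescribed shape operator
    (∀ S : Π x : M, TangentSpace (𝓡 2) x →L[ℝ] TangentSpace (𝓡 2) x, IsSymmetricField S →
      ((∃ f nu : M → R3, IsImmersionR3 o S f nu) ↔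
        ∃ φ : SpinorField σ, φ.Nontrivial ∧ φ.IsConstantR3 S)) ∧
    -- immersions into Euclidean space with prescribed mean curvature
    (∀ H : M → ℝ, List.TFAE [
      ∃ S : Π x : M, TangentSpace (𝓡 2) x →L[ℝ] TangentSpace (𝓡 2) x,
        IsSymmetricField S ∧ meanCurvature S = H ∧ ∃ f nu : M → R3, IsImmersionR3 o S f nu,
      ∃ S : Π x : M, TangentSpace (𝓡 2) x →L[ℝ] TangentSpace (𝓡 2) x,
        IsSymmetricField S ∧ meanCurvature S = H ∧
          ∃ φ : SpinorField σ, φ.Nontrivial ∧ φ.IsConstantR3 S,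
      ∃ φ : SpinorField σ, φ.Nontrivial ∧ φ.ConstNorm ∧ φ.IsDiracR3 H]) ∧
    -- immersions into the Heisenberg group
    (∀ τ : ℝ, τ ≠ 0 → ∀ S : Π x : M, TangentSpace (𝓡 2) x →L[ℝ] TangentSpace (𝓡 2) x,
      IsSymmetricField S → ∀ T : Π x : M, TangentSpace (𝓡 2) x, IsSmoothField T →
      ∀ lam : M → ℝ, ContMDiff (𝓡 2) 𝓘(ℝ, ℝ) ∞ lam → (∀ x, lam x ^ 2 + ‖T x‖ ^ 2 = 1) →
      List.TFAE [
        ∃ f nu : M → R3, IsImmersionNil3 o τ S T lam f nu,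
        DanielEquations o τ S T lam ∧
          ∃ φ : SpinorField σ, φ.Nontrivial ∧ φ.IsConstantNil3 τ S T lam,
        DanielEquations o τ S T lam ∧
          ∃ φ : SpinorField σ, φ.Nontrivial ∧ φ.ConstNorm ∧
            φ.IsDiracNil3 τ (meanCurvature S) T lam ∧ φ.DLambdaCondition τ T lam]) := by
  have : LocallyPathConnectedSpace M :=
    ChartedSpace.locallyPathConnectedSpace (EuclideanSpace ℝ (Fin 2)) M
  have hA : ∀ S : Π x : M, TangentSpace (𝓡 2) x →L[ℝ] TangentSpace (𝓡 2) x, IsSymmetricField S →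
      ((∃ f nu : M → R3, IsImmersionR3 o S f nu) ↔
        ∃ φ : SpinorField σ, φ.Nontrivial ∧ φ.IsConstantR3 S) := by
    intro S hS
    constructor
    · rintro ⟨f, nu, hf⟩
      obtain ⟨φ, hn, hc⟩ := (isImmersionR3_iff.1 hf).exists_isConstantNil3 σ (T := 0) (lam := 0)
        fun h => absurd rfl h
      exact ⟨φ, hn, SpinorField.isConstantR3_iff.2 hc⟩
    · rintro ⟨φ, hn, hc⟩
      have hc' := SpinorField.isConstantR3_iff.1 hc
      obtain ⟨c, -, hu⟩ := hn.exists_unitNorm hc'.constNorm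
      obtain ⟨f, nu, hf, -⟩ := (hc'.mulRight (c : ℍ[ℝ])).exists_isNilImmersion hu hS
        fun h => absurd rfl h
      exact ⟨f, nu, isImmersionR3_iff.2 hf⟩
  refine ⟨hA, fun H => ?_, fun τ hτ S hS T hT lam hl h1 => ?_⟩
  · tfae_have 1 ↔ 2 := by
      constructor
      · rintro ⟨S, hS, hH, h⟩
        exact ⟨S, hS, hH, (hA S hS).1 h⟩
      · rintro ⟨S, hS, hH, h⟩
        exact ⟨S, hS, hH, (hA S hS).2 h⟩
    tfae_have 2 → 3 := by
      rintro ⟨S, hS, rfl, φ, hn, hc⟩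
      have hc' := SpinorField.isConstantR3_iff.1 hc
      exact ⟨φ, hn, hc'.constNorm, SpinorField.isDiracR3_iff.2
        (hc'.isDiracNil3 hc'.constNorm hn hS fun h => absurd rfl h)⟩
    tfae_have 3 → 2 := by
      rintro ⟨φ, hn, hN, hD⟩
      obtain ⟨c, -, hu⟩ := hn.exists_unitNorm hN
      have hD' : (φ.mulRight (c : ℍ[ℝ])).IsDiracR3 H :=
        SpinorField.isDiracR3_iff.2 ((SpinorField.isDiracR3_iff.1 hD).mulRight _)
      obtain ⟨S, hS, hH, hc⟩ := hD'.exists_isConstantR3 hu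
      exact ⟨S, hS, hH, _, hu.nontrivial, hc⟩
    tfae_finish
  · tfae_have 1 → 2 := by
      rintro ⟨f, nu, hf⟩
      obtain ⟨hf, hv⟩ := isImmersionNil3_iff.1 hf
      exact ⟨hf.danielEquations hT hl hv, hf.exists_isConstantNil3 σ fun _ => hv⟩
    tfae_have 2 → 1 := by
      rintro ⟨hD, φ, hn, hc⟩
      obtain ⟨c, -, hu⟩ := hn.exists_unitNorm hc.constNorm
      -- The spinor is first scaled to norm 1, then rotated so that the vertical field becomes E₃.
      obtain ⟨ψ, hu', hc', hv⟩ := (hc.mulRight (c : ℍ[ℝ])).exists_vert_eq_omega2 hu hD hT hl h1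
      obtain ⟨f, nu, hf, hv'⟩ := hc'.exists_isNilImmersion hu' hS fun _ => hv
      exact ⟨f, nu, isImmersionNil3_iff.2 ⟨hf, hv' hτ⟩⟩
    tfae_have 2 → 3 := by
      rintro ⟨hD, φ, hn, hc⟩
      exact ⟨hD, φ, hn, hc.constNorm, hc.isDiracNil3 hc.constNorm hn hS fun _ => h1,
        hc.dLambdaCondition hc.constNorm hn hS hD⟩
    tfae_have 3 → 2 := by
      rintro ⟨hD, φ, hn, hN, hφ, hlam⟩
      obtain ⟨c, hc, hu⟩ := hn.exists_unitNorm hN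
      exact ⟨hD, _, hu.nontrivial, (hφ.mulRight _).isConstantNil3 hτ hS hT h1 hD hu
        (hlam.mulRight hN hn hc)⟩
    tfae_finish
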